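/- **Setting.** Consider a ring of $L$ sites $\mathbb Z/L$, with a finite-dimensional Hilbert space $\mathcal H_i$ at each site and $\mathcal H=\bigotimes_i\mathcal H_i$. An *interval* is a set of consecutive sites $\{a,a+1,\dots,a+n-1\}$. A *local circuit of depth $D$ and gate range $r$* is a product of (at most) $D$ layers, each layer being a product of unitary gates with pairwise disjoint supports, every gate being supported on an interval of at most $r$ sites; it is *inside* a region $M$ if these intervals lie in $M$. Let $G$ be a group and $U:G\to U(\mathcal H)$ a unitary representation such that every $U(g)$ is a local circuit of depth $D$ and gate range $r$. *Anomaly.* Let $M$ be an interval such that $M$ and its complement each have at least $100\,rD$ sites. A restriction of $U$ to $M$ consists of local circuits $U_M(g)$ inside $M$, of depth $D$ and gate range $r$, that act as $U(g)$ in the interior of $M$ (that is, $U_M(g)^{-1}U(g)$ acts trivially on all sites of $M$ at distance at least $4rD$ from the ends of $M$), together with unitaries $\Omega_L(g,h)$, $\Omega_R(g,h)$ supported on the first, respectively the last, $4rD$ sites of $M$, such that $U_M(g)U_M(h)=\Omega_L(g,h)\,\Omega_R(g,h)\,U_M(gh)$. The anomaly of $U$ is the class $[\omega]\in H^3(G,U(1))$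 (trivial action on $U(1)$) of a cocycle $\omega$ obtained from such a restriction by $$\omega(g,h,k)\,\Omega_L(g,h)\,\Omega_L(gh,k)=U_M(g)\,\Omega_L(h,k)\,U_M(g)^{-1}\,\Omega_L(g,hk)\qquad(g,h,k\in G).$$ *Separability.* For a partition of the ring into three non-empty regions $A,B,C$, a state (positive semidefinite operator of trace one) is tripartite separable with respect to $A,B,C$ if it is of the form $\sum_i p_i|A_i\rangle\langle A_i|\otimes|B_i\rangle\langle B_i|\otimes|C_i\rangle\langle C_i|$, a finite sum with $p_i\ge0$, $\sum_ip_i=1$ and unit vectors $|A_i\rangle,|B_i\rangle,|C_i\rangle$ in the Hilbert spaces of $A,B,C$. *Local channels.* A local channel of depth $D'$ and gate range $r'$ is a map $\mathcal E(\sigma)=\mathrm{Tr}_{\mathcal A}\big[V(\sigma\otimes|0\rangle\langle0|_{\mathcal A})V^\dagger\big]$, where $\mathcal A$ consists of a finite-dimensional ancilla added to each site, $|0\rangle_{\mathcal A}$ is a product state, and $V$ is a local circuit of depth $D'$ and gate range $r'$ on the ring of enlarged sites. **Theorem.** There is a universal constant $K$ such that the following holds for all $L$, $(\mathcal H_i)$,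 $G$, $r$, $D$ and $U$ as above. Suppose that the anomaly $[\omega]\in H^3(G,U(1))$ of $U$ is nontrivial, and let $\rho$ be a state that is strongly symmetric, i.e. $U(g)\rho\propto\rho$ for all $g\in G$. Then: 1. $\rho$ is not tripartite separable with respect to any partition of the ring into three intervals $A,B,C$ with $|A|,|B|,|C|\ge K\,rD$. 2. The tripartite entanglement of $\rho$ is long-ranged: for every local channel $\mathcal E$ of depth $D'$ and gate range $r'$, every partition of the ring into three intervals $A,B,C$ with $|A|,|B|,|C|\ge K\,(rD+r'D')$, and every state $\rho_{3s}$ that is tripartite separable with respect to $A,B,C$, one has $\rho\ne\mathcal E(\rho_{3s})$. -/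

import Mathlib

open scoped BigOperators ComplexOrder

noncomputable section

namespace SpinRing

/-! ### Operators on a ring of `L` sites

The sites of the ring are the elements of `ZMod L`; the site `i` carries the Hilbert space
`ℂ^(κ i)`.  The tensor product of all of them is the space of complex functions on the set of
configurations `x : ∀ i, κ i`, and operators are matrices indexed by configurations. -/

/-- Configurations: labels of the product basis of `⨂ i, ℂ^(κ i)`. -/
abbrev Config {L : ℕ} (κ : ZMod L → Type*) : Type _ := ∀ i : ZMod L, κ i

/-- Operators on `⨂ i, ℂ^(κ i)`. -/
abbrev Op {L : ℕ} (κ : ZMod L → Type*) : Type _ := Matrix (Config κ) (Config κ) ℂ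

/-- The arc `{a, a + 1, …, a + n - 1}` of `n` consecutive sites of the ring. -/
def arc {L : ℕ} (a : ZMod L) (n : ℕ) : Finset (ZMod L) :=
  (Finset.range n).image fun k : ℕ => a + (k : ZMod L)

/-- A connected region (interval) of the ring. -/
def IsInterval {L : ℕ} (S : Finset (ZMod L)) : Prop :=
  ∃ (a : ZMod L) (n : ℕ), S = arc a n

section Operators

variable {L : ℕ} [NeZero L] {κ : ZMod L → Type*} [∀ i, Fintype (κ i)] [∀ i, DecidableEq (κ i)]

/-- `M` is supported on `S`: it is of the form `T ⊗ 1`, with `T` acting on the sites in `S` and the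
identity on all other sites. -/
def SupportedOn (S : Finset (ZMod L)) (M : Op κ) : Prop :=
  ∃ T : Matrix (∀ i : S, κ i) (∀ i : S, κ i) ℂ, ∀ x y : Config κ,
    M x y = if ∀ i, i ∉ S → x i = y i then T (fun i => x i) (fun i => y i) else 0

/-- One layer of a local circuit inside the region `S`: a product of unitary gates with pairwise
disjoint supports, each supported on an arc of at most `r` consecutive sites of `S`. -/
def IsLayer (S : Finset (ZMod L)) (r : ℕ) (W : Op κ) : Prop :=
  ∃ (N : ℕ) (a : Fin N → ZMod L) (n : Fin N → ℕ)
    (u : Fin N → Matrix.unitaryGroup (Config κ) ℂ),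
    (∀ j, n j ≤ r ∧ arc (a j) (n j) ⊆ S ∧ SupportedOn (arc (a j) (n j)) (u j : Op κ)) ∧
    (∀ j j', j ≠ j' → Disjoint (arc (a j) (n j)) (arc (a j') (n j'))) ∧
    W = (List.ofFn fun j => (u j : Op κ)).prod

/-- `W` is a local unitary circuit inside the region `S`, of depth at most `D` and with gates of
range at most `r`. (A layer may be empty, so the depth is an upper bound.) -/
def IsCircuit (S : Finset (ZMod L)) (r : ℕ) : ℕ → Op κ → Prop
  | 0, W => W = 1
  | D + 1, W => ∃ V W' : Op κ, IsLayer S r V ∧ IsCircuit S r D W' ∧ W = V * W'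

/-! ### States, symmetry and separability -/

/-- Mixed states: positive semidefinite operators of trace one. -/
def IsState (ρ : Op κ) : Prop := ρ.PosSemidef ∧ ρ.trace = 1

/-- `ρ` is strongly symmetric: `U(g) ρ ∝ ρ` for every `g`. -/
def StronglySymmetric {G : Type*} [Group G] (U : G →* Matrix.unitaryGroup (Config κ) ℂ)
    (ρ : Op κ) : Prop :=
  ∀ g, ∃ c : ℂ, (U g : Op κ) * ρ = c • ρ

/-- `P` is a `k`-partition of the ring: non-empty, pairwise disjoint, covering. -/
def IsPartition {k : ℕ} (P : Fin k → Finset (ZMod L)) : Prop :=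
  (∀ j, (P j).Nonempty) ∧ (∀ j j', j ≠ j' → Disjoint (P j) (P j')) ∧ ∀ i, ∃ j, i ∈ P j

/-- `ψ = φ₁ ⊗ ⋯ ⊗ φₖ` with unit vectors `φⱼ` in the Hilbert space of the region `P j`. -/
def IsPureProduct {k : ℕ} (P : Fin k → Finset (ZMod L)) (ψ : Config κ → ℂ) : Prop :=
  ∃ φ : ∀ j : Fin k, (∀ i : P j, κ i) → ℂ,
    (∀ j, ∑ x, ‖φ j x‖ ^ 2 = 1) ∧ ∀ x, ψ x = ∏ j, φ j (fun i => x i)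

/-- `ρ` is separable with respect to `P`: a mixture `∑ α, p α |ψ α⟩⟨ψ α|` of pure product states
with respect to `P`. -/
def IsSeparable {k : ℕ} (P : Fin k → Finset (ZMod L)) (ρ : Op κ) : Prop :=
  ∃ (N : ℕ) (p : Fin N → ℝ) (ψ : Fin N → Config κ → ℂ),
    (∀ α, 0 ≤ p α) ∧ ∑ α, p α = 1 ∧ (∀ α, IsPureProduct P (ψ α)) ∧
    ρ = ∑ α, (p α : ℂ) • Matrix.vecMulVec (ψ α) (star (ψ α))

/-! ### Finite-depth local channels -/

/-- The operator `ρ ⊗ |e⟩⟨e|` on the ring in which the site `i` carries an additional ancilla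
`ℂ^(m i)`, where `|e⟩ = ⨂ i, |e i⟩` is a product basis state of the ancillas. -/
def adjoinAncilla {m : ZMod L → ℕ} (e : ∀ i, Fin (m i)) (ρ : Op κ) :
    Op (fun i => κ i × Fin (m i)) :=
  Matrix.of fun x y =>
    if (∀ i, (x i).2 = e i) ∧ (∀ i, (y i).2 = e i) then
      ρ (fun i => (x i).1) (fun i => (y i).1) else 0

/-- The partial trace over the ancillas. -/
def traceAncilla {m : ZMod L → ℕ} (M : Op (fun i => κ i × Fin (m i))) : Op κ :=
  Matrix.of fun x y => ∑ s : ∀ i, Fin (m i), M (fun i => (x i, s i)) (fun i => (y i, s i))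

/-- `E` is a local channel of depth at most `D` and gate range at most `r`: it adjoins to every
site a finite-dimensional ancilla, all of them in a product state, applies a local unitary circuit
to the enlarged ring, and traces out the ancillas. -/
def IsLocalChannel (r D : ℕ) (E : Op κ → Op κ) : Prop :=
  ∃ (m : ZMod L → ℕ) (e : ∀ i, Fin (m i)) (V : Op (fun i => κ i × Fin (m i))),
    IsCircuit Finset.univ r D V ∧
    ∀ ρ, E ρ = traceAncilla (V * adjoinAncilla e ρ * V.conjTranspose)

/-! ### The anomaly -/

/-- A restriction of the symmetry `U` (whose operators are circuits of depth at most `D` and gate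
range at most `r`) to an interval `M = arc a n`: local unitary circuits `UM g` inside `M` that act
as `U g` in the interior of `M`, together with the boundary operators `ΩL`, `ΩR` near the two
endpoints of `M` that measure the failure of `UM` to be a representation.  "Near" and "interior"
are understood at the scale `4 * (r * D)`, and both `M` and its complement are required to be long
on the scale `r * D`, the maximal distance over which a circuit can spread an operator. -/
structure SymmetryRestriction {G : Type*} [Group G] (r D : ℕ)
    (U : G →* Matrix.unitaryGroup (Config κ) ℂ) where
  /-- first site of `M` -/
  a : ZMod L
  /-- length of `M` -/
  n : ℕ
  long : 100 * (r * D) ≤ n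
  long_compl : n + 100 * (r * D) ≤ L
  /-- the restricted symmetry operators -/
  UM : G → Matrix.unitaryGroup (Config κ) ℂ
  isCircuit : ∀ g, IsCircuit (arc a n) r D (UM g : Op κ)
  /-- `UM g` acts as `U g` in the interior of `M`: the two differ by a unitary that is supported
  off the interior -/
  bulk : ∀ g, SupportedOn
    (Finset.univ \ arc (a + ((4 * (r * D) : ℕ) : ZMod L)) (n - 2 * (4 * (r * D))))
    (((UM g)⁻¹ * U g : Matrix.unitaryGroup (Config κ) ℂ) : Op κ)
  /-- boundary operators at the left endpoint -/
  ΩL : G → G → Matrix.unitaryGroup (Config κ) ℂ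
  /-- boundary operators at the right endpoint -/
  ΩR : G → G → Matrix.unitaryGroup (Config κ) ℂ
  suppL : ∀ g h, SupportedOn (arc a (4 * (r * D))) (ΩL g h : Op κ)
  suppR : ∀ g h, SupportedOn
    (arc (a + ((n - 4 * (r * D) : ℕ) : ZMod L)) (4 * (r * D))) (ΩR g h : Op κ)
  mul_eq : ∀ g h, UM g * UM h = ΩL g h * ΩR g h * UM (g * h)

end Operators

/-- `U(1)` as a trivial `G`-module, written additively. -/
abbrev trivialU1 (G : Type) [Group G] : Rep ℤ G := Rep.trivial ℤ G (Additive Circle)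

/-- The cohomology group `H³(G, U(1))`. -/
abbrev H3U1 (G : Type) [Group G] := groupCohomology (trivialU1 G) 3

/-- The class `c ∈ H³(G, U(1))` is the anomaly of the symmetry `U`: it is represented by the
cocycle `ω` that measures the failure of associativity of the boundary operators at one endpoint of
a restriction of `U` to an interval,
`ω(g,h,k) Ω(g,h) Ω(gh,k) = UM(g) Ω(h,k) UM(g)⁻¹ Ω(g,hk)`. -/
def IsAnomalyClass {L : ℕ} [NeZero L] {κ : ZMod L → Type*} [∀ i, Fintype (κ i)]
    [∀ i, DecidableEq (κ i)] {G : Type} [Group G] (r D : ℕ)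
    (U : G →* Matrix.unitaryGroup (Config κ) ℂ) (c : H3U1 G) : Prop :=
  ∃ (R : SymmetryRestriction r D U) (ω : (Fin 3 → G) → Additive Circle)
    (hω : inhomogeneousCochains.d (trivialU1 G) 3 ω = 0),
    (∀ g h k : G,
      ((Additive.toMul (ω ![g, h, k]) : Circle) : ℂ) •
          ((R.ΩL g h * R.ΩL (g * h) k : Matrix.unitaryGroup (Config κ) ℂ) : Op κ) =
        ((R.UM g * R.ΩL h k * (R.UM g)⁻¹ * R.ΩL g (h * k) :
          Matrix.unitaryGroup (Config κ) ℂ) : Op κ)) ∧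
    c = groupCohomology.π (trivialU1 G) 3 (groupCohomology.cocyclesMk ω hω)

end SpinRing

end

set_option linter.unusedSectionVars false

noncomputable section

namespace SpinRing

/-! ### Operators supported on a set of sites, described as commutants. -/

section Support

variable {L : ℕ} {κ : ZMod L → Type*}

/-! Suppose ρ is the image of a tripartite separable state under a local channel; the identity
channel gives the first part. Dilate the channel. Since U(g)ρ ∝ ρ and a sum of positive terms
vanishes only termwise, every pure state of the dilated mixture is an eigenvector of U(g) ⊗ 1
(`ancillaLift_mulVec_eq`). It remains to show: if U fixes, up to phases, a vector yψ with y a local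
circuit and ψ a product over three long arcs, then ω is a coboundary (`exists_cochain_of_fixed`).

Cut y and U(g) at the three points between the arcs (`IsCut`). The part of y on the arcs is absorbed
into ψ; conjugating U(g) by the rest gives x₀x₁x₂W, where x_j lives near cut j and W acts within the
arcs. Thus x₀x₁x₂ maps the product vector Wψ to a multiple of ψ. Three regions matter here: each cut
joins a different pair of them, so entanglement made at one cut cannot be undone at the others,
whereas for two regions both cuts join the same pair. A computation with purities makes this
precise: x₀⁻¹ψ is a product across cut 0 (`isProd_of_three_cuts`). By uniqueness of purifications
x₀⁻¹ then acts on ψ as a product of unitaries on the two sides (`exists_local_unitaries`). Changing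
U(g) near cut 0 accordingly gives S(g), which does not couple the two sides of that cut and still
has a common eigenvector for all g (`exists_local_symmetry`).

Consequently S(g)S(h) = X_A X_B S(gh) with X_A, X_B on the two sides of the cut
(`exists_local_mul`), and the common eigenvector is an eigenvector of X_A too
(`exists_smul_of_isProd`). Glue U_M, near the left end of M, to S, near the cut (`exists_glue`). The
result H(g) lives between these two points and satisfies H(g)H(h) = Ω_L X_A H(gh) up to a scalar
(`glue_mul`). Associativity of H makes the associators of Ω_L and X_A cancel; on the common
eigenvector the latter is the coboundary of the eigenvalues, hence so is ω
(`exists_cochain_of_glue`).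

Throughout, locality is handled by commutants, and `exists_factor` turns "conjugation preserves the
operators on a region" into a tensor factorization. -/

theorem piecewise_eq_right_of_agree {S : Finset (ZMod L)} {x y : Config κ}
    (h : ∀ i, i ∉ S → x i = y i) : S.piecewise y x = y := by
  funext i
  by_cases hi : i ∈ S <;> simp [hi, h]

variable [NeZero L] [∀ i, Fintype (κ i)] [∀ i, DecidableEq (κ i)]

/-- An operator is supported on `S` iff its entries vanish between configurations that differ
off `S` and do not depend on the common values off `S`. -/
theorem supportedOn_iff {S : Finset (ZMod L)} {M : Op κ} :
    SupportedOn S M ↔ (∀ x y, ∀ i ∉ S, x i ≠ y i → M x y = 0) ∧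
      ∀ x y z w, M (S.piecewise x z) (S.piecewise y z) = M (S.piecewise x w) (S.piecewise y w) := by
  constructor
  · rintro ⟨T, hT⟩
    refine ⟨fun x y i hi hxy => ?_, fun x y z w => ?_⟩
    · rw [hT, if_neg]
      exact fun h => hxy (h i hi)
    · rw [hT, hT, if_pos (fun i hi => by simp [hi]), if_pos (fun i hi => by simp [hi])]
      congr 1 <;> funext i <;> simp [i.2]
  · rintro ⟨h1, h2⟩
    by_cases hne : Nonempty (Config κ)
    · obtain ⟨z₀⟩ := hne
      let ext : (∀ i : S, κ i) → Config κ := fun a i => if h : i ∈ S then a ⟨i, h⟩ else z₀ i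
      refine ⟨fun a b => M (ext a) (ext b), fun x y => ?_⟩
      have hext : ∀ x : Config κ, ext (fun i => x i) = S.piecewise x z₀ := by
        intro x; funext i
        by_cases hi : i ∈ S <;> simp [ext, hi]
      show M x y = if _ then M (ext fun i => x i) (ext fun i => y i) else 0
      rw [hext, hext]
      split_ifs with h
      · rw [h2 x y z₀ x, Finset.piecewise_same, piecewise_eq_right_of_agree h]
      · push Not at h
        obtain ⟨i, hi, hxy⟩ := h
        exact h1 x y i hi hxy
    · exact ⟨0, fun x => (hne ⟨x⟩).elim⟩

/-- Each factor is diagonal outside its own region, so a single intermediate configuration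
contributes to an entry of either product: `y` on `S` and `x` elsewhere for `M * N`, the reverse for
`N * M`. -/
theorem SupportedOn.commute {S T : Finset (ZMod L)} (hST : Disjoint S T) {M N : Op κ}
    (hM : SupportedOn S M) (hN : SupportedOn T N) : M * N = N * M := by
  rw [supportedOn_iff] at hM hN
  obtain ⟨hM1, hM2⟩ := hM
  obtain ⟨hN1, hN2⟩ := hN
  have hd : ∀ i, i ∈ S → i ∉ T := fun i h h' => Finset.disjoint_left.mp hST h h'
  ext x y
  rw [Matrix.mul_apply, Matrix.mul_apply,
    Finset.sum_eq_single (S.piecewise y x), Finset.sum_eq_single (S.piecewise x y)]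
  · have e1 : M x (S.piecewise y x) = M (S.piecewise x y) y := by
      have := hM2 x y x y
      rwa [Finset.piecewise_same, Finset.piecewise_same] at this
    rw [e1, mul_comm]
    congr 1
    by_cases h : ∀ i, i ∉ S → i ∉ T → x i = y i
    · have a1 : S.piecewise y x = T.piecewise x y := by
        funext i
        by_cases hS : i ∈ S
        · simp [hS, hd i hS]
        · by_cases hT : i ∈ T <;> simp [hS, hT, h]
      have a2 : S.piecewise x y = T.piecewise y x := by
        funext i
        by_cases hS : i ∈ S
        · simp [hS, hd i hS]
        · by_cases hT : i ∈ T <;> simp [hS, hT, h]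
      rw [a1, a2]
      have := hN2 x y y x
      rwa [Finset.piecewise_same, Finset.piecewise_same] at this
    · push Not at h
      obtain ⟨i, hS, hT, hxy⟩ := h
      rw [hN1 _ _ i hT (by simpa [hS] using hxy), hN1 _ _ i hT (by simpa [hS] using hxy)]
  · intro z _ hz
    by_contra hne
    apply hz
    funext i
    by_cases hS : i ∈ S
    · simp only [hS, Finset.piecewise_eq_of_mem]
      by_contra hi
      exact hne (by rw [hN1 x z i (hd i hS) (Ne.symm hi), zero_mul])
    · simp only [hS, not_false_eq_true, Finset.piecewise_eq_of_notMem]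
      by_contra hi
      exact hne (by rw [hM1 z y i hS hi, mul_zero])
  · simp
  · intro z _ hz
    by_contra hne
    apply hz
    funext i
    by_cases hS : i ∈ S
    · simp only [hS, Finset.piecewise_eq_of_mem]
      by_contra hi
      exact hne (by rw [hN1 z y i (hd i hS) hi, mul_zero])
    · simp only [hS, not_false_eq_true, Finset.piecewise_eq_of_notMem]
      by_contra hi
      exact hne (by rw [hM1 x z i hS (Ne.symm hi), zero_mul])
  · simp

/-- Unitary operators on the ring. -/
abbrev UnitaryOp (κ : ZMod L → Type*) [∀ i, Fintype (κ i)] [∀ i, DecidableEq (κ i)] : Type _ :=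
  Matrix.unitaryGroup (Config κ) ℂ

/-- The diagonal reflection that changes the sign of the basis state `k` at the site `i`. -/
def siteSign (i : ZMod L) (k : κ i) : UnitaryOp κ :=
  ⟨Matrix.diagonal fun x => if x i = k then -1 else 1, by
    rw [Matrix.mem_unitaryGroup_iff, Matrix.star_eq_conjTranspose, Matrix.diagonal_conjTranspose,
      Matrix.diagonal_mul_diagonal, ← Matrix.diagonal_one]
    congr 1
    funext x
    by_cases h : x i = k <;> simp [h]⟩

theorem supportedOn_siteSign (i : ZMod L) (k : κ i) :
    SupportedOn {i} (siteSign i k : Op κ) := by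
  rw [supportedOn_iff]
  refine ⟨fun x y j _ hxy => Matrix.diagonal_apply_ne _ fun h => hxy (by rw [h]),
    fun x y z w => ?_⟩
  simp only [siteSign, Finset.piecewise_singleton, Matrix.diagonal_apply, Function.update_self]
  by_cases h : x i = y i
  · rw [h, if_pos rfl, if_pos rfl]
  · rw [if_neg, if_neg]
    · exact fun h' => h (by simpa using congrFun h' i)
    · exact fun h' => h (by simpa using congrFun h' i)

/-- The permutation of the configurations that applies `π` at the site `i`. -/
def sitePerm (i : ZMod L) (π : Equiv.Perm (κ i)) : Equiv.Perm (Config κ) where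
  toFun x := Function.update x i (π (x i))
  invFun x := Function.update x i (π.symm (x i))
  left_inv x := by simp
  right_inv x := by simp

/-- The permutation operator of `π` at the site `i`. -/
def sitePermOp (i : ZMod L) (π : Equiv.Perm (κ i)) : UnitaryOp κ :=
  ⟨(sitePerm i π).permMatrix ℂ, by
    rw [Matrix.mem_unitaryGroup_iff, Matrix.star_eq_conjTranspose, Matrix.conjTranspose_permMatrix,
      ← Matrix.permMatrix_mul]
    simp⟩

theorem sitePermOp_apply (i : ZMod L) (π : Equiv.Perm (κ i)) (x y : Config κ) :
    (sitePermOp i π : Op κ) x y = if Function.update x i (π (x i)) = y then 1 else 0 := by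
  simp [sitePermOp, sitePerm, Equiv.Perm.permMatrix, PEquiv.toMatrix_apply, Equiv.toPEquiv,
    eq_comm]

theorem supportedOn_sitePermOp (i : ZMod L) (π : Equiv.Perm (κ i)) :
    SupportedOn {i} (sitePermOp i π : Op κ) := by
  rw [supportedOn_iff]
  constructor
  · intro x y j hj hxy
    rw [sitePermOp_apply, if_neg]
    intro h
    apply hxy
    rw [← h, Function.update_of_ne (by simpa using hj)]
  · intro x y z w
    simp only [sitePermOp_apply, Finset.piecewise_singleton, Function.update_self,
      Function.update_idem]
    by_cases h : π (x i) = y i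
    · simp [h]
    · rw [if_neg, if_neg]
      · exact fun h' => h (by simpa using congrFun h' i)
      · exact fun h' => h (by simpa using congrFun h' i)

/-- An operator that commutes with all unitaries at the sites off `S` is supported on `S`. -/
theorem supportedOn_of_commute {S : Finset (ZMod L)} {M : Op κ}
    (h : ∀ i ∉ S, ∀ u : UnitaryOp κ, SupportedOn {i} (u : Op κ) → (u : Op κ) * M = M * u) :
    SupportedOn S M := by
  have hupd : ∀ i ∉ S, ∀ x y : Config κ, x i = y i → ∀ k : κ i,
      M (Function.update x i k) (Function.update y i k) = M x y := by
    intro i hi x y hxy k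
    -- Commutation with the swap of the levels `x i` and `k`, read at the entry `(x, update y i k)`.
    have := congrFun (congrFun (h i hi (sitePermOp i (Equiv.swap (x i) k))
      (supportedOn_sitePermOp _ _)) x) (Function.update y i k)
    rw [Matrix.mul_apply, Matrix.mul_apply, Finset.sum_eq_single (Function.update x i k),
      Finset.sum_eq_single y] at this
    · simpa [sitePermOp_apply, hxy] using this
    · intro z _ hz
      rw [sitePermOp_apply, if_neg, mul_zero]
      intro h'
      apply hz
      have h2 := congrFun h' i
      simp only [Function.update_self] at h2
      rw [hxy, Equiv.swap_apply_eq_iff, Equiv.swap_apply_right] at h2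
      funext j
      by_cases hj : j = i
      · subst hj; exact h2
      · simpa [hj] using congrFun h' j
    · simp
    · intro z _ hz
      rw [sitePermOp_apply, if_neg, zero_mul]
      simpa using hz.symm
    · simp
  rw [supportedOn_iff]
  constructor
  · intro x y i hi hxy
    -- The reflection has eigenvalue -1 on `x` and 1 on `y`, so the entry equals its own negative.
    have := congrFun (congrFun (h i hi (siteSign i (x i)) (supportedOn_siteSign _ _)) x) y
    simp only [siteSign, Matrix.diagonal_mul, Matrix.mul_diagonal, if_true,
      if_neg (Ne.symm hxy)] at this
    linear_combination (-1 / 2 : ℂ) * this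
  · have key : ∀ T : Finset (ZMod L), Disjoint T S → ∀ x y w : Config κ, (∀ i ∉ S, x i = y i) →
        M (T.piecewise w x) (T.piecewise w y) = M x y := by
      intro T
      induction T using Finset.induction_on with
      | empty => intro _ x y w _; simp
      | insert i T hiT ih =>
        intro hT x y w hxy
        rw [Finset.disjoint_insert_left] at hT
        rw [Finset.piecewise_insert, Finset.piecewise_insert, hupd i hT.1, ih hT.2 x y w hxy]
        simp [hiT, hxy i hT.1]
    intro x y z w
    have := key Sᶜ disjoint_compl_left (S.piecewise x z) (S.piecewise y z) w
      (fun i hi => by simp [hi])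
    rw [← this]
    congr 1 <;> funext i <;> by_cases hi : i ∈ S <;> simp [hi]

/-- The group of unitaries supported on `X`. -/
def loc (κ : ZMod L → Type*) [∀ i, Fintype (κ i)] [∀ i, DecidableEq (κ i)]
    (X : Finset (ZMod L)) : Subgroup (UnitaryOp κ) :=
  -- As a centralizer this is a subgroup for free, and membership is tested one site off `X` at a
  -- time; `mem_loc_iff` recovers the support.
  Subgroup.centralizer {u | ∃ i ∉ X, SupportedOn {i} (u : Op κ)}

theorem mem_loc_iff {X : Finset (ZMod L)} {u : UnitaryOp κ} :
    u ∈ loc κ X ↔ SupportedOn X (u : Op κ) := by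
  rw [loc, Subgroup.mem_centralizer_iff]
  constructor
  · intro h
    refine supportedOn_of_commute fun i hi v hv => ?_
    exact congrArg Subtype.val (h v ⟨i, hi, hv⟩)
  · rintro h v ⟨i, hi, hv⟩
    exact Subtype.ext (hv.commute (by simpa using hi) h)

theorem mem_loc_of_commute {X : Finset (ZMod L)} {u : UnitaryOp κ}
    (h : ∀ i ∉ X, ∀ v ∈ loc κ {i}, v * u = u * v) : u ∈ loc κ X := by
  rw [loc, Subgroup.mem_centralizer_iff]
  rintro v ⟨i, hi, hv⟩
  exact h i hi v (mem_loc_iff.2 hv)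

theorem loc_comm {X Y : Finset (ZMod L)} (h : Disjoint X Y) {u v : UnitaryOp κ}
    (hu : u ∈ loc κ X) (hv : v ∈ loc κ Y) : u * v = v * u :=
  Subtype.ext ((mem_loc_iff.1 hu).commute h (mem_loc_iff.1 hv))

theorem loc_mono {X Y : Finset (ZMod L)} (h : X ⊆ Y) : loc κ X ≤ loc κ Y :=
  fun _ hu => mem_loc_of_commute fun _ hi _ hv =>
    (loc_comm (by simpa using fun h' => hi (h h')) hu hv).symm

theorem mem_loc_inter {X Y : Finset (ZMod L)} {u : UnitaryOp κ} (hX : u ∈ loc κ X)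
    (hY : u ∈ loc κ Y) : u ∈ loc κ (X ∩ Y) :=
  mem_loc_of_commute fun i hi v hv => by
    rw [Finset.mem_inter, not_and_or] at hi
    rcases hi with hi | hi
    · exact (loc_comm (by simpa using hi) hX hv).symm
    · exact (loc_comm (by simpa using hi) hY hv).symm


theorem exists_smul_one_of_supportedOn_empty {M : Op κ} (h : SupportedOn ∅ M) :
    ∃ z : ℂ, M = z • (1 : Op κ) := by
  obtain ⟨T, hT⟩ := h
  refine ⟨T (fun i => absurd i.2 (Finset.notMem_empty _))
    (fun i => absurd i.2 (Finset.notMem_empty _)), ?_⟩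
  ext x y
  rw [hT, Matrix.smul_apply, Matrix.one_apply]
  by_cases hxy : x = y
  · subst hxy
    simp only [Finset.notMem_empty, not_false_eq_true, implies_true, if_true, smul_eq_mul, mul_one]
    congr 1 <;> funext i <;> exact absurd i.2 (Finset.notMem_empty _)
  · rw [if_neg, if_neg hxy, smul_zero]
    exact fun h => hxy (funext fun i => h i (Finset.notMem_empty _))

end Support

/-! ### Unitaries that preserve a tensor factor split. -/

section Factor

variable {L : ℕ} {κ : ZMod L → Type*} [NeZero L] [∀ i, Fintype (κ i)] [∀ i, DecidableEq (κ i)]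

theorem SupportedOn.conjTranspose {S : Finset (ZMod L)} {M : Op κ} (h : SupportedOn S M) :
    SupportedOn S M.conjTranspose := by
  rw [supportedOn_iff] at h ⊢
  refine ⟨fun x y i hi hxy => ?_, fun x y z w => ?_⟩
  · rw [Matrix.conjTranspose_apply, h.1 y x i hi (Ne.symm hxy), star_zero]
  · rw [Matrix.conjTranspose_apply, Matrix.conjTranspose_apply, h.2 y x z w]

theorem SupportedOn.smul {S : Finset (ZMod L)} {M : Op κ} (h : SupportedOn S M) (c : ℂ) :
    SupportedOn S (c • M) := by
  rw [supportedOn_iff] at h ⊢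
  refine ⟨fun x y i hi hxy => ?_, fun x y z w => ?_⟩
  · rw [Matrix.smul_apply, h.1 x y i hi hxy, smul_zero]
  · rw [Matrix.smul_apply, Matrix.smul_apply, h.2 x y z w]

theorem SupportedOn.transpose {S : Finset (ZMod L)} {M : Op κ} (h : SupportedOn S M) :
    SupportedOn S M.transpose := by
  rw [supportedOn_iff] at h ⊢
  exact ⟨fun x y i hi hxy => h.1 y x i hi (Ne.symm hxy), fun x y z w => h.2 y x z w⟩

/-- Contraction with an operator on `S` only moves the coordinates in `S`, so the frozen ones may be
changed from those of `y` to those of `l`. This reindexing underlies `slice_mul` and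
`mulVec_piecewise`. -/
theorem SupportedOn.sum_mul_eq {S : Finset (ZMod L)} {N : Op κ} (hN : SupportedOn S N)
    (g : Config κ → ℂ) (y l : Config κ) :
    ∑ z : Config κ, (if ∀ i, i ∉ S → z i = y i then g (S.piecewise z l) else 0) * N z y =
      ∑ z : Config κ, g z * N z (S.piecewise y l) := by
  rw [supportedOn_iff] at hN
  simp only [ite_mul, zero_mul]
  rw [← Finset.sum_filter]
  have hr : ∑ z : Config κ, g z * N z (S.piecewise y l) =
      ∑ z ∈ Finset.univ.filter (fun z : Config κ => ∀ i, i ∉ S → z i = l i),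
        g z * N z (S.piecewise y l) := by
    symm
    apply Finset.sum_filter_of_ne
    intro z _ hz i hi
    by_contra hne
    exact hz (by rw [hN.1 _ _ i hi (by simpa [hi] using hne), mul_zero])
  rw [hr]
  refine Finset.sum_nbij' (fun z => S.piecewise z l) (fun z => S.piecewise z y) ?_ ?_ ?_ ?_ ?_
  · intro z _
    simp only [Finset.mem_filter, Finset.mem_univ, true_and]
    intro i hi
    simp [hi]
  · intro z _
    simp only [Finset.mem_filter, Finset.mem_univ, true_and]
    intro i hi
    simp [hi]
  · intro z hz
    simp only [Finset.mem_filter, Finset.mem_univ, true_and] at hz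
    funext i
    by_cases hi : i ∈ S <;> simp [hi, hz]
  · intro z hz
    simp only [Finset.mem_filter, Finset.mem_univ, true_and] at hz
    funext i
    by_cases hi : i ∈ S <;> simp [hi, hz]
  · intro z hz
    simp only [Finset.mem_filter, Finset.mem_univ, true_and] at hz
    congr 1
    have := hN.2 z y y l
    rwa [Finset.piecewise_same, piecewise_eq_right_of_agree (fun i hi => (hz i hi).symm)] at this

/-- The operator on `S` obtained from `M` by fixing the matrix indices off `S`. -/
def slice (S : Finset (ZMod L)) (M : Op κ) (k l : Config κ) : Op κ :=
  Matrix.of fun x y =>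
    if ∀ i, i ∉ S → x i = y i then M (S.piecewise x k) (S.piecewise y l) else 0

theorem slice_apply (S : Finset (ZMod L)) (M : Op κ) (k l x y : Config κ) :
    slice S M k l x y =
      if ∀ i, i ∉ S → x i = y i then M (S.piecewise x k) (S.piecewise y l) else 0 := rfl

theorem supportedOn_slice (S : Finset (ZMod L)) (M : Op κ) (k l : Config κ) :
    SupportedOn S (slice S M k l) := by
  rw [supportedOn_iff]
  refine ⟨fun x y i hi hxy => ?_, fun x y z w => ?_⟩
  · rw [slice_apply, if_neg]
    exact fun h => hxy (h i hi)
  · rw [slice_apply, slice_apply, if_pos (fun i hi => by simp [hi]),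
      if_pos (fun i hi => by simp [hi])]
    congr 1 <;> funext i <;> by_cases hi : i ∈ S <;> simp [hi]

/-- The indices frozen in a slice lie off `S`, where `N` is the identity. With `mul_slice`, slicing
is a bimodule map over the operators on `S`, which is how `exists_factor` uses it. -/
theorem slice_mul {S : Finset (ZMod L)} (M : Op κ) {N : Op κ} (hN : SupportedOn S N)
    (k l : Config κ) : slice S M k l * N = slice S (M * N) k l := by
  ext x y
  rw [slice_apply, Matrix.mul_apply]
  split_ifs with h
  · rw [Matrix.mul_apply, ← hN.sum_mul_eq]
    refine Finset.sum_congr rfl fun z _ => ?_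
    rw [slice_apply]
    congr 1
    refine if_congr ?_ rfl rfl
    constructor
    · exact fun h' i hi => by rw [← h' i hi, h i hi]
    · exact fun h' i hi => by rw [h' i hi, h i hi]
  · push Not at h
    obtain ⟨i, hi, hxy⟩ := h
    refine Finset.sum_eq_zero fun z _ => ?_
    rw [supportedOn_iff] at hN
    by_cases hz : z i = y i
    · rw [slice_apply, if_neg, zero_mul]
      exact fun h' => hxy ((h' i hi).trans hz)
    · rw [hN.1 z y i hi hz, mul_zero]

theorem slice_transpose (S : Finset (ZMod L)) (M : Op κ) (k l : Config κ) :
    (slice S M k l).transpose = slice S M.transpose l k := by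
  ext x y
  rw [Matrix.transpose_apply, slice_apply, slice_apply, Matrix.transpose_apply]
  exact if_congr ⟨fun h i hi => (h i hi).symm, fun h i hi => (h i hi).symm⟩ rfl rfl

theorem mul_slice {S : Finset (ZMod L)} (M : Op κ) {N : Op κ} (hN : SupportedOn S N)
    (k l : Config κ) : N * slice S M k l = slice S (N * M) k l := by
  apply Matrix.transpose_injective
  rw [Matrix.transpose_mul, slice_transpose, slice_mul _ hN.transpose, slice_transpose,
    Matrix.transpose_mul]

/-- A unitary whose conjugation preserves the operators on `S` is a product of a unitary on `S` and
a unitary on the complement of `S`. -/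
theorem exists_factor {S : Finset (ZMod L)} {T : UnitaryOp κ}
    (h : ∀ v ∈ loc κ S, T * v * T⁻¹ ∈ loc κ S) :
    ∃ τ ∈ loc κ S, τ⁻¹ * T ∈ loc κ Sᶜ := by
  by_cases hne : Nonempty (Config κ)
  swap
  · rw [not_nonempty_iff] at hne
    exact ⟨1, one_mem _, by
      rw [show (1 : UnitaryOp κ)⁻¹ * T = 1 from Subtype.ext (Subsingleton.elim _ _)]
      exact one_mem _⟩
  -- A nonzero entry of `T` selects a nonzero slice, the candidate for the factor on `S`.
  obtain ⟨k, l, hkl⟩ : ∃ k l, (T : Op κ) k l ≠ 0 := by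
    by_contra hcon
    push Not at hcon
    have h0 : (T : Op κ) = 0 := by ext x y; exact hcon x y
    have h1 := Unitary.coe_star_mul_self T
    rw [h0, mul_zero] at h1
    exact zero_ne_one h1
  set τ : Op κ := slice S (T : Op κ) k l with hτ
  have hτS : SupportedOn S τ := supportedOn_slice _ _ _ _
  -- Slice the identity `T v = (T v T⁻¹) T`, in which both `v` and `T v T⁻¹` act on `S`.
  have inter : ∀ v ∈ loc κ S, τ * (v : Op κ) = ((T * v * T⁻¹ : UnitaryOp κ) : Op κ) * τ := by
    intro v hv
    rw [hτ, slice_mul _ (mem_loc_iff.1 hv), mul_slice _ (mem_loc_iff.1 (h v hv)),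
      ← Submonoid.coe_mul, ← Submonoid.coe_mul, inv_mul_cancel_right]
  have inter' : ∀ v ∈ loc κ S,
      (v : Op κ) * τ.conjTranspose =
        τ.conjTranspose * ((T * v * T⁻¹ : UnitaryOp κ) : Op κ) := by
    intro v hv
    have := congrArg Matrix.conjTranspose (inter v⁻¹ (inv_mem hv))
    rw [Matrix.conjTranspose_mul, Matrix.conjTranspose_mul] at this
    have e : T * v⁻¹ * T⁻¹ = (T * v * T⁻¹)⁻¹ := by group
    rw [e] at this
    simpa [← Matrix.star_eq_conjTranspose] using this
  -- Schur's lemma: `τᴴ τ` commutes with operators on `S` by the intertwining relations and with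
  -- those off `S` by its support, so it is a scalar and a multiple of `τ` is unitary.
  obtain ⟨z, hz⟩ : ∃ z : ℂ, τ.conjTranspose * τ = z • (1 : Op κ) := by
    apply exists_smul_one_of_supportedOn_empty
    apply supportedOn_of_commute
    intro i _ u hu
    by_cases hi : i ∈ S
    · have huS : u ∈ loc κ S :=
        loc_mono (Finset.singleton_subset_iff.2 hi) (mem_loc_iff.2 hu)
      rw [← mul_assoc, inter' u huS, Matrix.mul_assoc, ← inter u huS, Matrix.mul_assoc]
    · have hd : Disjoint {i} S := by simpa using hi
      rw [← mul_assoc, hu.commute hd hτS.conjTranspose, mul_assoc, hu.commute hd hτS, mul_assoc]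
  have hz' : z = ((∑ x, ‖τ x l‖ ^ 2 : ℝ) : ℂ) := by
    have := congrFun (congrFun hz l) l
    rw [Matrix.smul_apply, Matrix.one_apply_eq, smul_eq_mul, mul_one, Matrix.mul_apply] at this
    rw [← this]
    push_cast
    refine Finset.sum_congr rfl fun x _ => ?_
    rw [Matrix.conjTranspose_apply]
    exact RCLike.conj_mul _
  have hpos : 0 < ∑ x, ‖τ x l‖ ^ 2 := by
    have hx : τ (S.piecewise k l) l = (T : Op κ) k l := by
      rw [hτ, slice_apply, if_pos (fun i hi => by simp [hi])]
      rw [Finset.piecewise_same, Finset.piecewise_piecewise_of_subset_left (Finset.Subset.refl S),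
        Finset.piecewise_same]
    refine lt_of_lt_of_le ?_ (Finset.single_le_sum (f := fun x => ‖τ x l‖ ^ 2)
      (fun x _ => by positivity) (Finset.mem_univ (S.piecewise k l)))
    have : 0 < ‖(T : Op κ) k l‖ := norm_pos_iff.2 hkl
    simp only [hx]
    positivity
  set q : ℝ := ∑ x, ‖τ x l‖ ^ 2 with hq
  set c : ℂ := (((Real.sqrt q)⁻¹ : ℝ) : ℂ) with hc
  have hcc : star c * c * z = 1 := by
    rw [hz', hc, Complex.star_def, Complex.conj_ofReal, ← Complex.ofReal_mul, ← Complex.ofReal_mul,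
      ← mul_inv, Real.mul_self_sqrt hpos.le, inv_mul_cancel₀ hpos.ne', Complex.ofReal_one]
  let τ' : UnitaryOp κ := ⟨c • τ, by
    rw [Matrix.mem_unitaryGroup_iff', Matrix.star_eq_conjTranspose, Matrix.conjTranspose_smul,
      Matrix.smul_mul, Matrix.mul_smul, hz, smul_smul, smul_smul, hcc, one_smul]⟩
  refine ⟨τ', mem_loc_iff.2 (hτS.smul c), mem_loc_of_commute fun i hi v hv => ?_⟩
  have hvS : v ∈ loc κ S := loc_mono (by simpa using hi) hv
  -- `τ'` and `T` conjugate the operators on `S` alike, so `τ'⁻¹ T` commutes with them.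
  have e1 : τ' * v = T * v * T⁻¹ * τ' := by
    apply Subtype.ext
    show c • τ * (v : Op κ) = ((T * v * T⁻¹ : UnitaryOp κ) : Op κ) * (c • τ)
    rw [Matrix.smul_mul, Matrix.mul_smul, inter v hvS]
  have e2 : v = τ'⁻¹ * (T * v * T⁻¹) * τ' := by rw [mul_assoc, ← e1]; group
  calc v * (τ'⁻¹ * T) = τ'⁻¹ * (T * v * T⁻¹) * τ' * (τ'⁻¹ * T) := by rw [← e2]
    _ = τ'⁻¹ * T * v := by group

end Factor

/-! ### Arcs in integer coordinates. -/

section Geometry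

/-- The set of sites with a coordinate in the integer interval `[l, h)`. -/
def seg (L : ℕ) (l h : ℤ) : Finset (ZMod L) := (Finset.Ico l h).image fun k : ℤ => (k : ZMod L)

variable {L : ℕ}

theorem mem_seg {l h : ℤ} {j : ZMod L} :
    j ∈ seg L l h ↔ ∃ k : ℤ, l ≤ k ∧ k < h ∧ (k : ZMod L) = j := by
  simp [seg, and_assoc]

theorem intCast_mem_seg {l h k : ℤ} (h₁ : l ≤ k) (h₂ : k < h) : (k : ZMod L) ∈ seg L l h :=
  mem_seg.2 ⟨k, h₁, h₂, rfl⟩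

theorem seg_mono {l h l' h' : ℤ} (h₁ : l' ≤ l) (h₂ : h ≤ h') : seg L l h ⊆ seg L l' h' := by
  intro j hj
  obtain ⟨k, hk1, hk2, rfl⟩ := mem_seg.1 hj
  exact intCast_mem_seg (h₁.trans hk1) (hk2.trans_le h₂)

theorem eq_of_intCast_eq {k k' : ℤ} (h : (k : ZMod L) = k') (h₁ : k - k' < L) (h₂ : k' - k < L) :
    k = k' := by
  rw [← sub_eq_zero, ← Int.cast_sub, ZMod.intCast_zmod_eq_zero_iff_dvd] at h
  have := Int.eq_zero_of_abs_lt_dvd h (abs_lt.2 ⟨by linarith, h₁⟩)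
  linarith

/-- `H₁` and `H₂` keep the two coordinate ranges from meeting around the back of the ring, so a
common site has a common coordinate. -/
theorem seg_inter_subset {l₁ h₁ l₂ h₂ l h : ℤ} (H₁ : h₁ ≤ l₂ + L) (H₂ : h₂ ≤ l₁ + L)
    (hl : l ≤ l₁ ∨ l ≤ l₂) (hh : h₁ ≤ h ∨ h₂ ≤ h) :
    seg L l₁ h₁ ∩ seg L l₂ h₂ ⊆ seg L l h := by
  intro j hj
  rw [Finset.mem_inter, mem_seg, mem_seg] at hj
  obtain ⟨⟨k, hk1, hk2, rfl⟩, k', hk1', hk2', hkk⟩ := hj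
  obtain rfl := eq_of_intCast_eq hkk (by omega) (by omega)
  exact intCast_mem_seg (by omega) (by omega)

theorem seg_disjoint {l₁ h₁ l₂ h₂ : ℤ} (H₁ : h₁ ≤ l₂) (H₂ : h₂ ≤ l₁ + L) :
    Disjoint (seg L l₁ h₁) (seg L l₂ h₂) := by
  rw [Finset.disjoint_left]
  intro j hj hj'
  obtain ⟨k, hk1, hk2, rfl⟩ := mem_seg.1 hj
  obtain ⟨k', hk1', hk2', hkk⟩ := mem_seg.1 hj'
  have := eq_of_intCast_eq hkk (by omega) (by omega)
  omega

theorem seg_period (l h : ℤ) : seg L (l + L) (h + L) = seg L l h := by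
  ext j
  rw [mem_seg, mem_seg]
  constructor
  · rintro ⟨k, h1, h2, rfl⟩
    exact ⟨k - L, by omega, by omega, by simp⟩
  · rintro ⟨k, h1, h2, rfl⟩
    exact ⟨k + L, by omega, by omega, by simp⟩

theorem exists_coord [NeZero L] (l : ℤ) (j : ZMod L) :
    ∃ k : ℤ, l ≤ k ∧ k < l + L ∧ (k : ZMod L) = j := by
  have hL : (0 : ℤ) < L := by exact_mod_cast NeZero.pos L
  refine ⟨l + ((j.val : ℤ) - l) % L, ?_, ?_, ?_⟩
  · have := Int.emod_nonneg ((j.val : ℤ) - l) hL.ne'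
    omega
  · have := Int.emod_lt_of_pos ((j.val : ℤ) - l) hL
    omega
  · have h1 : ((((j.val : ℤ) - l) % L : ℤ) : ZMod L) = (((j.val : ℤ) - l : ℤ) : ZMod L) := by
      rw [ZMod.intCast_mod]
    rw [Int.cast_add, h1]
    simp

theorem seg_union {l m h : ℤ} (h₁ : l ≤ m) (h₂ : m ≤ h) :
    seg L l h = seg L l m ∪ seg L m h := by
  ext j
  rw [Finset.mem_union, mem_seg, mem_seg, mem_seg]
  constructor
  · rintro ⟨k, h1, h2, rfl⟩
    rcases lt_or_ge k m with hk | hk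
    · exact Or.inl ⟨k, h1, hk, rfl⟩
    · exact Or.inr ⟨k, hk, h2, rfl⟩
  · rintro (⟨k, h1, h2, rfl⟩ | ⟨k, h1, h2, rfl⟩)
    · exact ⟨k, h1, h2.trans_le h₂, rfl⟩
    · exact ⟨k, h₁.trans h1, h2, rfl⟩

theorem seg_eq_univ [NeZero L] (l : ℤ) : seg L l (l + L) = Finset.univ :=
  Finset.eq_univ_iff_forall.2 fun j => mem_seg.2 (exists_coord l j)

theorem seg_compl [NeZero L] {l h : ℤ} (h₁ : l ≤ h) (h₂ : h ≤ l + L) :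
    (seg L l h)ᶜ = seg L h (l + L) := by
  rw [eq_comm, eq_compl_iff_isCompl, isCompl_iff]
  refine ⟨(seg_disjoint le_rfl le_rfl).symm, ?_⟩
  rw [codisjoint_iff, sup_comm, Finset.sup_eq_union, ← seg_union h₁ h₂, seg_eq_univ]
  rfl

theorem arc_intCast (a : ℤ) (n : ℕ) : arc (a : ZMod L) n = seg L a (a + n) := by
  ext j
  rw [mem_seg, arc, Finset.mem_image]
  constructor
  · rintro ⟨k, hk, rfl⟩
    rw [Finset.mem_range] at hk
    exact ⟨a + k, by omega, by omega, by simp⟩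
  · rintro ⟨k, h1, h2, rfl⟩
    refine ⟨(k - a).toNat, by rw [Finset.mem_range]; omega, ?_⟩
    have : (((k - a).toNat : ℤ) : ZMod L) = ((k - a : ℤ) : ZMod L) := by
      rw [Int.toNat_of_nonneg (by omega)]
    rw [Int.cast_natCast] at this
    rw [this]
    simp

theorem seg_succ (k : ℤ) : seg L k (k + 1) = {(k : ZMod L)} := by
  have : Finset.Ico k (k + 1) = {k} := by ext; simp; omega
  rw [seg, this, Finset.image_singleton]

end Geometry

/-! ### How conjugation by a unitary moves supports. -/

section Maps

variable {L : ℕ} {κ : ZMod L → Type*} [NeZero L] [∀ i, Fintype (κ i)] [∀ i, DecidableEq (κ i)]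

theorem loc_conj_eq {X Y : Finset (ZMod L)} (h : Disjoint X Y) {u v : UnitaryOp κ}
    (hu : u ∈ loc κ X) (hv : v ∈ loc κ Y) : u * v * u⁻¹ = v := by
  rw [loc_comm h hu hv, mul_inv_cancel_right]

theorem mem_loc_of_subset_inter {X Y Z : Finset (ZMod L)} {u : UnitaryOp κ} (hX : u ∈ loc κ X)
    (hY : u ∈ loc κ Y) (h : X ∩ Y ⊆ Z) : u ∈ loc κ Z :=
  loc_mono h (mem_loc_inter hX hY)

theorem loc_univ (u : UnitaryOp κ) : u ∈ loc κ Finset.univ :=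
  mem_loc_of_commute fun i hi => absurd (Finset.mem_univ i) hi

/-- Conjugation by `T` maps the operators on `I` to operators on `J`. -/
def Maps (T : UnitaryOp κ) (I J : Finset (ZMod L)) : Prop :=
  ∀ v ∈ loc κ I, T * v * T⁻¹ ∈ loc κ J

/-- By commutants: for `w` at a site off `J`, `T⁻¹ w T` commutes with every site of `I`, so it is
supported off `I` and commutes with `v`. This avoids decomposing `v` into single-site operators. -/
theorem maps_of_sites {T : UnitaryOp κ} {I J : Finset (ZMod L)}
    (h : ∀ i ∈ I, Maps T {i} J) : Maps T I J := by
  intro v hv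
  refine mem_loc_of_commute fun j hj w hw => ?_
  have h1 : T⁻¹ * w * T ∈ loc κ Iᶜ := by
    refine mem_loc_of_commute fun i hi u hu => ?_
    have hi' : i ∈ I := by simpa using hi
    have := loc_comm (by simpa using hj) (h i hi' u hu) hw
    calc u * (T⁻¹ * w * T) = T⁻¹ * (T * u * T⁻¹ * w) * T := by group
      _ = T⁻¹ * w * T * u := by rw [this]; group
  have h2 := loc_comm disjoint_compl_left h1 hv
  calc w * (T * v * T⁻¹) = T * (T⁻¹ * w * T * v) * T⁻¹ := by group
    _ = T * v * T⁻¹ * w := by rw [h2]; group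

/-- Operators off `J` commute with the images of the operators on `I`; pulled back by `T`, they
commute with `I` itself. -/
theorem Maps.inv {T : UnitaryOp κ} {I J : Finset (ZMod L)} (h : Maps T I J) :
    Maps T⁻¹ Jᶜ Iᶜ := by
  intro w hw
  refine mem_loc_of_commute fun i hi u hu => ?_
  have hu' : u ∈ loc κ I := loc_mono (by simpa using hi) hu
  have := loc_comm disjoint_compl_right (h u hu') hw
  calc u * (T⁻¹ * w * T⁻¹⁻¹) = T⁻¹ * (T * u * T⁻¹ * w) * T := by group
    _ = T⁻¹ * w * T⁻¹⁻¹ * u := by rw [this]; group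

theorem Maps.comp {T T' : UnitaryOp κ} {I J K : Finset (ZMod L)} (h : Maps T J K)
    (h' : Maps T' I J) : Maps (T * T') I K := by
  intro v hv
  have := h _ (h' v hv)
  rwa [show T * (T' * v * T'⁻¹) * T⁻¹ = T * T' * v * (T * T')⁻¹ by group] at this

theorem Maps.mono {T : UnitaryOp κ} {I J I' J' : Finset (ZMod L)} (h : Maps T I J) (hI : I' ⊆ I)
    (hJ : J ⊆ J') : Maps T I' J' :=
  fun v hv => loc_mono hJ (h v (loc_mono hI hv))

theorem Maps.inter {T : UnitaryOp κ} {I J J' Z : Finset (ZMod L)} (h : Maps T I J)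
    (h' : Maps T I J') (hZ : J ∩ J' ⊆ Z) : Maps T I Z :=
  fun v hv => mem_loc_of_subset_inter (h v hv) (h' v hv) hZ

theorem maps_of_disjoint {T : UnitaryOp κ} {X I : Finset (ZMod L)} (hT : T ∈ loc κ X)
    (h : Disjoint X I) : Maps T I I :=
  fun v hv => by rwa [loc_conj_eq h hT hv]

theorem maps_of_mem {T : UnitaryOp κ} {X I J : Finset (ZMod L)} (hT : T ∈ loc κ X)
    (hX : X ⊆ J) (hI : I ⊆ J) : Maps T I J :=
  fun _ hv => mul_mem (mul_mem (loc_mono hX hT) (loc_mono hI hv)) (inv_mem (loc_mono hX hT))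

/-- Conjugation by `T` spreads operators by at most `s` sites. -/
def Spreads (s : ℕ) (T : UnitaryOp κ) : Prop :=
  ∀ k : ℤ, Maps T (seg L k (k + 1)) (seg L (k - s) (k + s + 1))

theorem Spreads.maps {s : ℕ} {T : UnitaryOp κ} (h : Spreads s T) (l m : ℤ) :
    Maps T (seg L l m) (seg L (l - s) (m + s)) := by
  refine maps_of_sites fun i hi => ?_
  obtain ⟨k, hk1, hk2, rfl⟩ := mem_seg.1 hi
  rw [← seg_succ]
  exact (h k).mono subset_rfl (seg_mono (by omega) (by omega))

/-- Apply `Maps.inv` to the arc complementary to the target. If `2 * s + 1` exceeds `L`, the target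
is the whole ring and nothing needs proof. -/
theorem Spreads.inv {s : ℕ} {T : UnitaryOp κ} (h : Spreads s T) : Spreads s T⁻¹ := by
  intro k
  by_cases hL : (2 * s + 1 : ℤ) ≤ L
  · have := (h.maps (k + s + 1) (k - s + L)).inv
    refine this.mono ?_ ?_
    · rw [seg_compl (by omega) (by omega)]
      have := seg_period (L := L) k (k + 1)
      rw [← this]
      exact seg_mono (by omega) (by omega)
    · rw [seg_compl (by omega) (by omega)]
      have := seg_period (L := L) (k - s) (k + s + 1)
      rw [← this]
  · intro v _
    refine loc_mono ?_ (loc_univ _)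
    rw [← seg_eq_univ (k - s)]
    exact seg_mono le_rfl (by omega)

theorem Spreads.mul {s t : ℕ} {T T' : UnitaryOp κ} (h : Spreads s T) (h' : Spreads t T') :
    Spreads (s + t) (T * T') := by
  intro k
  refine ((h.maps _ _).comp (h' k)).mono subset_rfl (seg_mono ?_ ?_) <;> push_cast <;> omega

theorem spreads_one : Spreads 0 (1 : UnitaryOp κ) := by
  intro k v hv
  simpa using hv

end Maps

/-! ### Cutting circuits at three points of the ring. -/

section Circuits

variable {L : ℕ} {κ : ZMod L → Type*} [NeZero L] [∀ i, Fintype (κ i)] [∀ i, DecidableEq (κ i)]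

/-- The ordered product of three group elements. -/
def prod3 {M : Type*} [Mul M] (f : Fin 3 → M) : M := f 0 * f 1 * f 2

/-- The regions `Y 0`, `Y 1`, `Y 2` are pairwise disjoint. -/
def PairwiseDisjoint3 (Y : Fin 3 → Finset (ZMod L)) : Prop := ∀ j j', j ≠ j' → Disjoint (Y j) (Y j')

theorem prod3_mul {Y : Fin 3 → Finset (ZMod L)} (hY : PairwiseDisjoint3 Y)
    {a b : Fin 3 → UnitaryOp κ} (ha : ∀ j, a j ∈ loc κ (Y j)) (hb : ∀ j, b j ∈ loc κ (Y j)) :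
    prod3 a * prod3 b = prod3 fun j => a j * b j := by
  have h10 := loc_comm (hY 1 0 (by decide)) (ha 1) (hb 0)
  have h20 := loc_comm (hY 2 0 (by decide)) (ha 2) (hb 0)
  have h21 := loc_comm (hY 2 1 (by decide)) (ha 2) (hb 1)
  simp only [prod3]
  calc a 0 * a 1 * a 2 * (b 0 * b 1 * b 2)
      = a 0 * a 1 * (a 2 * b 0) * b 1 * b 2 := by group
    _ = a 0 * (a 1 * b 0) * (a 2 * b 1) * b 2 := by rw [h20]; group
    _ = a 0 * b 0 * (a 1 * b 1) * (a 2 * b 2) := by rw [h10, h21]; group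

theorem prod3_conj (T : UnitaryOp κ) (a : Fin 3 → UnitaryOp κ) :
    T * prod3 a * T⁻¹ = prod3 fun j => T * a j * T⁻¹ := by
  simp only [prod3]; group

theorem prod3_mem {H : Subgroup (UnitaryOp κ)} {a : Fin 3 → UnitaryOp κ} (ha : ∀ j, a j ∈ H) :
    prod3 a ∈ H :=
  mul_mem (mul_mem (ha 0) (ha 1)) (ha 2)

/-- A gate: a region together with a unitary. -/
abbrev Gate (κ : ZMod L → Type*) [∀ i, Fintype (κ i)] [∀ i, DecidableEq (κ i)] : Type _ :=
  Finset (ZMod L) × UnitaryOp κ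

/-- The product of a list of gates. -/
def gateProd (l : List (Gate κ)) : UnitaryOp κ := (l.map Prod.snd).prod

@[simp] theorem gateProd_nil : gateProd ([] : List (Gate κ)) = 1 := rfl

@[simp] theorem gateProd_cons (g : Gate κ) (l : List (Gate κ)) :
    gateProd (g :: l) = g.2 * gateProd l := by
  simp [gateProd]

theorem IsLayer.exists_gates {S : Finset (ZMod L)} {r : ℕ} {W : Op κ} (h : IsLayer S r W) :
    ∃ l : List (Gate κ), l.Pairwise (fun g g' => Disjoint g.1 g'.1) ∧
      (∀ g ∈ l, g.2 ∈ loc κ g.1 ∧ g.1 ⊆ S ∧ ∃ (k : ℤ) (n : ℕ), n ≤ r ∧ g.1 = seg L k (k + n)) ∧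
      W = (gateProd l : Op κ) := by
  obtain ⟨N, a, n, u, h1, h2, rfl⟩ := h
  refine ⟨List.ofFn fun j => (arc (a j) (n j), u j), ?_, ?_, ?_⟩
  · rw [List.pairwise_ofFn]
    exact fun i j hij => h2 i j hij.ne
  · intro g hg
    obtain ⟨j, rfl⟩ := (List.mem_ofFn' _ _).1 hg
    obtain ⟨hr, hS, hu⟩ := h1 j
    obtain ⟨k, -, -, hk⟩ := exists_coord 0 (a j)
    exact ⟨mem_loc_iff.2 hu, hS, k, n j, hr, by
      show arc (a j) (n j) = _
      rw [← hk, arc_intCast]⟩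
  · rw [gateProd, Submonoid.coe_list_prod, List.map_map, List.map_ofFn]
    rfl

theorem gateProd_mem {H : Subgroup (UnitaryOp κ)} {l : List (Gate κ)} (h : ∀ g ∈ l, g.2 ∈ H) :
    gateProd l ∈ H :=
  list_prod_mem fun u hu => by
    obtain ⟨g, hg, rfl⟩ := List.mem_map.1 hu
    exact h g hg

/-- At most one gate of a layer meets `i`. In the induction, if the first gate contains `i` the
later ones leave `i` in place; otherwise they map `i` into `J` minus that gate, where the gate acts
trivially. -/
theorem maps_gateProd {l : List (Gate κ)} (hl : l.Pairwise fun g g' => Disjoint g.1 g'.1)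
    (hg : ∀ g ∈ l, g.2 ∈ loc κ g.1) {i : ZMod L} {J : Finset (ZMod L)} (hi : i ∈ J)
    (hJ : ∀ g ∈ l, i ∈ g.1 → g.1 ⊆ J) : Maps (gateProd l) {i} J := by
  induction l generalizing J with
  | nil => exact fun v hv => loc_mono (Finset.singleton_subset_iff.2 hi) (by simpa using hv)
  | cons g l ih =>
    rw [List.pairwise_cons] at hl
    rw [gateProd_cons]
    have hgl := fun g' h => hg g' (List.mem_cons_of_mem _ h)
    by_cases hig : i ∈ g.1
    · have h1 : Maps (gateProd l) {i} {i} := ih hl.2 hgl (by simp) fun g' hg' hig' =>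
        absurd hig' (Finset.disjoint_left.1 (hl.1 g' hg') hig)
      exact Maps.comp ((maps_of_mem (hg g (by simp)) (hJ g (by simp) hig)
        (by simpa using hi))) h1
    · have h1 : Maps (gateProd l) {i} (J \ g.1) := ih hl.2 hgl (by simp [hi, hig])
        fun g' hg' hig' => Finset.subset_sdiff.2
          ⟨hJ g' (List.mem_cons_of_mem _ hg') hig', (hl.1 g' hg').symm⟩
      exact (Maps.comp (maps_of_disjoint (hg g (by simp)) Finset.disjoint_sdiff) h1).mono
        subset_rfl Finset.sdiff_subset

theorem spreads_gateProd {r : ℕ} {l : List (Gate κ)}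
    (hl : l.Pairwise fun g g' => Disjoint g.1 g'.1)
    (hg : ∀ g ∈ l, g.2 ∈ loc κ g.1 ∧ ∃ (k : ℤ) (n : ℕ), n ≤ r ∧ g.1 = seg L k (k + n)) :
    Spreads r (gateProd l) := by
  intro k
  rw [seg_succ]
  refine maps_gateProd hl (fun g h => (hg g h).1) (intCast_mem_seg (by omega) (by omega)) ?_
  intro g h hk
  obtain ⟨-, k', n, hn, hkn⟩ := hg g h
  rw [hkn] at hk ⊢
  intro j hj
  obtain ⟨m, hm1, hm2, hmk⟩ := mem_seg.1 hk
  obtain ⟨m', hm1', hm2', rfl⟩ := mem_seg.1 hj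
  refine mem_seg.2 ⟨m' - m + k, by omega, by omega, ?_⟩
  push_cast
  rw [hmk]
  ring

theorem gateProd_eq_prod3 {Y : Fin 3 → Finset (ZMod L)} (hY : PairwiseDisjoint3 Y)
    {S : Finset (ZMod L)} {l : List (Gate κ)}
    (hl : ∀ g ∈ l, g.2 ∈ loc κ g.1 ∧ g.1 ⊆ S ∧ ∃ j, g.1 ⊆ Y j) :
    ∃ V : Fin 3 → UnitaryOp κ, (∀ j, V j ∈ loc κ (Y j)) ∧ (∀ j, V j ∈ loc κ S) ∧
      gateProd l = prod3 V := by
  induction l with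
  | nil => exact ⟨fun _ => 1, fun _ => one_mem _, fun _ => one_mem _, by simp [prod3]⟩
  | cons g l ih =>
    obtain ⟨V, hV, hVS, hp⟩ := ih fun g' h => hl g' (List.mem_cons_of_mem _ h)
    obtain ⟨hg, hgS, j, hj⟩ := hl g (by simp)
    let a : Fin 3 → UnitaryOp κ := Function.update (fun _ => 1) j g.2
    have ha : ∀ H : Fin 3 → Subgroup (UnitaryOp κ), g.2 ∈ H j → ∀ j', a j' ∈ H j' := by
      intro H hH j'
      by_cases hjj : j' = j
      · subst hjj; simpa [a] using hH
      · simp [a, hjj, one_mem]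
    have haY := ha (fun j => loc κ (Y j)) (loc_mono hj hg)
    have haS := ha (fun _ => loc κ S) (loc_mono hgS hg)
    refine ⟨fun j => a j * V j, fun j => mul_mem (haY j) (hV j),
      fun j => mul_mem (haS j) (hVS j), ?_⟩
    rw [gateProd_cons, hp, ← prod3_mul hY haY hV]
    congr 1
    fin_cases j <;> simp [a, prod3]

theorem gateProd_filter (p : Gate κ → Prop) [DecidablePred p] {l : List (Gate κ)}
    (hl : l.Pairwise fun g g' => Disjoint g.1 g'.1) (hg : ∀ g ∈ l, g.2 ∈ loc κ g.1) :
    gateProd l = gateProd (l.filter fun g => ¬ p g) * gateProd (l.filter fun g => p g) := by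
  induction l with
  | nil => simp
  | cons g l ih =>
    rw [List.pairwise_cons] at hl
    have ih' := ih hl.2 fun g' h => hg g' (List.mem_cons_of_mem _ h)
    by_cases hp : p g
    · have hc : Commute g.2 (gateProd (l.filter fun g => ¬ p g)) := by
        have : gateProd (l.filter fun g => ¬ p g) ∈ Subgroup.centralizer {g.2} := by
          refine gateProd_mem fun g' hg' => ?_
          have hgl := (List.mem_filter.1 hg').1
          rw [Subgroup.mem_centralizer_singleton_iff]
          exact (loc_comm (hl.1 g' hgl) (hg g (by simp)) (hg g' (List.mem_cons_of_mem _ hgl))).symm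
        exact (Subgroup.mem_centralizer_singleton_iff.1 this).symm
      rw [gateProd_cons, ih', List.filter_cons_of_neg (by simpa using hp),
        List.filter_cons_of_pos (by simpa using hp), gateProd_cons, ← mul_assoc, ← mul_assoc, hc.eq]
    · rw [gateProd_cons, ih', List.filter_cons_of_pos (by simpa using hp),
        List.filter_cons_of_neg (by simpa using hp), gateProd_cons, mul_assoc]

/-- The three arcs into which the ring is cut at `q 0`, `q 1`, `q 2`. -/
def pieces (L : ℕ) (q : Fin 3 → ℤ) : Fin 3 → Finset (ZMod L) :=
  ![seg L (q 0) (q 1), seg L (q 1) (q 2), seg L (q 2) (q 0 + L)]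

/-- The neighbourhood of radius `s` of a cut. -/
def window (L : ℕ) (q : Fin 3 → ℤ) (s : ℕ) (j : Fin 3) : Finset (ZMod L) :=
  seg L (q j - s) (q j + s)

/-- The cuts `q 0`, `q 1`, `q 2` are in cyclic order, at distances at least `d`. -/
structure Spaced (L : ℕ) (q : Fin 3 → ℤ) (d : ℤ) : Prop where
  left : q 0 + d ≤ q 1
  mid : q 1 + d ≤ q 2
  right : q 2 + d ≤ q 0 + L

theorem Spaced.mono {q : Fin 3 → ℤ} {d d' : ℤ} (h : Spaced L q d) (hd : d' ≤ d) :
    Spaced L q d' :=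
  ⟨by have := h.left; omega, by have := h.mid; omega, by have := h.right; omega⟩

theorem pairwiseDisjoint3_of {Y : Fin 3 → Finset (ZMod L)} (h01 : Disjoint (Y 0) (Y 1))
    (h02 : Disjoint (Y 0) (Y 2)) (h12 : Disjoint (Y 1) (Y 2)) : PairwiseDisjoint3 Y := by
  intro j j' h
  fin_cases j <;> fin_cases j' <;>
    first | exact absurd rfl h | assumption | (apply Disjoint.symm; assumption)

theorem Spaced.pieces_disjoint {q : Fin 3 → ℤ} (h : Spaced L q 0) :
    PairwiseDisjoint3 (pieces L q) := by
  obtain ⟨h1, h2, h3⟩ := h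
  exact pairwiseDisjoint3_of (seg_disjoint (by omega) (by omega))
    (seg_disjoint (by omega) (by omega)) (seg_disjoint (by omega) (by omega))

theorem Spaced.window_disjoint {q : Fin 3 → ℤ} {s : ℕ} (h : Spaced L q (2 * s)) :
    PairwiseDisjoint3 (window L q s) := by
  obtain ⟨h1, h2, h3⟩ := h
  exact pairwiseDisjoint3_of (seg_disjoint (by omega) (by omega))
    (seg_disjoint (by omega) (by omega)) (seg_disjoint (by omega) (by omega))

/-- Choose the coordinate of the left end in the turn starting at `q 0`. An arc of length at most
`r` that runs past the next cut begins within `r` of it, and crossing `q 0 + L` means crossing `q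
0`. -/
theorem seg_subset_piece_or_window {q : Fin 3 → ℤ} (k : ℤ) {n r : ℕ} (hn : n ≤ r) :
    (∃ j, seg L k (k + n) ⊆ pieces L q j) ∨ ∃ j, seg L k (k + n) ⊆ window L q r j := by
  obtain ⟨k', h1, h2, h3⟩ := exists_coord (q 0) (k : ZMod L)
  rw [← arc_intCast, ← h3, arc_intCast]
  rcases le_or_gt (k' + n) (q 1) with h | h
  · exact Or.inl ⟨0, seg_mono h1 h⟩
  rcases lt_or_ge k' (q 1) with h' | h'
  · exact Or.inr ⟨1, seg_mono (by omega) (by omega)⟩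
  rcases le_or_gt (k' + n) (q 2) with h | h
  · exact Or.inl ⟨1, seg_mono h' h⟩
  rcases lt_or_ge k' (q 2) with h' | h'
  · exact Or.inr ⟨2, seg_mono (by omega) (by omega)⟩
  rcases le_or_gt (k' + n) (q 0 + L) with h | h
  · exact Or.inl ⟨2, seg_mono h' h⟩
  · refine Or.inr ⟨0, ?_⟩
    rw [window, ← seg_period (q 0 - r) (q 0 + r)]
    exact seg_mono (by omega) (by omega)

/-- `W` is cut at the points `q 0`, `q 1`, `q 2`: it is the product of unitaries `x j` near the cuts
and unitaries `V j` on the pieces, all of them in the region `S`. -/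
structure IsCut (S : Finset (ZMod L)) (q : Fin 3 → ℤ) (s : ℕ) (W : UnitaryOp κ)
    (x V : Fin 3 → UnitaryOp κ) : Prop where
  x_mem : ∀ j, x j ∈ loc κ (window L q s j)
  x_mem' : ∀ j, x j ∈ loc κ S
  V_mem : ∀ j, V j ∈ loc κ (pieces L q j)
  V_mem' : ∀ j, V j ∈ loc κ S
  spreads : Spreads s (prod3 V)
  spreads' : Spreads s W
  eq : W = prod3 x * prod3 V

theorem IsLayer.exists_isCut {S : Finset (ZMod L)} {r : ℕ} {W : Op κ} (h : IsLayer S r W)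
    {q : Fin 3 → ℤ} (hq : Spaced L q (2 * r)) :
    ∃ (w : UnitaryOp κ) (x V : Fin 3 → UnitaryOp κ), W = w ∧ IsCut S q r w x V := by
  classical
  obtain ⟨l, hl, hg, rfl⟩ := h.exists_gates
  -- Gates inside a piece are collected in `V`; the others straddle a cut and are collected in `x`.
  let p : Gate κ → Prop := fun g => ∃ j, g.1 ⊆ pieces L q j
  obtain ⟨V, hV, hVS, hVp⟩ := gateProd_eq_prod3 (S := S) (hq.mono (by omega)).pieces_disjoint
    (l := l.filter fun g => p g) (fun g h' => by
      rw [List.mem_filter] at h'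
      exact ⟨(hg g h'.1).1, (hg g h'.1).2.1, by simpa using h'.2⟩)
  obtain ⟨x, hx, hxS, hxp⟩ := gateProd_eq_prod3 (S := S) hq.window_disjoint
    (l := l.filter fun g => ¬ p g) (fun g h' => by
      rw [List.mem_filter] at h'
      obtain ⟨h1, h2, k, n, hn, hk⟩ := hg g h'.1
      refine ⟨h1, h2, ?_⟩
      have := seg_subset_piece_or_window (L := L) (q := q) k hn
      rw [← hk] at this
      exact this.resolve_left (of_decide_eq_true h'.2))
  refine ⟨_, x, V, rfl, hx, hxS, hV, hVS, ?_, ?_, ?_⟩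
  · rw [← hVp]
    exact spreads_gateProd (hl.filter _) fun g h' => by
      have := hg g (List.mem_filter.1 h').1
      exact ⟨this.1, this.2.2⟩
  · exact spreads_gateProd hl fun g h' => ⟨(hg g h').1, (hg g h').2.2⟩
  · rw [← hVp, ← hxp]
    exact gateProd_filter p hl fun g h' => (hg g h').1

/-- Write `x V x' V'` as `x (V x' V⁻¹) V V'`. Conjugation by `V` spreads `x'` by at most `r`, so the
windows grow from `s` to `r + s`. -/
theorem IsCut.mul {S : Finset (ZMod L)} {q : Fin 3 → ℤ} {r s : ℕ} {w w' : UnitaryOp κ}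
    {x V x' V' : Fin 3 → UnitaryOp κ} (hq : Spaced L q (2 * (r + s : ℕ))) (h : IsCut S q r w x V)
    (h' : IsCut S q s w' x' V') :
    IsCut S q (r + s) (w * w') (fun j => x j * (prod3 V * x' j * (prod3 V)⁻¹))
      (fun j => V j * V' j) := by
  have hx1 : ∀ j, x j ∈ loc κ (window L q (r + s) j) := fun j =>
    loc_mono (seg_mono (by push_cast; omega) (by push_cast; omega)) (h.x_mem j)
  have hx2 : ∀ j, prod3 V * x' j * (prod3 V)⁻¹ ∈ loc κ (window L q (r + s) j) := fun j =>
    loc_mono (seg_mono (by push_cast; omega) (by push_cast; omega))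
      (h.spreads.maps _ _ _ (h'.x_mem j))
  have hVV := prod3_mul (hq.mono (by omega)).pieces_disjoint h.V_mem h'.V_mem
  have hVS : prod3 V ∈ loc κ S := prod3_mem h.V_mem'
  refine ⟨fun j => mul_mem (hx1 j) (hx2 j), fun j => mul_mem (h.x_mem' j)
    (mul_mem (mul_mem hVS (h'.x_mem' j)) (inv_mem hVS)), fun j => mul_mem (h.V_mem j) (h'.V_mem j),
    fun j => mul_mem (h.V_mem' j) (h'.V_mem' j), ?_, h.spreads'.mul h'.spreads', ?_⟩
  · rw [← hVV]
    exact h.spreads.mul h'.spreads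
  · rw [← prod3_mul hq.window_disjoint hx1 hx2, ← hVV, ← prod3_conj, h.eq, h'.eq]
    group

theorem IsCircuit.exists_isCut {S : Finset (ZMod L)} {r D : ℕ} {W : Op κ} (h : IsCircuit S r D W)
    {q : Fin 3 → ℤ} (hq : Spaced L q (2 * (r * D : ℕ))) :
    ∃ (w : UnitaryOp κ) (x V : Fin 3 → UnitaryOp κ), W = w ∧ IsCut S q (r * D) w x V := by
  induction D generalizing W with
  | zero =>
    obtain rfl : W = 1 := h
    exact ⟨1, fun _ => 1, fun _ => 1, rfl, fun _ => one_mem _, fun _ => one_mem _,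
      fun _ => one_mem _, fun _ => one_mem _, by simpa [prod3] using spreads_one,
      by simpa using spreads_one, by simp [prod3]⟩
  | succ D ih =>
    obtain ⟨W₁, W₂, h₁, h₂, rfl⟩ := h
    have e : r * (D + 1) = r + r * D := by ring
    rw [e] at hq ⊢
    obtain ⟨w₁, x₁, V₁, rfl, c₁⟩ := h₁.exists_isCut (hq.mono (by push_cast; nlinarith))
    obtain ⟨w₂, x₂, V₂, rfl, c₂⟩ := ih h₂ (hq.mono (by push_cast; nlinarith))
    exact ⟨w₁ * w₂, _, _, rfl, c₁.mul hq c₂⟩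

theorem IsCircuit.exists_isCut' {S : Finset (ZMod L)} {r D : ℕ} {W : UnitaryOp κ}
    (h : IsCircuit S r D (W : Op κ)) {q : Fin 3 → ℤ} (hq : Spaced L q (2 * (r * D : ℕ))) :
    ∃ x V : Fin 3 → UnitaryOp κ, IsCut S q (r * D) W x V := by
  obtain ⟨w, x, V, hw, hc⟩ := h.exists_isCut hq
  obtain rfl := Subtype.ext hw
  exact ⟨x, V, hc⟩

end Circuits

open Matrix

/-! ### Purities, and the entanglement created at three cuts. -/

section Purity

variable {L : ℕ} {κ : ZMod L → Type*} [NeZero L] [∀ i, Fintype (κ i)] [∀ i, DecidableEq (κ i)]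

/-- Exchange the parts off `X` of two configurations. -/
def exch (κ : ZMod L → Type*) (X : Finset (ZMod L)) : Equiv.Perm (Config κ × Config κ) where
  toFun p := (X.piecewise p.1 p.2, X.piecewise p.2 p.1)
  invFun p := (X.piecewise p.1 p.2, X.piecewise p.2 p.1)
  left_inv p := by
    ext i <;> by_cases hi : i ∈ X <;> simp [hi]
  right_inv p := by
    ext i <;> by_cases hi : i ∈ X <;> simp [hi]

/-- The purity `tr (ρ_X ^ 2)` of the reduced state of `ψ` on the region `X`. -/
def purity (X : Finset (ZMod L)) (ψ : Config κ → ℂ) : ℂ :=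
  ∑ p : Config κ × Config κ, ψ p.1 * ψ p.2 *
    star (ψ (X.piecewise p.1 p.2) * ψ (X.piecewise p.2 p.1))

/-- `ψ` is a product of a vector on `X` and a vector on the complement. -/
def IsProd (X : Finset (ZMod L)) (ψ : Config κ → ℂ) : Prop :=
  ∀ a b : Config κ, ψ (X.piecewise a b) * ψ (X.piecewise b a) = ψ a * ψ b

/-- `ψ` is a unit vector. -/
def IsNormalized (ψ : Config κ → ℂ) : Prop := ∑ a, ψ a * star (ψ a) = 1

theorem piecewise_compl' (X : Finset (ZMod L)) (a b : Config κ) :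
    Xᶜ.piecewise a b = X.piecewise b a := Finset.piecewise_compl _ _ _

theorem purity_compl (X : Finset (ZMod L)) (ψ : Config κ → ℂ) : purity Xᶜ ψ = purity X ψ := by
  simp only [purity, piecewise_compl']
  refine Finset.sum_congr rfl fun p _ => ?_
  rw [mul_comm (ψ (X.piecewise p.2 p.1))]

theorem IsProd.compl {X : Finset (ZMod L)} {ψ : Config κ → ℂ} (h : IsProd X ψ) :
    IsProd Xᶜ ψ := by
  intro a b
  rw [piecewise_compl', piecewise_compl', mul_comm, h]

theorem mulVec_inner {n : Type*} [Fintype n] [DecidableEq n] (u : Matrix.unitaryGroup n ℂ)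
    (ψ φ : n → ℂ) :
    star ((u : Matrix n n ℂ) *ᵥ ψ) ⬝ᵥ ((u : Matrix n n ℂ) *ᵥ φ) = star ψ ⬝ᵥ φ := by
  rw [Matrix.star_mulVec, Matrix.dotProduct_mulVec, Matrix.vecMul_vecMul,
    ← Matrix.star_eq_conjTranspose, Unitary.coe_star_mul_self, Matrix.vecMul_one]

theorem isNormalized_iff {ψ : Config κ → ℂ} : IsNormalized ψ ↔ star ψ ⬝ᵥ ψ = 1 := by
  simp [IsNormalized, dotProduct, mul_comm]

theorem IsNormalized.mulVec {ψ : Config κ → ℂ} (h : IsNormalized ψ) (u : UnitaryOp κ) :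
    IsNormalized ((u : Op κ) *ᵥ ψ) := by
  rw [isNormalized_iff] at h ⊢
  rw [mulVec_inner, h]

theorem IsNormalized.exists_ne_zero {ψ : Config κ → ℂ} (h : IsNormalized ψ) : ∃ b, ψ b ≠ 0 := by
  by_contra hcon
  push Not at hcon
  simp [IsNormalized, hcon] at h

/-- In matrix form: `u ⊗ u` commutes with the partial swap `exch`. -/
theorem SupportedOn.exch_entries {X : Finset (ZMod L)} {u : Op κ} (hu : SupportedOn X u)
    (a b c d : Config κ) :
    u (X.piecewise a b) (X.piecewise c d) * u (X.piecewise b a) (X.piecewise d c) =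
      u a c * u b d := by
  rw [supportedOn_iff] at hu
  obtain ⟨h1, h2⟩ := hu
  have aux : ∀ a b c d : Config κ, (∀ i, i ∉ X → a i = c i) → (∀ i, i ∉ X → b i = d i) →
      u (X.piecewise a b) (X.piecewise c d) = u a c := by
    intro a b c d hac hbd
    have e1 : X.piecewise c d = X.piecewise c b := by
      funext i
      by_cases hi : i ∈ X <;> simp [hi, hbd]
    have := h2 a c b a
    rw [Finset.piecewise_same, piecewise_eq_right_of_agree hac] at this
    rw [e1, this]
  by_cases hac : ∀ i, i ∉ X → a i = c i
  · by_cases hbd : ∀ i, i ∉ X → b i = d i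
    · rw [aux a b c d hac hbd, aux b a d c hbd hac]
    · push Not at hbd
      obtain ⟨i, hi, hne⟩ := hbd
      rw [h1 b d i hi hne, h1 (X.piecewise a b) (X.piecewise c d) i hi (by simpa [hi] using hne),
        zero_mul, mul_zero]
  · push Not at hac
    obtain ⟨i, hi, hne⟩ := hac
    rw [h1 a c i hi hne, h1 (X.piecewise b a) (X.piecewise d c) i hi (by simpa [hi] using hne),
      zero_mul, mul_zero]

theorem purity_eq_dotProduct (X : Finset (ZMod L)) (ψ : Config κ → ℂ) :
    purity X ψ = star ((fun p : Config κ × Config κ => ψ p.1 * ψ p.2) ∘ exch κ X) ⬝ᵥ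
      (fun p : Config κ × Config κ => ψ p.1 * ψ p.2) := by
  simp only [purity, dotProduct]
  exact Finset.sum_congr rfl fun p _ => mul_comm _ _

/-- The purity is the expectation value of the partial swap in `ψ ⊗ ψ`, and `u ⊗ u` commutes with
that swap. -/
theorem purity_mulVec {X : Finset (ZMod L)} {u : UnitaryOp κ} (hu : u ∈ loc κ X)
    (ψ : Config κ → ℂ) : purity X ((u : Op κ) *ᵥ ψ) = purity X ψ := by
  set U₂ : Matrix (Config κ × Config κ) (Config κ × Config κ) ℂ :=
    Matrix.kroneckerMap (· * ·) (u : Op κ) (u : Op κ) with hU₂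
  have hU₂u : U₂ ∈ Matrix.unitaryGroup (Config κ × Config κ) ℂ :=
    Matrix.kronecker_mem_unitary u.2 u.2
  have hten : ∀ χ : Config κ × Config κ → ℂ, ∀ p,
      (U₂ *ᵥ χ) p = ∑ c, ∑ d, (u : Op κ) p.1 c * (u : Op κ) p.2 d * χ (c, d) := by
    intro χ p
    rw [Matrix.mulVec, dotProduct, Fintype.sum_prod_type]
    rfl
  have h1 : (fun p : Config κ × Config κ => ((u : Op κ) *ᵥ ψ) p.1 * ((u : Op κ) *ᵥ ψ) p.2) =
      U₂ *ᵥ fun p => ψ p.1 * ψ p.2 := by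
    funext p
    rw [hten, Matrix.mulVec, Matrix.mulVec, dotProduct, dotProduct, Finset.sum_mul_sum]
    refine Finset.sum_congr rfl fun c _ => Finset.sum_congr rfl fun d _ => ?_
    ring
  have h2 : ∀ χ : Config κ × Config κ → ℂ, (U₂ *ᵥ χ) ∘ exch κ X = U₂ *ᵥ (χ ∘ exch κ X) := by
    intro χ
    have hsub : U₂.submatrix (exch κ X) (exch κ X) = U₂ := by
      ext p q
      exact (mem_loc_iff.1 hu).exch_entries p.1 p.2 q.1 q.2
    conv_rhs => rw [← hsub, Matrix.submatrix_mulVec_equiv]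
    congr 2
    funext p
    simp
  rw [purity_eq_dotProduct, purity_eq_dotProduct, h1, h2]
  exact mulVec_inner ⟨U₂, hU₂u⟩ _ _

theorem purity_mulVec_compl {X : Finset (ZMod L)} {u : UnitaryOp κ} (hu : u ∈ loc κ Xᶜ)
    (ψ : Config κ → ℂ) : purity X ((u : Op κ) *ᵥ ψ) = purity X ψ := by
  rw [← purity_compl, purity_mulVec hu, purity_compl]

theorem purity_smul (X : Finset (ZMod L)) {z : ℂ} (hz : z * star z = 1) (ψ : Config κ → ℂ) :
    purity X (z • ψ) = purity X ψ := by
  refine Finset.sum_congr rfl fun p _ => ?_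
  simp only [Pi.smul_apply, smul_eq_mul, star_mul']
  linear_combination (z * star z + 1) * (ψ p.1 * ψ p.2 * (star (ψ (X.piecewise p.1 p.2)) *
    star (ψ (X.piecewise p.2 p.1)))) * hz

theorem sum_exch (X : Finset (ZMod L)) (F : Config κ × Config κ → ℂ) :
    ∑ p, F (exch κ X p) = ∑ p, F p := Equiv.sum_comp (exch κ X) F

/-- Up to normalization the purity is the squared Hilbert–Schmidt norm of the reduced matrix `g`.
Strict positivity permits the cancellations in `isProd_of_three_cuts`. -/
theorem exists_purity_pos (X : Finset (ZMod L)) {ψ : Config κ → ℂ} (hψ : ∃ b, ψ b ≠ 0) :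
    ∃ q : ℝ, 0 < q ∧ purity X ψ = q := by
  obtain ⟨b₀, hb₀⟩ := hψ
  let g : Config κ → Config κ → ℂ := fun a b =>
    ∑ c, ψ (X.piecewise a c) * star (ψ (X.piecewise b c))
  -- After regrouping, two of the four configurations summed over are free; they give the squared
  -- cardinality.
  have hsum : ∑ a, ∑ b, g a b * star (g a b) =
      (Fintype.card (Config κ) : ℂ) ^ 2 * purity X ψ := by
    have e1 : ∑ a, ∑ b, g a b * star (g a b) = ∑ p : Config κ × Config κ,
        ∑ q : Config κ × Config κ, (fun p q : Config κ × Config κ => ψ p.1 * ψ q.1 *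
          star (ψ (X.piecewise p.1 q.1) * ψ (X.piecewise q.1 p.1))) (exch κ X p) (exch κ X q) := by
      simp only [g, star_sum, Finset.sum_mul_sum, Fintype.sum_prod_type]
      refine Finset.sum_congr rfl fun a _ => ?_
      rw [Finset.sum_comm]
      refine Finset.sum_congr rfl fun c _ => Finset.sum_congr rfl fun b _ =>
        Finset.sum_congr rfl fun d _ => ?_
      have e1 : X.piecewise (X.piecewise a c) (X.piecewise b d) = X.piecewise a d := by
        funext i; by_cases hi : i ∈ X <;> simp [hi]
      have e2 : X.piecewise (X.piecewise b d) (X.piecewise a c) = X.piecewise b c := by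
        funext i; by_cases hi : i ∈ X <;> simp [hi]
      simp only [exch, Equiv.coe_fn_mk, e1, e2, star_mul', star_star]
      ring
    rw [e1, sum_exch X (fun p => ∑ q : Config κ × Config κ, ψ p.1 * ψ (exch κ X q).1 *
          star (ψ (X.piecewise p.1 (exch κ X q).1) * ψ (X.piecewise (exch κ X q).1 p.1)))]
    simp only [fun p : Config κ × Config κ => sum_exch X (fun q => ψ p.1 * ψ q.1 *
          star (ψ (X.piecewise p.1 q.1) * ψ (X.piecewise q.1 p.1)))]
    simp only [purity, Fintype.sum_prod_type, Finset.sum_const, Finset.card_univ, nsmul_eq_mul,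
      Finset.mul_sum]
    refine Finset.sum_congr rfl fun a _ => Finset.sum_congr rfl fun b _ => ?_
    ring
  have hN : (0 : ℝ) < Fintype.card (Config κ) := by
    exact_mod_cast Fintype.card_pos_iff.2 ⟨b₀⟩
  have hre : ∑ a, ∑ b, g a b * star (g a b) = ((∑ a, ∑ b, ‖g a b‖ ^ 2 : ℝ) : ℂ) := by
    push_cast
    refine Finset.sum_congr rfl fun a _ => Finset.sum_congr rfl fun b _ => ?_
    exact RCLike.mul_conj _
  have hg : 0 < ‖g b₀ b₀‖ := by
    rw [norm_pos_iff]
    have : g b₀ b₀ = ((∑ c, ‖ψ (X.piecewise b₀ c)‖ ^ 2 : ℝ) : ℂ) := by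
      push_cast
      exact Finset.sum_congr rfl fun c _ => RCLike.mul_conj _
    rw [this]
    have h0 : 0 < ∑ c, ‖ψ (X.piecewise b₀ c)‖ ^ 2 := by
      refine lt_of_lt_of_le ?_ (Finset.single_le_sum
        (f := fun c => ‖ψ (X.piecewise b₀ c)‖ ^ 2) (fun c _ => by positivity)
        (Finset.mem_univ b₀))
      have : 0 < ‖ψ b₀‖ := norm_pos_iff.2 hb₀
      simp only [Finset.piecewise_same]
      positivity
    exact_mod_cast h0.ne'
  have hS : 0 < ∑ a, ∑ b, ‖g a b‖ ^ 2 := by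
    refine lt_of_lt_of_le (b := ∑ b, ‖g b₀ b‖ ^ 2) ?_ (Finset.single_le_sum
      (f := fun a => ∑ b, ‖g a b‖ ^ 2) (fun c _ => by positivity) (Finset.mem_univ b₀))
    refine lt_of_lt_of_le (b := ‖g b₀ b₀‖ ^ 2) (by positivity) (Finset.single_le_sum
      (f := fun b => ‖g b₀ b‖ ^ 2) (fun c _ => by positivity) (Finset.mem_univ b₀))
  rw [hre] at hsum
  clear_value g
  clear hre hg hb₀
  generalize (∑ a, ∑ b, ‖g a b‖ ^ 2) = Q at hsum hS
  generalize purity X ψ = P at hsum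
  generalize Fintype.card (Config κ) = N at hsum hN
  have hN' : (N : ℂ) ^ 2 ≠ 0 := pow_ne_zero _ (by exact_mod_cast hN.ne')
  refine ⟨Q / (N : ℝ) ^ 2, by positivity, ?_⟩
  rw [Complex.ofReal_div, hsum, Complex.ofReal_pow, Complex.ofReal_natCast,
    mul_div_cancel_left₀ _ hN']

theorem sum_mul_star_pair {ψ : Config κ → ℂ} (h : IsNormalized ψ) :
    ∑ p : Config κ × Config κ, ψ p.1 * ψ p.2 * star (ψ p.1 * ψ p.2) = 1 := by
  have := congrArg₂ (· * ·) h h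
  simp only [one_mul] at this
  rw [← this, Fintype.sum_prod_type, Finset.sum_mul_sum]
  refine Finset.sum_congr rfl fun a _ => Finset.sum_congr rfl fun b _ => ?_
  rw [star_mul']
  ring

theorem IsProd.purity_eq_one {X : Finset (ZMod L)} {ψ : Config κ → ℂ} (h : IsProd X ψ)
    (hn : IsNormalized ψ) : purity X ψ = 1 := by
  rw [← sum_mul_star_pair hn]
  exact Finset.sum_congr rfl fun p _ => by rw [h]

/-- Equality case of Cauchy–Schwarz: `ψ ⊗ ψ` and its partial swap are unit vectors with inner
product one, so their difference has norm zero. -/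
theorem isProd_of_purity_eq_one {X : Finset (ZMod L)} {ψ : Config κ → ℂ} (hn : IsNormalized ψ)
    (h : purity X ψ = 1) : IsProd X ψ := by
  set Ψ : Config κ × Config κ → ℂ := fun p => ψ p.1 * ψ p.2 with hΨ
  have h1 : ∑ p, Ψ p * star (Ψ p) = 1 := sum_mul_star_pair hn
  have h2 : ∑ p, Ψ (exch κ X p) * star (Ψ (exch κ X p)) = 1 := by
    rw [sum_exch X fun p => Ψ p * star (Ψ p), h1]
  have h3 : ∑ p, Ψ p * star (Ψ (exch κ X p)) = 1 := h
  have h4 : ∑ p, Ψ (exch κ X p) * star (Ψ p) = 1 := by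
    have := congrArg star h3
    rw [star_sum, star_one] at this
    rw [← this]
    refine Finset.sum_congr rfl fun p _ => ?_
    generalize Ψ (exch κ X p) = z
    generalize Ψ p = y
    rw [star_mul', star_star, mul_comm]
  have h5 : ∑ p, ‖Ψ (exch κ X p) - Ψ p‖ ^ 2 = 0 := by
    have : ((∑ p, ‖Ψ (exch κ X p) - Ψ p‖ ^ 2 : ℝ) : ℂ) = 0 := by
      have e : ∀ p, ((‖Ψ (exch κ X p) - Ψ p‖ ^ 2 : ℝ) : ℂ) =
          Ψ (exch κ X p) * star (Ψ (exch κ X p)) - Ψ (exch κ X p) * star (Ψ p)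
            - Ψ p * star (Ψ (exch κ X p)) + Ψ p * star (Ψ p) := by
        intro p
        have := RCLike.mul_conj (Ψ (exch κ X p) - Ψ p)
        rw [Complex.ofReal_pow]
        refine Eq.trans this.symm ?_
        rw [map_sub]
        simp only [Complex.star_def]
        ring
      rw [Complex.ofReal_sum, Finset.sum_congr rfl fun p _ => e p, Finset.sum_add_distrib,
        Finset.sum_sub_distrib, Finset.sum_sub_distrib, h1, h2, h3, h4]
      ring
    exact_mod_cast this
  intro a b
  have := (Finset.sum_eq_zero_iff_of_nonneg fun p _ => by positivity).1 h5 (a, b)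
    (Finset.mem_univ _)
  have := sub_eq_zero.1 (norm_eq_zero.1 (pow_eq_zero_iff two_ne_zero |>.1 this))
  exact this

/-- Reduced states of a product vector factorize across `Y`. With one pair of copies of `ψ` per
purity, exchanging the parts off `Y` between the pairs turns the product into `purity X ψ` times a
norm equal to one. -/
theorem purity_eq_mul {Y : Finset (ZMod L)} {ψ : Config κ → ℂ} (hY : IsProd Y ψ)
    (hn : IsNormalized ψ) (X : Finset (ZMod L)) :
    purity X ψ = purity (X ∩ Y) ψ * purity (X \ Y) ψ := by
  have hone := sum_mul_star_pair hn
  symm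
  calc purity (X ∩ Y) ψ * purity (X \ Y) ψ
      = ∑ a, ∑ c, ∑ b, ∑ d, ψ a * ψ b *
          star (ψ ((X ∩ Y).piecewise a b) * ψ ((X ∩ Y).piecewise b a)) * (ψ c * ψ d *
          star (ψ ((X \ Y).piecewise c d) * ψ ((X \ Y).piecewise d c))) := by
        simp only [purity, Fintype.sum_prod_type]
        rw [Finset.sum_mul_sum]
        refine Finset.sum_congr rfl fun a _ => Finset.sum_congr rfl fun c _ => ?_
        rw [Finset.sum_mul_sum]
    _ = ∑ p : Config κ × Config κ, ∑ q : Config κ × Config κ,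
          (fun p q : Config κ × Config κ => ψ p.1 * ψ q.1 * star (ψ (X.piecewise p.1 q.1) *
            ψ (X.piecewise q.1 p.1)) * (ψ p.2 * ψ q.2 * star (ψ p.2 * ψ q.2)))
            (exch κ Y p) (exch κ Y q) := by
        simp only [Fintype.sum_prod_type]
        refine Finset.sum_congr rfl fun a _ => Finset.sum_congr rfl fun c _ =>
          Finset.sum_congr rfl fun b _ => Finset.sum_congr rfl fun d _ => ?_
        have e1 : ∀ a b c d : Config κ, Y.piecewise ((X ∩ Y).piecewise a b)
            ((X \ Y).piecewise c d) = X.piecewise (Y.piecewise a c) (Y.piecewise b d) := by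
          intro a b c d
          funext i; by_cases hi : i ∈ X <;> by_cases hi' : i ∈ Y <;> simp [hi, hi']
        have e2 : ∀ a b c d : Config κ, Y.piecewise ((X \ Y).piecewise c d)
            ((X ∩ Y).piecewise a b) = Y.piecewise d b := by
          intro a b c d
          funext i; by_cases hi : i ∈ X <;> by_cases hi' : i ∈ Y <;> simp [hi, hi']
        have k1 := hY a c
        have k2 := hY b d
        have k3 := hY ((X ∩ Y).piecewise a b) ((X \ Y).piecewise c d)
        have k4 := hY ((X ∩ Y).piecewise b a) ((X \ Y).piecewise d c)
        rw [e1, e2] at k3 k4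
        simp only [exch, Equiv.coe_fn_mk]
        calc _ = (ψ a * ψ c) * (ψ b * ψ d) * star ((ψ ((X ∩ Y).piecewise a b) *
              ψ ((X \ Y).piecewise c d)) * (ψ ((X ∩ Y).piecewise b a) *
              ψ ((X \ Y).piecewise d c))) := by
              simp only [star_mul']; ring
          _ = _ := by
              rw [← k1, ← k2, ← k3, ← k4]
              simp only [star_mul']; ring
    _ = purity X ψ := by
        rw [sum_exch Y (fun p => ∑ q : Config κ × Config κ, ψ p.1 * ψ (exch κ Y q).1 *
          star (ψ (X.piecewise p.1 (exch κ Y q).1) * ψ (X.piecewise (exch κ Y q).1 p.1)) *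
            (ψ p.2 * ψ (exch κ Y q).2 * star (ψ p.2 * ψ (exch κ Y q).2)))]
        simp only [fun p : Config κ × Config κ => sum_exch Y (fun q => ψ p.1 * ψ q.1 *
          star (ψ (X.piecewise p.1 q.1) * ψ (X.piecewise q.1 p.1)) *
            (ψ p.2 * ψ q.2 * star (ψ p.2 * ψ q.2)))]
        rw [← mul_one (purity X ψ), ← hone]
        simp only [purity, Fintype.sum_prod_type]
        rw [Finset.sum_mul_sum]
        refine Finset.sum_congr rfl fun a _ => Finset.sum_congr rfl fun c _ => ?_
        rw [Finset.sum_mul_sum]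

/-- If the unitaries `x 0`, `x 1`, `x 2`, located around the cuts between the three regions
`A = {0, 1}`, `B = {2, 3}`, `C = {4, 5}`, map a product vector to a product vector, then `x 0` alone
does not create entanglement between `A` and the rest. -/
theorem isProd_of_three_cuts (ℓ : ZMod L → Fin 6) {x : Fin 3 → UnitaryOp κ}
    (hx0 : x 0 ∈ loc κ (Finset.univ.filter fun i => ℓ i ∈ ({1, 2} : Finset (Fin 6))))
    (hx1 : x 1 ∈ loc κ (Finset.univ.filter fun i => ℓ i ∈ ({3, 4} : Finset (Fin 6))))
    (hx2 : x 2 ∈ loc κ (Finset.univ.filter fun i => ℓ i ∈ ({5, 0} : Finset (Fin 6))))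
    {ψ ψ' : Config κ → ℂ} (hn : IsNormalized ψ) (hn' : IsNormalized ψ')
    (hp : ∀ T ∈ ({{0, 1}, {2, 3}, {4, 5}} : Finset (Finset (Fin 6))),
      IsProd (Finset.univ.filter fun i => ℓ i ∈ T) ψ)
    (hp' : ∀ T ∈ ({{0, 1}, {2, 3}, {4, 5}} : Finset (Finset (Fin 6))),
      IsProd (Finset.univ.filter fun i => ℓ i ∈ T) ψ')
    {z : ℂ} (h : ((prod3 x : UnitaryOp κ) : Op κ) *ᵥ ψ' = z • ψ) :
    IsProd (Finset.univ.filter fun i => ℓ i ∈ ({0, 1} : Finset (Fin 6)))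
      ((((x 0)⁻¹ : UnitaryOp κ) : Op κ) *ᵥ ψ) := by
  set R : Finset (Fin 6) → Finset (ZMod L) := fun T => Finset.univ.filter fun i => ℓ i ∈ T with hR
  have Rc : ∀ T, (R T)ᶜ = R Tᶜ := fun T => by ext i; simp [hR]
  have Ri : ∀ T T', R T ∩ R T' = R (T ∩ T') := fun T T' => by ext i; simp [hR]
  have Rs : ∀ T T', R T \ R T' = R (T \ T') := fun T T' => by ext i; simp [hR]
  have Rm : ∀ {T T'}, T ⊆ T' → R T ⊆ R T' := fun {T T'} hT i => by
    simp only [hR, Finset.mem_filter, Finset.mem_univ, true_and]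
    exact fun hi => hT hi
  -- Up to the phase `z`, `φ` is also `x₁ x₂ ψ'`. So its purities equal those of `ψ` on regions that
  -- do not split cells {1, 2} (`r0`), and those of `ψ'` on regions that split neither {3, 4} nor
  -- {5, 0} (`r1`).
  set φ : Config κ → ℂ := (((x 0)⁻¹ : UnitaryOp κ) : Op κ) *ᵥ ψ with hφ
  have hφn : IsNormalized φ := hn.mulVec _
  have hφ' : z • φ = (x 1 : Op κ) *ᵥ ((x 2 : Op κ) *ᵥ ψ') := by
    rw [hφ, ← Matrix.mulVec_smul, ← h, Matrix.mulVec_mulVec, Matrix.mulVec_mulVec,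
      ← Submonoid.coe_mul, ← Submonoid.coe_mul]
    congr 2
    simp only [prod3]
    group
  have hz : z * star z = 1 := by
    have h1 : IsNormalized (z • φ) := by rw [hφ']; exact (hn'.mulVec _).mulVec _
    simp only [IsNormalized, Pi.smul_apply, smul_eq_mul, star_mul'] at h1 hφn
    rw [← h1, ← mul_one (z * star z), ← hφn, Finset.mul_sum]
    exact Finset.sum_congr rfl fun a _ => by ring
  have inv : ∀ {u : UnitaryOp κ} {Q T : Finset (Fin 6)}, u ∈ loc κ (R Q) → Q ⊆ T ∨ Q ⊆ Tᶜ →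
      ∀ χ, purity (R T) ((u : Op κ) *ᵥ χ) = purity (R T) χ := by
    rintro u Q T hu (hQ | hQ) χ
    · exact purity_mulVec (loc_mono (Rm hQ) hu) χ
    · refine purity_mulVec_compl (loc_mono ?_ hu) χ
      rw [Rc]
      exact Rm hQ
  have r0 : ∀ T : Finset (Fin 6), ({1, 2} : Finset (Fin 6)) ⊆ T ∨ ({1, 2} : Finset (Fin 6)) ⊆ Tᶜ →
      purity (R T) φ = purity (R T) ψ := fun T hT => inv (inv_mem hx0) hT ψ
  have r1 : ∀ T : Finset (Fin 6), (({3, 4} : Finset (Fin 6)) ⊆ T ∨ ({3, 4} : Finset (Fin 6)) ⊆ Tᶜ) →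
      (({5, 0} : Finset (Fin 6)) ⊆ T ∨ ({5, 0} : Finset (Fin 6)) ⊆ Tᶜ) →
      purity (R T) φ = purity (R T) ψ' := by
    intro T h1 h2
    rw [← purity_smul (R T) hz φ, hφ', inv hx1 h1, inv hx2 h2]
  have pc : ∀ (T T' : Finset (Fin 6)), T' = Tᶜ → ∀ χ : Config κ → ℂ,
      purity (R T') χ = purity (R T) χ := by
    rintro T _ rfl χ
    rw [← Rc, purity_compl]
  have pm : ∀ {χ : Config κ → ℂ}, IsNormalized χ → ∀ Q : Finset (Fin 6), IsProd (R Q) χ →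
      ∀ T T₁ T₂ : Finset (Fin 6), T₁ = T ∩ Q → T₂ = T \ Q →
      purity (R T) χ = purity (R T₁) χ * purity (R T₂) χ := by
    rintro χ hχ Q hQ T _ _ rfl rfl
    rw [purity_eq_mul hQ hχ, Ri, Rs]
  have hA := hp {0, 1} (by decide)
  have hB := hp {2, 3} (by decide)
  have hC := hp {4, 5} (by decide)
  have hA' := hp' {0, 1} (by decide)
  have hB' := hp' {2, 3} (by decide)
  have hCφ1 : purity (R {4, 5}) φ = 1 := by
    rw [r0 _ (by decide)]; exact hC.purity_eq_one hn
  have hCφ := isProd_of_purity_eq_one hφn hCφ1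
  have pos : ∀ T, ∃ q : ℝ, 0 < q ∧ purity (R T) φ = q := fun T =>
    exists_purity_pos _ hφn.exists_ne_zero
  have ne : ∀ T, purity (R T) φ ≠ 0 := fun T => by
    obtain ⟨q, hq, hq'⟩ := pos T
    rw [hq']; exact_mod_cast hq.ne'
  -- Factor the region {0, 1, 2, 5} in two ways, by the product structure of `ψ'` at B and by that
  -- of `φ` at C, then cancel the purity of cell 5. `s2` is the mirror image.
  have s1 : purity (R {0, 1, 2}) φ = purity (R {2}) φ * purity (R {0, 1}) φ := by
    have t1 := pm hn' _ hB' {0, 1, 2, 5} {2} {0, 1, 5} (by decide) (by decide)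
    rw [← r1 _ (by decide) (by decide), ← r1 _ (by decide) (by decide),
      ← r1 _ (by decide) (by decide)] at t1
    have t2 := pm hφn _ hCφ {0, 1, 2, 5} {5} {0, 1, 2} (by decide) (by decide)
    have t3 := pm hφn _ hCφ {0, 1, 5} {5} {0, 1} (by decide) (by decide)
    apply mul_left_cancel₀ (ne {5})
    rw [← t2, t1, t3]; ring
  have s2 : purity (R {1, 2, 3}) φ = purity (R {1}) φ * purity (R {2, 3}) φ := by
    have t1 := pm hn' _ hA' {1, 2, 3, 4} {1} {2, 3, 4} (by decide) (by decide)
    rw [← r1 _ (by decide) (by decide), ← r1 _ (by decide) (by decide),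
      ← r1 _ (by decide) (by decide)] at t1
    have t2 := pm hφn _ hCφ {1, 2, 3, 4} {4} {1, 2, 3} (by decide) (by decide)
    have t3 := pm hφn _ hCφ {2, 3, 4} {4} {2, 3} (by decide) (by decide)
    apply mul_left_cancel₀ (ne {4})
    rw [← t2, t1, t3]; ring
  have s3 : purity (R {0, 1, 2}) φ = purity (R {3}) ψ := by
    rw [pc {3, 4, 5} _ (by decide), pm hφn _ hCφ _ {4, 5} {3} (by decide) (by decide), hCφ1,
      one_mul, r0 _ (by decide)]
  have s4 : purity (R {1, 2, 3}) φ = purity (R {0}) ψ := by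
    rw [pc {0, 4, 5} _ (by decide), pm hφn _ hCφ _ {4, 5} {0} (by decide) (by decide), hCφ1,
      one_mul, r0 _ (by decide)]
  have s5 : purity (R {2, 3}) φ = purity (R {0, 1}) φ := by
    rw [pc {0, 1, 4, 5} _ (by decide), pm hφn _ hCφ _ {4, 5} {0, 1} (by decide) (by decide), hCφ1,
      one_mul]
  have s6 : purity (R {1, 2}) φ = purity (R {0}) ψ * purity (R {3}) ψ := by
    have u1 : purity (R {1}) ψ = purity (R {0}) ψ := by
      rw [pc {0, 2, 3, 4, 5} _ (by decide), pm hn _ hA _ {0} {2, 3, 4, 5} (by decide) (by decide),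
        pc {0, 1} {2, 3, 4, 5} (by decide), hA.purity_eq_one hn, mul_one]
    have u2 : purity (R {2}) ψ = purity (R {3}) ψ := by
      rw [pc {0, 1, 3, 4, 5} _ (by decide), pm hn _ hB _ {3} {0, 1, 4, 5} (by decide) (by decide),
        pc {2, 3} {0, 1, 4, 5} (by decide), hB.purity_eq_one hn, mul_one]
    rw [r0 _ (by decide), pm hn _ hA _ {1} {2} (by decide) (by decide), u1, u2]
  have s7 : purity (R {1, 2}) φ = purity (R {1}) φ * purity (R {2}) φ := by
    have t1 := pm hn' _ hA' {1, 2} {1} {2} (by decide) (by decide)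
    rwa [← r1 _ (by decide) (by decide), ← r1 _ (by decide) (by decide),
      ← r1 _ (by decide) (by decide)] at t1
  apply isProd_of_purity_eq_one hφn
  obtain ⟨q, hq, hq'⟩ := pos {0, 1}
  -- Write P for purities of `φ` and p for those of `ψ`. Then P₁P₂P₀₁² = P₁P₂₃ · P₂P₀₁ = P₁₂₃P₀₁₂ =
  -- p₀p₃ = P₁₂ = P₁P₂, and P₁P₂ is nonzero.
  have key : purity (R {0, 1}) φ * purity (R {0, 1}) φ = 1 := by
    apply mul_left_cancel₀ (mul_ne_zero (ne {1}) (ne {2}))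
    rw [mul_one]
    calc _ = (purity (R {1}) φ * purity (R {2, 3}) φ) *
          (purity (R {2}) φ * purity (R {0, 1}) φ) := by rw [s5]; ring
      _ = purity (R {1}) φ * purity (R {2}) φ := by rw [← s2, ← s1, s4, s3, ← s6, s7]
  rw [hq'] at key ⊢
  have : q * q = 1 := by exact_mod_cast key
  have : q = 1 := by nlinarith
  rw [this, Complex.ofReal_one]

end Purity

/-- Two matrices with the same Gram matrix of columns differ by a unitary on the left. -/
theorem exists_unitary_mul_eq {m n : Type*} [Fintype m] [DecidableEq m] [Fintype n] [DecidableEq n]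
    {M M' : Matrix m n ℂ} (h : M.conjTranspose * M = M'.conjTranspose * M') :
    ∃ V ∈ Matrix.unitaryGroup m ℂ, V * M = M' := by
  set f : EuclideanSpace ℂ n →ₗ[ℂ] EuclideanSpace ℂ m := Matrix.toEuclideanLin M with hf
  set g : EuclideanSpace ℂ n →ₗ[ℂ] EuclideanSpace ℂ m := Matrix.toEuclideanLin M' with hg
  have hnorm : ∀ v, ‖f v‖ = ‖g v‖ := by
    intro v
    have key : ∀ N : Matrix m n ℂ, inner ℂ (Matrix.toEuclideanLin N v) (Matrix.toEuclideanLin N v) =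
        star v.ofLp ⬝ᵥ ((N.conjTranspose * N) *ᵥ v.ofLp) := by
      intro N
      rw [EuclideanSpace.inner_eq_star_dotProduct, Matrix.ofLp_toLpLin, Matrix.toLin'_apply,
        dotProduct_comm, ← Matrix.mulVec_mulVec, Matrix.star_mulVec, ← Matrix.dotProduct_mulVec]
    have := (key M).trans ((congrArg (fun A => star v.ofLp ⬝ᵥ (A *ᵥ v.ofLp)) h).trans (key M').symm)
    rw [inner_self_eq_norm_sq_to_K, inner_self_eq_norm_sq_to_K] at this
    have h2 : ‖f v‖ ^ 2 = ‖g v‖ ^ 2 := by exact_mod_cast this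
    exact (pow_left_inj₀ (norm_nonneg _) (norm_nonneg _) two_ne_zero).1 h2
  obtain ⟨s, hs⟩ := f.rangeRestrict.exists_rightInverse_of_surjective f.range_rangeRestrict
  have hfs : ∀ y : LinearMap.range f, f (s y) = y := fun y => by
    have := LinearMap.congr_fun hs y
    exact congrArg Subtype.val this
  -- The map `f v ↦ g v` on the range of `f`, isometric because the Gram matrices agree; it extends
  -- to a unitary of the whole finite-dimensional space.
  let T : LinearMap.range f →ₗᵢ[ℂ] EuclideanSpace ℂ m :=
    ⟨g ∘ₗ s, fun y => by
      rw [LinearMap.comp_apply, ← hnorm, hfs]; rfl⟩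
  have hT : ∀ v, T (f.rangeRestrict v) = g v := by
    intro v
    show g (s (f.rangeRestrict v)) = g v
    rw [← sub_eq_zero, ← map_sub, ← norm_eq_zero, ← hnorm, map_sub, hfs]
    simp
  let E : EuclideanSpace ℂ m ≃ₗᵢ[ℂ] EuclideanSpace ℂ m := T.extend.toLinearIsometryEquiv rfl
  have hE : ∀ v, E (f v) = g v := by
    intro v
    rw [← hT v]
    exact T.extend_apply (f.rangeRestrict v)
  let b := EuclideanSpace.basisFun m ℂ
  refine ⟨LinearMap.toMatrix b.toBasis b.toBasis E.toLinearEquiv.toLinearMap,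
    E.toMatrix_mem_unitaryGroup b b, ?_⟩
  apply (Matrix.toEuclideanLin (𝕜 := ℂ) (m := m) (n := n)).injective
  rw [Matrix.toEuclideanLin_eq_toLin_orthonormal, Matrix.toLin_mul _ b.toBasis,
    Matrix.toLin_toMatrix, ← Matrix.toEuclideanLin_eq_toLin_orthonormal]
  exact LinearMap.ext hE

/-! ### Reduced states and the local unitaries relating purifications. -/

section Marginals

variable {L : ℕ} {κ : ZMod L → Type*} [NeZero L] [∀ i, Fintype (κ i)] [∀ i, DecidableEq (κ i)]

theorem mulVec_piecewise {X : Finset (ZMod L)} {u : UnitaryOp κ} (hu : u ∈ loc κ X)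
    (ψ : Config κ → ℂ) (c a : Config κ) :
    ((u : Op κ) *ᵥ ψ) (X.piecewise c a) = ((u : Op κ) *ᵥ fun z => ψ (X.piecewise z a)) c := by
  have hs := mem_loc_iff.1 hu
  have := hs.transpose.sum_mul_eq ψ c a
  simp only [Matrix.transpose_apply] at this
  rw [Matrix.mulVec, Matrix.mulVec, dotProduct, dotProduct]
  rw [Finset.sum_congr rfl fun z _ => mul_comm _ _, ← this]
  refine Finset.sum_congr rfl fun z _ => ?_
  split_ifs with h
  · rw [mul_comm]
  · push Not at h
    obtain ⟨i, hi, hne⟩ := h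
    rw [(supportedOn_iff.1 hs).1 c z i hi (Ne.symm hne)]
    ring

theorem mulVec_mul_of_indep {X : Finset (ZMod L)} {u : UnitaryOp κ} (hu : u ∈ loc κ X)
    {F : Config κ → ℂ} (hF : ∀ x z : Config κ, (∀ i, i ∉ X → x i = z i) → F z = F x)
    (G : Config κ → ℂ) :
    ((u : Op κ) *ᵥ fun z => F z * G z) = fun x => F x * ((u : Op κ) *ᵥ G) x := by
  funext x
  rw [Matrix.mulVec, Matrix.mulVec, dotProduct, dotProduct, Finset.mul_sum]
  refine Finset.sum_congr rfl fun z _ => ?_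
  by_cases h : ∀ i, i ∉ X → x i = z i
  · rw [hF x z h]; ring
  · push Not at h
    obtain ⟨i, hi, hne⟩ := h
    rw [(supportedOn_iff.1 (mem_loc_iff.1 hu)).1 x z i hi hne]
    ring

/-- The reduced density matrix of `ψ` on the complement of `X`, up to normalization. -/
def gram (X : Finset (ZMod L)) (ψ : Config κ → ℂ) (a b : Config κ) : ℂ :=
  ∑ c, ψ (X.piecewise c a) * star (ψ (X.piecewise c b))

theorem gram_mulVec {X : Finset (ZMod L)} {u : UnitaryOp κ} (hu : u ∈ loc κ X)
    (ψ : Config κ → ℂ) (a b : Config κ) : gram X ((u : Op κ) *ᵥ ψ) a b = gram X ψ a b := by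
  have := mulVec_inner u (fun z => ψ (X.piecewise z b)) (fun z => ψ (X.piecewise z a))
  simp only [gram, mulVec_piecewise hu]
  simp only [dotProduct] at this
  rw [Finset.sum_congr rfl fun z _ => mul_comm _ _]
  refine Eq.trans this ?_
  exact Finset.sum_congr rfl fun z _ => mul_comm _ _

/-- Overwrite the restriction to `X` of a configuration. -/
def overwrite (X : Finset (ZMod L)) (c : ∀ i : X, κ i) (a : Config κ) : Config κ :=
  fun i => if h : i ∈ X then c ⟨i, h⟩ else a i

theorem overwrite_restrict (X : Finset (ZMod L)) (c a : Config κ) :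
    overwrite X (fun i => c i) a = X.piecewise c a := by
  funext i
  by_cases hi : i ∈ X <;> simp [overwrite, hi]

theorem restrict_overwrite (X : Finset (ZMod L)) (c : ∀ i : X, κ i) (a : Config κ) :
    (fun i : X => overwrite X c a i) = c := by
  funext i
  simp [overwrite]

theorem overwrite_of_notMem {X : Finset (ZMod L)} {c : ∀ i : X, κ i} {a : Config κ} {i : ZMod L}
    (hi : i ∉ X) : overwrite X c a i = a i := by
  simp [overwrite, hi]

theorem sum_ite_agree (X : Finset (ZMod L)) (x : Config κ) (h : Config κ → ℂ) :
    ∑ z : Config κ, (if ∀ i, i ∉ X → x i = z i then h z else 0) =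
      ∑ c : (∀ i : X, κ i), h (overwrite X c x) := by
  rw [← Finset.sum_filter]
  refine Finset.sum_nbij' (fun z i => z i) (fun c => overwrite X c x) ?_ ?_ ?_ ?_ ?_
  · simp
  · intro c _
    simp only [Finset.mem_filter, Finset.mem_univ, true_and]
    intro i hi
    rw [overwrite_of_notMem hi]
  · intro z hz
    simp only [Finset.mem_filter, Finset.mem_univ, true_and] at hz
    rw [overwrite_restrict, piecewise_eq_right_of_agree hz]
  · intro c _
    exact restrict_overwrite X c x
  · intro z hz
    simp only [Finset.mem_filter, Finset.mem_univ, true_and] at hz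
    rw [overwrite_restrict, piecewise_eq_right_of_agree hz]

theorem sum_restrict (X : Finset (ZMod L)) (F : (∀ i : X, κ i) → ℂ) :
    ∑ c : Config κ, F (fun i => c i) =
      (Fintype.card (∀ i : {i // i ∉ X}, κ i) : ℂ) * ∑ c, F c := by
  refine (Fintype.sum_equiv (Equiv.piEquivPiSubtypeProd (fun i => i ∈ X) κ)
    (fun c => F (fun i => c i)) (fun p => F p.1) (fun c => rfl)).trans ?_
  rw [Fintype.sum_prod_type, Finset.mul_sum]
  refine Finset.sum_congr rfl fun c _ => ?_
  simp

/-- The operator `V ⊗ 1` for `V` acting on the region `X`. -/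
def extendOp (X : Finset (ZMod L)) (V : Matrix (∀ i : X, κ i) (∀ i : X, κ i) ℂ) : Op κ :=
  Matrix.of fun x y => if ∀ i, i ∉ X → x i = y i then V (fun i => x i) (fun i => y i) else 0

theorem extendOp_mulVec (X : Finset (ZMod L)) (V : Matrix (∀ i : X, κ i) (∀ i : X, κ i) ℂ)
    (ψ : Config κ → ℂ) (x : Config κ) :
    (extendOp X V *ᵥ ψ) x = ∑ c, V (fun i => x i) c * ψ (overwrite X c x) := by
  rw [Matrix.mulVec, dotProduct]
  simp only [extendOp, Matrix.of_apply, ite_mul, zero_mul]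
  rw [sum_ite_agree X x fun z => V (fun i => x i) (fun i => z i) * ψ z]
  simp only [restrict_overwrite]

theorem extendOp_mem_unitaryGroup (X : Finset (ZMod L))
    {V : Matrix (∀ i : X, κ i) (∀ i : X, κ i) ℂ} (hV : V ∈ Matrix.unitaryGroup (∀ i : X, κ i) ℂ) :
    extendOp X V ∈ Matrix.unitaryGroup (Config κ) ℂ := by
  rw [Matrix.mem_unitaryGroup_iff'] at hV ⊢
  ext x y
  rw [Matrix.mul_apply]
  have e : ∀ z, star (extendOp X V) x z * extendOp X V z y =
      if ∀ i, i ∉ X → x i = z i then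
        star (V (fun i => z i) (fun i => x i)) * extendOp X V z y else 0 := by
    intro z
    rw [Matrix.star_apply, extendOp, Matrix.of_apply]
    by_cases h : ∀ i, i ∉ X → x i = z i
    · rw [if_pos h, if_pos fun i hi => (h i hi).symm]
    · rw [if_neg h, if_neg fun h' => h fun i hi => (h' i hi).symm, star_zero, zero_mul]
  rw [Finset.sum_congr rfl fun z _ => e z,
    sum_ite_agree X x fun z => star (V (fun i => z i) (fun i => x i)) * extendOp X V z y]
  simp only [restrict_overwrite]
  by_cases h : ∀ i, i ∉ X → x i = y i
  · have e2 : ∀ c, extendOp X V (overwrite X c x) y = V c (fun i => y i) := by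
      intro c
      rw [extendOp, Matrix.of_apply, if_pos, restrict_overwrite]
      intro i hi
      rw [overwrite_of_notMem hi, h i hi]
    simp only [e2]
    have := congrFun (congrFun hV (fun i => x i)) (fun i => y i)
    rw [Matrix.mul_apply] at this
    refine Eq.trans this ?_
    rw [Matrix.one_apply, Matrix.one_apply]
    refine if_congr ?_ rfl rfl
    constructor
    · intro h'
      funext i
      by_cases hi : i ∈ X
      · exact congrFun h' ⟨i, hi⟩
      · exact h i hi
    · rintro rfl; rfl
  · have hxy : x ≠ y := by rintro rfl; exact h fun _ _ => rfl
    rw [Matrix.one_apply_ne hxy]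
    refine Finset.sum_eq_zero fun c _ => ?_
    rw [extendOp, Matrix.of_apply, if_neg, mul_zero]
    intro h'
    exact h fun i hi => by rw [← h' i hi, overwrite_of_notMem hi]

/-- Uniqueness of purifications. For each choice of coordinates off `X`, `N` has as column the
resulting vector on `X`, so equal marginals are equal Gram matrices of columns. The cardinality
enters because `gram` sums over full configurations. -/
theorem exists_unitary_of_gram_eq {X : Finset (ZMod L)} {α γ : Config κ → ℂ}
    (h : ∀ a b, gram X α a b = gram X γ a b) : ∃ v ∈ loc κ X, (v : Op κ) *ᵥ α = γ := by
  by_cases hne : Nonempty (Config κ)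
  swap
  · exact ⟨1, one_mem _, funext fun x => (hne ⟨x⟩).elim⟩
  let N : (Config κ → ℂ) → Matrix (∀ i : X, κ i) (Config κ) ℂ := fun ψ =>
    Matrix.of fun c a => ψ (overwrite X c a)
  have hcard : (Fintype.card (∀ i : {i // i ∉ X}, κ i) : ℂ) ≠ 0 := by
    obtain ⟨z⟩ := hne
    have : Nonempty (∀ i : {i // i ∉ X}, κ i) := ⟨fun i => z i⟩
    exact_mod_cast Fintype.card_ne_zero
  have hN : ∀ ψ a b, gram X ψ a b = (Fintype.card (∀ i : {i // i ∉ X}, κ i) : ℂ) *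
      ((N ψ).conjTranspose * N ψ) b a := by
    intro ψ a b
    rw [Matrix.mul_apply, ← sum_restrict X fun c => (N ψ).conjTranspose b c * N ψ c a]
    refine Finset.sum_congr rfl fun c _ => ?_
    rw [Matrix.conjTranspose_apply]
    simp only [N, Matrix.of_apply, overwrite_restrict]
    rw [mul_comm]
  obtain ⟨V, hV, hVN⟩ := exists_unitary_mul_eq (M := N α) (M' := N γ) (by
    ext b a
    exact mul_left_cancel₀ hcard (by rw [← hN, ← hN, h]))
  refine ⟨⟨extendOp X V, extendOp_mem_unitaryGroup X hV⟩, mem_loc_iff.2 ⟨V, fun x y => rfl⟩, ?_⟩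
  funext x
  rw [extendOp_mulVec]
  have := congrFun (congrFun hVN (fun i => x i)) x
  rw [Matrix.mul_apply] at this
  refine Eq.trans this ?_
  simp only [N, Matrix.of_apply, overwrite_restrict, Finset.piecewise_same]

theorem gram_smul (X : Finset (ZMod L)) (k : ℂ) (ψ : Config κ → ℂ) (a b : Config κ) :
    gram X (k • ψ) a b = k * star k * gram X ψ a b := by
  simp only [gram, Finset.mul_sum, Pi.smul_apply, smul_eq_mul, star_mul']
  exact Finset.sum_congr rfl fun c _ => by ring

/-- For `ψ = α ⊗ β` across `A`, tracing `X` out of `α` amounts to tracing `X ∪ Aᶜ` out of `ψ`, up to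
the norm of `β`. Here `α` and `β` are slices of `ψ` through `b₀`, which produces the constants. -/
theorem gram_left_factor {A : Finset (ZMod L)} (X : Finset (ZMod L)) {ψ : Config κ → ℂ}
    (hψ : IsProd A ψ) (b₀ a b : Config κ) :
    gram X (fun a => ψ (A.piecewise a b₀)) a b *
        ∑ c, ψ (A.piecewise b₀ c) * star (ψ (A.piecewise b₀ c)) =
      Fintype.card (Config κ) * (ψ b₀ * star (ψ b₀)) * gram (X ∪ Aᶜ) ψ a b := by
  have hp : ∀ a c, ψ ((X ∪ Aᶜ).piecewise c a) * ψ b₀ =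
      ψ (A.piecewise (X.piecewise c a) b₀) * ψ (A.piecewise b₀ c) := by
    intro a c
    have := hψ ((X ∪ Aᶜ).piecewise c a) b₀
    have e1 : A.piecewise ((X ∪ Aᶜ).piecewise c a) b₀ = A.piecewise (X.piecewise c a) b₀ := by
      funext i
      by_cases hA : i ∈ A <;> by_cases hi : i ∈ X <;> simp [hA, hi]
    have e2 : A.piecewise b₀ ((X ∪ Aᶜ).piecewise c a) = A.piecewise b₀ c := by
      funext i
      by_cases hA : i ∈ A <;> simp [hA]
    rw [← this, e1, e2]
  rw [gram, gram, Finset.sum_mul_sum]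
  calc _ = ∑ p : Config κ × Config κ, (fun p : Config κ × Config κ =>
        ψ (A.piecewise (X.piecewise p.1 a) b₀) * star (ψ (A.piecewise (X.piecewise p.1 b) b₀)) *
          (ψ (A.piecewise b₀ p.1) * star (ψ (A.piecewise b₀ p.1)))) (exch κ A p) := by
        rw [Fintype.sum_prod_type]
        refine Finset.sum_congr rfl fun c _ => Finset.sum_congr rfl fun d _ => ?_
        have e1 : ∀ a, A.piecewise (X.piecewise (A.piecewise c d) a) b₀ =
            A.piecewise (X.piecewise c a) b₀ := by
          intro a; funext i
          by_cases hA : i ∈ A <;> by_cases hi : i ∈ X <;> simp [hA, hi]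
        have e2 : A.piecewise b₀ (A.piecewise c d) = A.piecewise b₀ d := by
          funext i
          by_cases hA : i ∈ A <;> simp [hA]
        simp only [exch, Equiv.coe_fn_mk, e1, e2]
    _ = _ := by
        rw [sum_exch A fun p : Config κ × Config κ =>
          ψ (A.piecewise (X.piecewise p.1 a) b₀) * star (ψ (A.piecewise (X.piecewise p.1 b) b₀)) *
          (ψ (A.piecewise b₀ p.1) * star (ψ (A.piecewise b₀ p.1))), Fintype.sum_prod_type,
          Finset.mul_sum]
        refine Finset.sum_congr rfl fun c _ => ?_
        simp only [Finset.sum_const, Finset.card_univ, nsmul_eq_mul]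
        rw [mul_assoc (Fintype.card _ : ℂ)]
        congr 1
        calc _ = (ψ (A.piecewise (X.piecewise c a) b₀) * ψ (A.piecewise b₀ c)) *
              star (ψ (A.piecewise (X.piecewise c b) b₀) * ψ (A.piecewise b₀ c)) := by
              rw [star_mul']; ring
          _ = _ := by
              rw [← hp, ← hp, star_mul']; ring

theorem sum_mul_star_eq (F : Config κ → ℂ) :
    ∑ c, F c * star (F c) = ((∑ c, ‖F c‖ ^ 2 : ℝ) : ℂ) := by
  push_cast
  exact Finset.sum_congr rfl fun c _ => RCLike.mul_conj _

theorem sum_norm_sq_pos {F : Config κ → ℂ} {b : Config κ} (hb : F b ≠ 0) :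
    0 < ∑ c, ‖F c‖ ^ 2 := by
  have : 0 < ‖F b‖ := norm_pos_iff.2 hb
  exact lt_of_lt_of_le (by positivity) (Finset.single_le_sum
    (f := fun c => ‖F c‖ ^ 2) (fun c _ => by positivity) (Finset.mem_univ b))

/-- `x` acts within `X ∪ Aᶜ`, so it preserves the marginal off that set. Hence the `A`-factors of
`ψ` and `φ` have proportional marginals off `X`, and a unitary on `X` relates them up to scale. -/
theorem exists_unitary_left_factor {A X Y : Finset (ZMod L)} (hY : Disjoint Y A)
    {x : UnitaryOp κ} (hx : x ∈ loc κ (X ∪ Y)) {ψ φ : Config κ → ℂ} (hφ : (x : Op κ) *ᵥ ψ = φ)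
    (hpψ : IsProd A ψ) (hpφ : IsProd A φ) {b₀ b₁ : Config κ} (h₀ : ψ b₀ ≠ 0) (h₁ : φ b₁ ≠ 0) :
    ∃ v ∈ loc κ X, ∃ k : ℂ, (v : Op κ) *ᵥ (fun a => ψ (A.piecewise a b₀)) =
      k • fun a => φ (A.piecewise a b₁) := by
  have hxZ : x ∈ loc κ (X ∪ Aᶜ) :=
    loc_mono (Finset.union_subset_union subset_rfl
      (Finset.subset_compl_iff_disjoint_right.2 hY)) hx
  have g0 := fun a b => gram_left_factor X hpψ b₀ a b
  have g1 := fun a b => gram_left_factor X hpφ b₁ a b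
  have hg := fun a b => gram_mulVec hxZ ψ a b
  rw [hφ] at hg
  simp only [sum_mul_star_eq fun c => ψ (A.piecewise b₀ c),
    sum_mul_star_eq fun c => φ (A.piecewise b₁ c), hg] at g0 g1
  have p0 : 0 < ∑ c, ‖ψ (A.piecewise b₀ c)‖ ^ 2 :=
    sum_norm_sq_pos (b := b₀) (by rwa [Finset.piecewise_same])
  have p1 : 0 < ∑ c, ‖φ (A.piecewise b₁ c)‖ ^ 2 :=
    sum_norm_sq_pos (b := b₁) (by rwa [Finset.piecewise_same])
  generalize (∑ c, ‖ψ (A.piecewise b₀ c)‖ ^ 2) = B₀ at g0 p0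
  generalize (∑ c, ‖φ (A.piecewise b₁ c)‖ ^ 2) = B₁ at g1 p1
  have n0 : ψ b₀ * star (ψ b₀) = ((‖ψ b₀‖ ^ 2 : ℝ) : ℂ) := by
    rw [Complex.ofReal_pow]; exact RCLike.mul_conj _
  have n1 : φ b₁ * star (φ b₁) = ((‖φ b₁‖ ^ 2 : ℝ) : ℂ) := by
    rw [Complex.ofReal_pow]; exact RCLike.mul_conj _
  have q0 : 0 < ‖ψ b₀‖ ^ 2 := by have := norm_pos_iff.2 h₀; positivity
  have q1 : 0 < ‖φ b₁‖ ^ 2 := by have := norm_pos_iff.2 h₁; positivity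
  rw [n0] at g0
  rw [n1] at g1
  generalize ‖ψ b₀‖ ^ 2 = Q₀ at g0 q0
  generalize ‖φ b₁‖ ^ 2 = Q₁ at g1 q1
  -- The ratio of the constants in `g0` and `g1`; scaling the factor of `φ` by its square root makes
  -- the Gram functions equal.
  set t : ℝ := Q₀ * B₁ / (Q₁ * B₀) with ht
  have htpos : 0 < t := by positivity
  set k : ℂ := ((Real.sqrt t : ℝ) : ℂ) with hk
  have hkk : k * star k = (t : ℂ) := by
    rw [hk, Complex.star_def, Complex.conj_ofReal, ← Complex.ofReal_mul,
      Real.mul_self_sqrt htpos.le]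
  have hB0 : (B₀ : ℂ) ≠ 0 := by exact_mod_cast p0.ne'
  have hQ1 : (Q₁ : ℂ) ≠ 0 := by exact_mod_cast q1.ne'
  obtain ⟨v, hv, hvk⟩ := exists_unitary_of_gram_eq (X := X)
    (α := fun a => ψ (A.piecewise a b₀)) (γ := k • fun a => φ (A.piecewise a b₁)) (by
      intro a b
      rw [gram_smul, hkk, ht]
      apply mul_right_cancel₀ hB0
      rw [g0]
      push_cast
      rw [div_mul_eq_mul_div, div_mul_eq_mul_div, eq_div_iff (mul_ne_zero hQ1 hB0)]
      have := g1 a b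
      linear_combination (-(Q₀ : ℂ) * B₀) * this)
  exact ⟨v, hv, k, hvk⟩

theorem IsProd.mul_eq {A : Finset (ZMod L)} {ψ : Config κ → ℂ} (h : IsProd A ψ)
    (b₀ a : Config κ) : ψ (A.piecewise a b₀) * ψ (A.piecewise b₀ a) = ψ a * ψ b₀ := h a b₀

theorem piecewise_left_indep {A Y : Finset (ZMod L)} (hY : Disjoint Y A) (b₀ : Config κ)
    {x z : Config κ} (h : ∀ i, i ∉ Y → x i = z i) :
    A.piecewise z b₀ = A.piecewise x b₀ := by
  funext i
  by_cases hi : i ∈ A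
  · simp [hi, h i fun h' => Finset.disjoint_left.1 hY h' hi]
  · simp [hi]

theorem piecewise_right_indep {A X : Finset (ZMod L)} (hX : X ⊆ A) (b₀ : Config κ)
    {x z : Config κ} (h : ∀ i, i ∉ X → x i = z i) :
    A.piecewise b₀ z = A.piecewise b₀ x := by
  funext i
  by_cases hi : i ∈ A
  · simp [hi]
  · simp [hi, h i fun h' => hi (hX h')]

/-- If `x` acts near the boundary of `A` and maps a product vector to a product vector, then it acts
on this vector as a product of unitaries on the two sides. -/
theorem exists_local_unitaries {A X Y : Finset (ZMod L)} (hX : X ⊆ A) (hY : Disjoint Y A)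
    {x : UnitaryOp κ} (hx : x ∈ loc κ (X ∪ Y)) {ψ : Config κ → ℂ} (hψ : ∃ b, ψ b ≠ 0)
    (hpψ : IsProd A ψ) (hpφ : IsProd A ((x : Op κ) *ᵥ ψ)) :
    ∃ v ∈ loc κ X, ∃ w ∈ loc κ Y, ∃ k : ℂ,
      ((v * w : UnitaryOp κ) : Op κ) *ᵥ ψ = k • ((x : Op κ) *ᵥ ψ) := by
  obtain ⟨b₀, h₀⟩ := hψ
  obtain ⟨b₁, h₁⟩ : ∃ b, ((x : Op κ) *ᵥ ψ) b ≠ 0 := by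
    by_contra hcon
    push Not at hcon
    have h0 : (x : Op κ) *ᵥ ψ = 0 := funext hcon
    have : ((x⁻¹ * x : UnitaryOp κ) : Op κ) *ᵥ ψ = 0 := by
      rw [Submonoid.coe_mul, ← Matrix.mulVec_mulVec, h0, Matrix.mulVec_zero]
    rw [inv_mul_cancel, Submonoid.coe_one, Matrix.one_mulVec] at this
    exact h₀ (congrFun this b₀)
  set φ := (x : Op κ) *ᵥ ψ with hφ
  obtain ⟨v, hv, k, hvk⟩ := exists_unitary_left_factor hY hx hφ.symm hpψ hpφ h₀ h₁
  -- The other side of the cut: the same lemma for `Aᶜ`, with `X` and `Y` exchanged.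
  obtain ⟨w, hw, k', hwk⟩ := exists_unitary_left_factor (A := Aᶜ)
    (disjoint_compl_right_iff.2 hX)
    (by rwa [Finset.union_comm]) hφ.symm hpψ.compl hpφ.compl h₀ h₁
  simp only [piecewise_compl'] at hwk
  refine ⟨v, hv, w, hw, k * k' * φ b₁ / ψ b₀, ?_⟩
  have e0 : ψ = (ψ b₀)⁻¹ • fun a => ψ (A.piecewise a b₀) * ψ (A.piecewise b₀ a) := by
    funext a
    rw [Pi.smul_apply, smul_eq_mul, hpψ.mul_eq, mul_comm (ψ a), inv_mul_cancel_left₀ h₀]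
  have e1 : (w : Op κ) *ᵥ (fun a => ψ (A.piecewise a b₀) * ψ (A.piecewise b₀ a)) =
      fun a => (k' * φ (A.piecewise b₁ a)) * ψ (A.piecewise a b₀) := by
    rw [mulVec_mul_of_indep hw (F := fun a => ψ (A.piecewise a b₀))
      (fun x z h => by rw [piecewise_left_indep hY b₀ h]), hwk]
    funext a
    simp only [Pi.smul_apply, smul_eq_mul]
    ring
  have e2 : (v : Op κ) *ᵥ (fun a => (k' * φ (A.piecewise b₁ a)) * ψ (A.piecewise a b₀)) =
      fun a => (k' * φ (A.piecewise b₁ a)) * (k * φ (A.piecewise a b₁)) := by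
    rw [mulVec_mul_of_indep hv (F := fun a => k' * φ (A.piecewise b₁ a))
      (fun x z h => by rw [piecewise_right_indep hX b₁ h]), hvk]
    rfl
  conv_lhs => rw [e0]
  rw [Submonoid.coe_mul, ← Matrix.mulVec_mulVec, Matrix.mulVec_smul, e1, Matrix.mulVec_smul, e2]
  funext a
  simp only [Pi.smul_apply, smul_eq_mul]
  have := hpφ.mul_eq b₁ a
  field_simp
  linear_combination k * k' * this

/-- If a product of unitaries on `A` and on its complement fixes a product vector up to a factor,
then so does the unitary on `A`. -/
theorem exists_smul_of_isProd {A : Finset (ZMod L)} {u u' : UnitaryOp κ} (hu : u ∈ loc κ A)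
    (hu' : u' ∈ loc κ Aᶜ) {ψ : Config κ → ℂ} (hψ : ∃ b, ψ b ≠ 0) (hp : IsProd A ψ) {z : ℂ}
    (h : ((u * u' : UnitaryOp κ) : Op κ) *ᵥ ψ = z • ψ) :
    ∃ μ : ℂ, (u : Op κ) *ᵥ ψ = μ • ψ := by
  obtain ⟨b₀, h₀⟩ := hψ
  have e0 : ψ = (ψ b₀)⁻¹ • fun a => ψ (A.piecewise b₀ a) * ψ (A.piecewise a b₀) := by
    funext a
    rw [Pi.smul_apply, smul_eq_mul, mul_comm (ψ (A.piecewise b₀ a)), hp.mul_eq, mul_comm (ψ a),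
      inv_mul_cancel_left₀ h₀]
  set α : Config κ → ℂ := fun a => ψ (A.piecewise a b₀) with hα
  set β : Config κ → ℂ := fun a => ψ (A.piecewise b₀ a) with hβ
  have hur : (u : Op κ) *ᵥ ψ = (ψ b₀)⁻¹ • fun a => β a * ((u : Op κ) *ᵥ α) a := by
    conv_lhs => rw [e0]
    rw [Matrix.mulVec_smul]
    congr 1
    exact mulVec_mul_of_indep hu
      (F := β) (fun x z h => by
      show ψ _ = ψ _
      rw [piecewise_right_indep subset_rfl b₀ h]) _
  have hur' : (u : Op κ) *ᵥ ψ =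
      (z * (ψ b₀)⁻¹) • fun a => α a * (((u'⁻¹ : UnitaryOp κ) : Op κ) *ᵥ β) a := by
    have h1 : (u : Op κ) *ᵥ ψ = z • (((u'⁻¹ : UnitaryOp κ) : Op κ) *ᵥ ψ) := by
      rw [← Matrix.mulVec_smul, ← h, Matrix.mulVec_mulVec, ← Submonoid.coe_mul,
        ← loc_comm disjoint_compl_left hu' hu, inv_mul_cancel_left]
    rw [h1]
    conv_lhs => rw [e0]
    rw [Matrix.mulVec_smul, smul_smul]
    congr 1
    rw [← mulVec_mul_of_indep (inv_mem hu') (F := α)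
      (fun x z h => by
        show ψ _ = ψ _
        rw [piecewise_left_indep disjoint_compl_left b₀ h])]
    congr 1
    funext a
    exact mul_comm _ _
  -- Freeze the coordinates off `A` at `b₀` in the two expressions for `u ψ`: one becomes a multiple
  -- of `u α`, the other a multiple of `α`.
  have key : (u : Op κ) *ᵥ α = (z * (((u'⁻¹ : UnitaryOp κ) : Op κ) *ᵥ β) b₀ / ψ b₀) • α := by
    funext a
    have h2 := congrFun (hur.symm.trans hur') (A.piecewise a b₀)
    simp only [Pi.smul_apply, smul_eq_mul] at h2 ⊢
    have c1 : β (A.piecewise a b₀) = ψ b₀ := by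
      simp only [hβ]
      congr 1
      funext i
      by_cases hi : i ∈ A <;> simp [hi]
    have c2 : ∀ a, α (A.piecewise a b₀) = α a := by
      intro a
      simp only [hα]
      congr 1
      funext i
      by_cases hi : i ∈ A <;> simp [hi]
    have c3 : ((u : Op κ) *ᵥ α) (A.piecewise a b₀) = ((u : Op κ) *ᵥ α) a := by
      rw [mulVec_piecewise hu]
      simp only [c2]
    have c4 : (((u'⁻¹ : UnitaryOp κ) : Op κ) *ᵥ β) (A.piecewise a b₀) =
        (((u'⁻¹ : UnitaryOp κ) : Op κ) *ᵥ β) b₀ := by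
      rw [← piecewise_compl', mulVec_piecewise (inv_mem hu')]
      congr 2
      funext b
      simp only [hβ, piecewise_compl']
      congr 1
      funext i
      by_cases hi : i ∈ A <;> simp [hi]
    rw [c1, c2, c3, c4] at h2
    field_simp at h2 ⊢
    linear_combination h2
  refine ⟨z * (((u'⁻¹ : UnitaryOp κ) : Op κ) *ᵥ β) b₀ / ψ b₀, ?_⟩
  rw [hur, key]
  have e0a : ∀ a, ψ a = (ψ b₀)⁻¹ * (β a * α a) := fun a => congrFun e0 a
  funext a
  simp only [Pi.smul_apply, smul_eq_mul]
  linear_combination (-(z * (((u'⁻¹ : UnitaryOp κ) : Op κ) *ᵥ β) b₀ / ψ b₀)) * e0a a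

end Marginals

/-! ### Gluing operators along their conjugation action. -/

section Glue

variable {L : ℕ} {κ : ZMod L → Type*} [NeZero L] [∀ i, Fintype (κ i)] [∀ i, DecidableEq (κ i)]

/-- Conjugation by `T` and by `T'` agree on the operators on `I`. -/
def Agree (T T' : UnitaryOp κ) (I : Finset (ZMod L)) : Prop :=
  ∀ v ∈ loc κ I, T * v * T⁻¹ = T' * v * T'⁻¹

theorem Agree.symm {T T' : UnitaryOp κ} {I : Finset (ZMod L)} (h : Agree T T' I) :
    Agree T' T I := fun v hv => (h v hv).symm

theorem Agree.trans {T T' T'' : UnitaryOp κ} {I : Finset (ZMod L)} (h : Agree T T' I)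
    (h' : Agree T' T'' I) : Agree T T'' I := fun v hv => (h v hv).trans (h' v hv)

theorem Agree.mono {T T' : UnitaryOp κ} {I J : Finset (ZMod L)} (h : Agree T T' I) (hJ : J ⊆ I) :
    Agree T T' J := fun v hv => h v (loc_mono hJ hv)

theorem Agree.maps {T T' : UnitaryOp κ} {I J : Finset (ZMod L)} (h : Agree T T' I)
    (h' : Maps T' I J) : Maps T I J := fun v hv => by rw [h v hv]; exact h' v hv

theorem Agree.mul {T₁ T₁' T₂ T₂' : UnitaryOp κ} {I J : Finset (ZMod L)} (h₁ : Agree T₁ T₁' J)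
    (h₂ : Agree T₂ T₂' I) (hm : Maps T₂' I J) : Agree (T₁ * T₂) (T₁' * T₂') I := by
  intro v hv
  have e1 : T₁ * T₂ * v * (T₁ * T₂)⁻¹ = T₁ * (T₂ * v * T₂⁻¹) * T₁⁻¹ := by group
  have e2 : T₁' * T₂' * v * (T₁' * T₂')⁻¹ = T₁' * (T₂' * v * T₂'⁻¹) * T₁'⁻¹ := by group
  rw [e1, e2, h₂ v hv, h₁ _ (hm v hv)]

theorem agree_of_inv_mul_mem {T T' : UnitaryOp κ} {X I : Finset (ZMod L)}
    (h : T⁻¹ * T' ∈ loc κ X) (hd : Disjoint X I) : Agree T T' I := by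
  intro v hv
  have := loc_conj_eq hd h hv
  calc T * v * T⁻¹ = T * (T⁻¹ * T' * v * (T⁻¹ * T')⁻¹) * T⁻¹ := by rw [this]
    _ = T' * v * T'⁻¹ := by group

theorem agree_one {T : UnitaryOp κ} {X I : Finset (ZMod L)}
    (h : T ∈ loc κ X) (hd : Disjoint X I) : Agree T 1 I :=
  (agree_of_inv_mul_mem (T := 1) (by simpa using h) hd).symm

/-- Converse to `agree_of_inv_mul_mem`. Applied to all sites, it shows that unitaries with the same
conjugation action differ by an element of `loc κ ∅`, that is, a scalar. -/
theorem inv_mul_mem_of_agree {T T' : UnitaryOp κ} {I : Finset (ZMod L)}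
    (h : ∀ i ∈ I, Agree T T' {i}) : T⁻¹ * T' ∈ loc κ Iᶜ := by
  refine mem_loc_of_commute fun i hi v hv => ?_
  have := h i (by simpa using hi) v hv
  calc v * (T⁻¹ * T') = T⁻¹ * (T * v * T⁻¹) * T' := by group
    _ = T⁻¹ * T' * v := by rw [this]; group

theorem agree_of_sites {T T' : UnitaryOp κ} {I : Finset (ZMod L)}
    (h : ∀ i ∈ I, Agree T T' {i}) : Agree T T' I :=
  agree_of_inv_mul_mem (inv_mul_mem_of_agree h) disjoint_compl_left

theorem agree_union {T T' : UnitaryOp κ} {I J K : Finset (ZMod L)}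
    (hI : Agree T T' I) (hJ : Agree T T' J) (hK : K ⊆ I ∪ J) : Agree T T' K :=
  agree_of_sites fun i hi => by
    rcases Finset.mem_union.1 (hK hi) with h | h
    · exact hI.mono (by simpa using h)
    · exact hJ.mono (by simpa using h)

/-- A circuit inside an arc can be cut at a point of the arc. -/
theorem exists_cut_arc {r D : ℕ} {s : ℤ} (hs : s = (r * D : ℕ)) {a c : ℤ} {n : ℕ}
    {W : UnitaryOp κ} (hW : IsCircuit (arc (a : ZMod L) n) r D (W : Op κ)) (h₁ : a + 10 * s ≤ c)
    (h₂ : c + 10 * s ≤ a + n) (h₃ : n + 100 * s ≤ L) :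
    ∃ ξ ∈ loc κ (seg L (c - s) (c + s)), ∃ Vl ∈ loc κ (seg L a c),
      ∃ Vr ∈ loc κ (seg L c (a + n)), W = ξ * Vr * Vl ∧ W ∈ loc κ (seg L a (a + n)) ∧
        Spreads (r * D) W := by
  subst hs
  -- Only the cut at `c` is wanted. The other two are placed outside the arc, where the cut
  -- operators are supported both inside and outside the arc and hence on no site (`e`).
  obtain ⟨x, V, h⟩ := hW.exists_isCut' (q := ![c, a + n + 10 * (r * D : ℕ), a + n + 20 * (r * D : ℕ)])
    ⟨by simp; omega, by simp; omega, by simp; omega⟩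
  rw [arc_intCast] at h
  have e : ∀ {X : Finset (ZMod L)} {u : UnitaryOp κ}, u ∈ loc κ X → u ∈ loc κ (seg L a (a + n)) →
      Disjoint X (seg L a (a + n)) → ∀ Y, u ∈ loc κ Y := fun h1 h2 hd Y =>
    mem_loc_of_subset_inter h1 h2 (by rw [Finset.disjoint_iff_inter_eq_empty.1 hd]; simp)
  have x0 := h.x_mem 0
  have x1 := e (h.x_mem 1) (h.x_mem' 1) (by
    simp only [window, Matrix.cons_val_one, Matrix.cons_val_zero]
    exact (seg_disjoint (by omega) (by omega)).symm)
  have x2 := e (h.x_mem 2) (h.x_mem' 2) (by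
    simp only [window, Matrix.cons_val]
    exact (seg_disjoint (by omega) (by omega)).symm)
  have V1 := e (h.V_mem 1) (h.V_mem' 1) (by
    simp only [pieces, Matrix.cons_val]
    exact (seg_disjoint (by omega) (by omega)).symm)
  have V0 := h.V_mem 0
  have V2 := h.V_mem 2
  simp only [pieces, window, Matrix.cons_val] at x0 V0 V2
  refine ⟨x 0, x0, V 2, mem_loc_of_subset_inter V2 (h.V_mem' 2) ?_, x 1 * x 2 * V 0 * V 1,
    mul_mem (mul_mem (mul_mem (x1 _) (x2 _)) ?_) (V1 _), ?_, ?_, h.spreads'⟩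
  · rw [← seg_period a (a + n), ← seg_period a c]
    exact seg_inter_subset (by omega) (by omega) (by omega) (by omega)
  · exact mem_loc_of_subset_inter V0 (h.V_mem' 0)
      (seg_inter_subset (by omega) (by omega) (by omega) (by omega))
  · rw [h.eq]
    simp only [prod3]
    group
  · rw [h.eq]
    exact mul_mem (prod3_mem h.x_mem') (prod3_mem h.V_mem')

/-- Glue the restricted symmetry `UM` on the left of `c` to an operator `S`, cut at `p`, on the
right of `c`. -/
theorem exists_glue {s w : ℤ} (hs : 0 ≤ s) (hsw : s ≤ w) {a c p N : ℤ}
    {UM U S ξ Vl Vr : UnitaryOp κ} (hξ : ξ ∈ loc κ (seg L (c - s) (c + s)))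
    (hVl : Vl ∈ loc κ (seg L a c)) (hVr : Vr ∈ loc κ (seg L c N)) (hUM : UM = ξ * Vr * Vl)
    (hspread : Maps UM (seg L c (c + 2 * s)) (seg L (c - s) (c + 3 * s)))
    (hUU : Agree UM U (seg L c (c + 2 * s))) (hSU : Agree S U (seg L c (c + 2 * s)))
    (hS : Maps S (seg L (c + 2 * s) p) (seg L (c + s) p))
    (hac : a + 10 * s ≤ c) (hcp : c + 10 * s ≤ p) (hpL : p + 10 * w ≤ a + L)
    (hcN : c + 2 * s ≤ N) (hN : N + 10 * s ≤ a + L) :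
    ∃ H ∈ loc κ (seg L a p), Agree H UM (seg L a c) ∧ Agree H S (seg L c p) := by
  -- `ξ⁻¹ S` crosses neither end of `[c, p)`. Near `c` it acts as `ξ⁻¹ UM = Vr Vl`, which does not
  -- cross `c`; further right, `S` reaches back at most `s` and does not cross `p`.
  have hT : Maps (ξ⁻¹ * S) (seg L c p) (seg L c p) := by
    refine maps_of_sites fun i hi => ?_
    obtain ⟨k, hk1, hk2, rfl⟩ := mem_seg.1 hi
    rcases lt_or_ge k (c + 2 * s) with hk | hk
    · have h1 : Maps (ξ⁻¹ * UM) (seg L c (c + 2 * s)) (seg L c N) := by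
        have e : ξ⁻¹ * UM = Vr * Vl := by rw [hUM]; group
        rw [e]
        intro v hv
        have e' : Vr * Vl * v * (Vr * Vl)⁻¹ = Vr * (Vl * v * Vl⁻¹) * Vr⁻¹ := by group
        rw [e', loc_conj_eq (seg_disjoint (by omega) (by omega)) hVl hv]
        exact maps_of_mem hVr subset_rfl (seg_mono le_rfl hcN) v hv
      have h2 : Maps (ξ⁻¹ * UM) (seg L c (c + 2 * s)) (seg L (c - s) (c + 3 * s)) :=
        (maps_of_mem (inv_mem hξ) (seg_mono le_rfl (by omega)) subset_rfl).comp hspread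
      have h3 : Maps (ξ⁻¹ * S) (seg L c (c + 2 * s)) (seg L c p) := by
        intro v hv
        have e : ξ⁻¹ * S * v * (ξ⁻¹ * S)⁻¹ = ξ⁻¹ * UM * v * (ξ⁻¹ * UM)⁻¹ := by
          have := (hSU.trans hUU.symm) v hv
          calc _ = ξ⁻¹ * (S * v * S⁻¹) * ξ := by group
            _ = _ := by rw [this]; group
        rw [e]
        exact (h1.inter h2 (seg_inter_subset (by omega) (by omega) (by omega) (by omega))) v hv
      exact h3.mono (by simpa using intCast_mem_seg hk1 hk) subset_rfl
    · have h1 : Maps (ξ⁻¹ * S) (seg L (c + 2 * s) p) (seg L (c + s) p) :=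
        (maps_of_disjoint (inv_mem hξ) (seg_disjoint (by omega) (by omega))).comp hS
      exact h1.mono (by simpa using intCast_mem_seg hk hk2) (seg_mono (by omega) le_rfl)
  obtain ⟨σ, hσ, hσ'⟩ := exists_factor hT
  set σ' := σ⁻¹ * (ξ⁻¹ * S) with hσ'_def
  have hSe : S = ξ * σ * σ' := by rw [hσ'_def]; group
  -- In `UM = ξ Vl Vr` the right part `Vr` is replaced by `σ`, the factor of `ξ⁻¹ S` on `[c, p)`.
  refine ⟨ξ * Vl * σ, mul_mem (mul_mem ?_ ?_) ?_, ?_, ?_⟩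
  · exact loc_mono (seg_mono (by omega) (by omega)) hξ
  · exact loc_mono (seg_mono le_rfl (by omega)) hVl
  · exact loc_mono (seg_mono (by omega) le_rfl) hσ
  · intro v hv
    have h1 := loc_conj_eq (seg_disjoint (by omega) (by omega)).symm hσ hv
    have h2 := loc_conj_eq (seg_disjoint (by omega) (by omega)).symm hVr hv
    have hc := loc_comm (seg_disjoint (by omega) (by omega)) hVl hVr
    rw [hUM, show ξ * Vr * Vl = ξ * (Vr * Vl) by group, ← hc]
    calc _ = ξ * Vl * (σ * v * σ⁻¹) * (ξ * Vl)⁻¹ := by group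
      _ = ξ * Vl * (Vr * v * Vr⁻¹) * (ξ * Vl)⁻¹ := by rw [h1, h2]
      _ = _ := by group
  · intro v hv
    have h1 := loc_conj_eq disjoint_compl_left hσ' hv
    have h2 := loc_conj_eq (seg_disjoint (by omega) (by omega)) hVl
      (maps_of_mem hσ subset_rfl subset_rfl v hv)
    rw [hSe]
    calc _ = ξ * (Vl * (σ * v * σ⁻¹) * Vl⁻¹) * ξ⁻¹ := by group
      _ = ξ * (σ * (σ' * v * σ'⁻¹) * σ⁻¹) * ξ⁻¹ := by rw [h2, h1]
      _ = _ := by group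

/-- The product law of the glued operators. -/
theorem glue_mul {s w : ℤ} (hs : 0 ≤ s) (hsw : s ≤ w) {a c p N : ℤ}
    {H₁ H₂ H₃ M₁ M₂ M₃ S₁ S₂ S₃ U₁ U₂ U₃ ΩL ΩR XA XB : UnitaryOp κ}
    (hH₁ : H₁ ∈ loc κ (seg L a p)) (hH₂ : H₂ ∈ loc κ (seg L a p)) (hH₃ : H₃ ∈ loc κ (seg L a p))
    (m₁ : Agree H₁ M₁ (seg L a c)) (m₂ : Agree H₂ M₂ (seg L a c)) (m₃ : Agree H₃ M₃ (seg L a c))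
    (t₁ : Agree H₁ S₁ (seg L c p)) (t₂ : Agree H₂ S₂ (seg L c p)) (t₃ : Agree H₃ S₃ (seg L c p))
    (u₁ : Agree H₁ U₁ (seg L (a + 4 * s) (p - 2 * w)))
    (u₂ : Agree H₂ U₂ (seg L (a + 4 * s) (p - 2 * w)))
    (u₃ : Agree H₃ U₃ (seg L (a + 4 * s) (p - 2 * w)))
    (hM : M₁ * M₂ = ΩL * ΩR * M₃) (hS : S₁ * S₂ = XA * XB * S₃) (hU : U₁ * U₂ = U₃)
    (mM₂ : Maps M₂ (seg L a (a + 8 * s)) (seg L a (a + 9 * s)))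
    (mM₃ : Maps M₃ (seg L a (a + 8 * s)) (seg L a (a + 9 * s)))
    (mS₂ : Maps S₂ (seg L (p - 6 * w) p) (seg L (p - 7 * w) p))
    (mS₃ : Maps S₃ (seg L (p - 6 * w) p) (seg L (p - 7 * w) p))
    (mU₂ : Maps U₂ (seg L (a + 8 * s) (p - 6 * w)) (seg L (a + 7 * s) (p - 5 * w)))
    (mU₃ : Maps U₃ (seg L (a + 8 * s) (p - 6 * w)) (seg L (a + 7 * s) (p - 5 * w)))
    (hΩL : ΩL ∈ loc κ (seg L a (a + 4 * s))) (hΩR : ΩR ∈ loc κ (seg L (N - 4 * s) N))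
    (hXA : XA ∈ loc κ (seg L (p - 4 * w) p)) (hXB : XB ∈ loc κ (seg L p (p + 4 * w)))
    (hac : a + 10 * s ≤ c) (hcp : c + 20 * w ≤ p) (hpL : p + 20 * w ≤ a + L)
    (hN : a + 20 * s ≤ N) (hN' : N ≤ a + L) :
    ∃ θ ∈ loc κ (∅ : Finset (ZMod L)), H₁ * H₂ = ΩL * XA * H₃ * θ := by
  refine ⟨(ΩL * XA * H₃)⁻¹ * (H₁ * H₂), ?_, by group⟩
  -- The two products are compared by conjugation, range by range: near `a` through `M`, in the bulk
  -- through the genuine representation `U`, near `p` through `S`, and beyond `p` where both act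
  -- trivially.
  have hmem : (ΩL * XA * H₃)⁻¹ * (H₁ * H₂) ∈ loc κ (Finset.univ : Finset (ZMod L))ᶜ := by
    refine inv_mul_mem_of_agree fun i _ => ?_
    obtain ⟨k, hk1, hk2, rfl⟩ := exists_coord a i
    have c1 : Agree (ΩL * XA * H₃) (H₁ * H₂) (seg L a (a + 8 * s)) := by
      have e1 : Agree (H₁ * H₂) (M₁ * M₂) (seg L a (a + 8 * s)) :=
        m₁.mul (m₂.mono (seg_mono le_rfl (by omega))) (mM₂.mono subset_rfl (seg_mono le_rfl (by omega)))
      have e2 : Agree (ΩL * ΩR) ΩL (seg L a (a + 9 * s)) := by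
        have := agree_one hΩR (seg_disjoint (L := L) (l₁ := N - 4 * s) (h₁ := N)
          (l₂ := a + L) (h₂ := a + 9 * s + L) (by omega) (by omega))
        rw [seg_period] at this
        simpa using Agree.mul (T₁ := ΩL) (T₁' := ΩL) (fun v _ => rfl) this
          (by intro v hv; simpa using hv)
      have e3 : Agree (ΩL * XA) ΩL (seg L a (a + 9 * s)) := by
        have := agree_one hXA (seg_disjoint (L := L) (l₁ := a) (h₁ := a + 9 * s)
          (by omega) (by omega)).symm
        simpa using Agree.mul (T₁ := ΩL) (T₁' := ΩL) (fun v _ => rfl) this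
          (by intro v hv; simpa using hv)
      have e4 : Agree (ΩL * XA * H₃) (ΩL * M₃) (seg L a (a + 8 * s)) :=
        e3.mul (m₃.mono (seg_mono le_rfl (by omega))) mM₃
      have e5 : Agree (M₁ * M₂) (ΩL * M₃) (seg L a (a + 8 * s)) := by
        rw [hM]
        exact e2.mul (fun v _ => rfl) mM₃
      exact e4.trans (e1.trans e5).symm
    have c2 : Agree (ΩL * XA * H₃) (H₁ * H₂) (seg L (a + 8 * s) (p - 6 * w)) := by
      have hsub : seg L (a + 8 * s) (p - 6 * w) ⊆ seg L (a + 4 * s) (p - 2 * w) :=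
        seg_mono (by omega) (by omega)
      have e1 : Agree (H₁ * H₂) (U₁ * U₂) (seg L (a + 8 * s) (p - 6 * w)) :=
        u₁.mul (u₂.mono hsub) (mU₂.mono subset_rfl (seg_mono (by omega) (by omega)))
      have e2 : Agree (ΩL * XA) 1 (seg L (a + 7 * s) (p - 5 * w)) := by
        have h1 := agree_one hΩL (seg_disjoint (L := L) (l₂ := a + 7 * s) (h₂ := p - 5 * w)
          (by omega) (by omega))
        have h2 := agree_one hXA (seg_disjoint (L := L) (l₁ := a + 7 * s) (h₁ := p - 5 * w)
          (by omega) (by omega)).symm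
        simpa using h1.mul h2 (by intro v hv; simpa using hv)
      have e3 : Agree (ΩL * XA * H₃) (1 * U₃) (seg L (a + 8 * s) (p - 6 * w)) :=
        e2.mul (u₃.mono hsub) mU₃
      rw [one_mul] at e3
      rw [hU] at e1
      exact e3.trans e1.symm
    have c3 : Agree (ΩL * XA * H₃) (H₁ * H₂) (seg L (p - 6 * w) p) := by
      have hsub : seg L (p - 6 * w) p ⊆ seg L c p := seg_mono (by omega) le_rfl
      have hsub' : seg L (p - 7 * w) p ⊆ seg L c p := seg_mono (by omega) le_rfl
      have e1 : Agree (H₁ * H₂) (S₁ * S₂) (seg L (p - 6 * w) p) :=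
        t₁.mul (t₂.mono hsub) (mS₂.mono subset_rfl hsub')
      have e2 : Agree (XA * XB) XA (seg L (p - 7 * w) p) := by
        have := agree_one hXB (seg_disjoint (L := L) (l₁ := p - 7 * w) (h₁ := p)
          (by omega) (by omega)).symm
        simpa using Agree.mul (T₁ := XA) (T₁' := XA) (fun v _ => rfl) this
          (by intro v hv; simpa using hv)
      have e3 : Agree (ΩL * XA) XA (seg L (p - 7 * w) p) := by
        have := agree_one hΩL (seg_disjoint (L := L) (l₂ := p - 7 * w) (h₂ := p)
          (by omega) (by omega))
        simpa using Agree.mul (T₂ := XA) (T₂' := XA) this (fun v _ => rfl)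
          (maps_of_mem hXA (seg_mono (by omega) le_rfl) subset_rfl)
      have e4 : Agree (ΩL * XA * H₃) (XA * S₃) (seg L (p - 6 * w) p) :=
        e3.mul (t₃.mono hsub) mS₃
      have e5 : Agree (S₁ * S₂) (XA * S₃) (seg L (p - 6 * w) p) := by
        rw [hS]
        exact e2.mul (fun v _ => rfl) mS₃
      exact e4.trans (e1.trans e5).symm
    have c4 : Agree (ΩL * XA * H₃) (H₁ * H₂) (seg L p (a + L)) := by
      have hd : Disjoint (seg L a p) (seg L p (a + L)) := seg_disjoint le_rfl le_rfl
      exact (agree_one (mul_mem (mul_mem (loc_mono (seg_mono le_rfl (by omega)) hΩL)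
        (loc_mono (seg_mono (by omega) le_rfl) hXA)) hH₃) hd).trans
        (agree_one (mul_mem hH₁ hH₂) hd).symm
    have hk : ∀ {l h : ℤ}, l ≤ k → k < h → {(k : ZMod L)} ⊆ seg L l h := fun h1 h2 => by
      simpa using intCast_mem_seg h1 h2
    rcases lt_or_ge k (a + 8 * s) with h | h
    · exact c1.mono (hk hk1 h)
    rcases lt_or_ge k (p - 6 * w) with h' | h'
    · exact c2.mono (hk h h')
    rcases lt_or_ge k p with h'' | h''
    · exact c3.mono (hk h' h'')
    · exact c4.mono (hk h'' hk2)
  simpa using hmem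

end Glue

/-! ### Associativity of the glued operators trivializes the cocycle. -/

section Cocycle

variable {L : ℕ} {κ : ZMod L → Type*} [NeZero L] [∀ i, Fintype (κ i)] [∀ i, DecidableEq (κ i)]

theorem coe_mul_mulVec (u v : UnitaryOp κ) (ψ : Config κ → ℂ) :
    ((u * v : UnitaryOp κ) : Op κ) *ᵥ ψ = (u : Op κ) *ᵥ ((v : Op κ) *ᵥ ψ) := by
  rw [Submonoid.coe_mul, Matrix.mulVec_mulVec]

theorem norm_eigenvalue {u : UnitaryOp κ} {ψ : Config κ → ℂ} (hn : IsNormalized ψ) {z : ℂ}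
    (h : (u : Op κ) *ᵥ ψ = z • ψ) : ‖z‖ = 1 := by
  have h1 : IsNormalized (z • ψ) := h ▸ hn.mulVec u
  have h2 : z * star z = 1 := by
    simp only [IsNormalized, Pi.smul_apply, smul_eq_mul, star_mul'] at h1 hn
    rw [← h1, ← mul_one (z * star z), ← hn, Finset.mul_sum]
    exact Finset.sum_congr rfl fun a _ => by ring
  have h3 : ((‖z‖ ^ 2 : ℝ) : ℂ) = 1 := by
    rw [← h2, Complex.ofReal_pow]
    exact (RCLike.mul_conj z).symm
  have h4 : ‖z‖ ^ 2 = 1 := by exact_mod_cast h3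
  exact (pow_eq_one_iff_of_nonneg (norm_nonneg _) two_ne_zero).1 h4

theorem inv_mulVec_eigen {u : UnitaryOp κ} {ψ : Config κ → ℂ} {z : ℂ} (hz : z ≠ 0)
    (h : (u : Op κ) *ᵥ ψ = z • ψ) : ((u⁻¹ : UnitaryOp κ) : Op κ) *ᵥ ψ = z⁻¹ • ψ := by
  have : ((u⁻¹ * u : UnitaryOp κ) : Op κ) *ᵥ ψ = z • (((u⁻¹ : UnitaryOp κ) : Op κ) *ᵥ ψ) := by
    rw [coe_mul_mulVec, h, Matrix.mulVec_smul]
  rw [inv_mul_cancel, Submonoid.coe_one, Matrix.one_mulVec] at this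
  rw [eq_inv_smul_iff₀ hz, ← this]

theorem central_of_mem_loc_empty {θ : UnitaryOp κ} (h : θ ∈ loc κ (∅ : Finset (ZMod L)))
    (u : UnitaryOp κ) : θ * u = u * θ :=
  loc_comm (Finset.disjoint_empty_left _) h (loc_univ u)

/-- If the endpoint operators `X` at the other end of a partial symmetry `H` fix a vector up to a
factor, then the cocycle of the endpoint operators `Ω` is a coboundary. -/
theorem exists_cochain_of_glue {G : Type*} [Group G] {I J : Finset (ZMod L)} (hIJ : Disjoint I J)
    {H S M : G → UnitaryOp κ} {Ω X : G → G → UnitaryOp κ}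
    (hH : ∀ g h, ∃ θ ∈ loc κ (∅ : Finset (ZMod L)), H g * H h = Ω g h * X g h * H (g * h) * θ)
    (hΩ : ∀ g h, Ω g h ∈ loc κ I) (hX : ∀ g h, X g h ∈ loc κ J)
    (hΩ' : ∀ g h k, H g * Ω h k * (H g)⁻¹ = M g * Ω h k * (M g)⁻¹)
    (hX' : ∀ g h k, H g * X h k * (H g)⁻¹ = S g * X h k * (S g)⁻¹)
    {J' : Finset (ZMod L)} (hIJ' : Disjoint I J') (hXJ : ∀ g h k, S g * X h k * (S g)⁻¹ ∈ loc κ J')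
    {ψ : Config κ → ℂ} (hn : IsNormalized ψ) (hS : ∀ g, ∃ z : ℂ, (S g : Op κ) *ᵥ ψ = z • ψ)
    (hXψ : ∀ g h, ∃ z : ℂ, (X g h : Op κ) *ᵥ ψ = z • ψ) {ω : G → G → G → ℂ}
    (hω : ∀ g h k, ω g h k • ((Ω g h * Ω (g * h) k : UnitaryOp κ) : Op κ) =
      ((M g * Ω h k * (M g)⁻¹ * Ω g (h * k) : UnitaryOp κ) : Op κ)) :
    ∃ ν : G → G → Circle, ∀ g h k, ω g h k * (ν h k * ν g (h * k)) = ν g h * ν (g * h) k := by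
  choose θ hθ hHθ using hH
  choose lam hlam using hS
  have hXθ : ∀ g h, ∃ z : ℂ, ((X g h * θ g h : UnitaryOp κ) : Op κ) *ᵥ ψ = z • ψ := by
    intro g h
    obtain ⟨z, hz⟩ := exists_smul_one_of_supportedOn_empty (mem_loc_iff.1 (hθ g h))
    obtain ⟨μ, hμ⟩ := hXψ g h
    refine ⟨z * μ, ?_⟩
    rw [coe_mul_mulVec, hz, Matrix.smul_mulVec, Matrix.one_mulVec, Matrix.mulVec_smul, hμ,
      smul_smul]
  choose ν hν using hXθ
  have hνn : ∀ g h, ‖ν g h‖ = 1 := fun g h => norm_eigenvalue hn (hν g h)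
  refine ⟨fun g h => ⟨ν g h, by simp [Submonoid.unitSphere, hνn]⟩, fun g h k => ?_⟩
  show ω g h k * (ν h k * ν g (h * k)) = ν g h * ν (g * h) k
  have cen := fun g h u => central_of_mem_loc_empty (hθ g h) u
  -- Expand `H g * H h * H k` in both bracketings and cancel `H (g * h * k)`. The `Ω` and `X` parts
  -- separate since they live on disjoint regions.
  have key : Ω g h * Ω (g * h) k * ((X g h * θ g h) * (X (g * h) k * θ (g * h) k)) =
      M g * Ω h k * (M g)⁻¹ * Ω g (h * k) *
        ((S g * (X h k * θ h k) * (S g)⁻¹) * (X g (h * k) * θ g (h * k))) := by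
    apply mul_right_cancel (b := H (g * h * k))
    have cXΩ : X g h * Ω (g * h) k = Ω (g * h) k * X g h :=
      (loc_comm hIJ (hΩ _ _) (hX _ _)).symm
    have cXΩ' : S g * X h k * (S g)⁻¹ * Ω g (h * k) = Ω g (h * k) * (S g * X h k * (S g)⁻¹) :=
      (loc_comm hIJ' (hΩ _ _) (hXJ _ _ _)).symm
    have a1 : H g * H h * H k = Ω g h * Ω (g * h) k * (X g h * X (g * h) k) * H (g * h * k) *
        (θ g h * θ (g * h) k) := by
      calc H g * H h * H k = Ω g h * X g h * H (g * h) * (θ g h * H k) := by rw [hHθ]; group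
        _ = Ω g h * X g h * (H (g * h) * H k) * θ g h := by rw [cen]; group
        _ = Ω g h * (X g h * Ω (g * h) k) * X (g * h) k * H (g * h * k) *
            (θ (g * h) k * θ g h) := by rw [hHθ]; group
        _ = _ := by rw [cXΩ, ← cen g h]; group
    have a2 : H g * H h * H k = M g * Ω h k * (M g)⁻¹ * Ω g (h * k) *
        (S g * X h k * (S g)⁻¹ * X g (h * k)) * H (g * h * k) *
        (θ h k * θ g (h * k)) := by
      calc H g * H h * H k = H g * (H h * H k) := by group
        _ = (H g * Ω h k * (H g)⁻¹) * (H g * X h k * (H g)⁻¹) * (H g * H (h * k)) * θ h k := by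
            rw [hHθ h k]; group
        _ = M g * Ω h k * (M g)⁻¹ * (S g * X h k * (S g)⁻¹ * Ω g (h * k)) * X g (h * k) *
            H (g * (h * k)) * (θ g (h * k) * θ h k) := by rw [hΩ', hX', hHθ g (h * k)]; group
        _ = _ := by rw [cXΩ', ← cen h k, mul_assoc g h k]; group
    have swap : ∀ {θ₁ θ₂ P A B C : UnitaryOp κ}, (∀ u, θ₁ * u = u * θ₁) → (∀ u, θ₂ * u = u * θ₂) →
        P * ((A * θ₁) * (B * θ₂)) * C = P * (A * B) * C * (θ₁ * θ₂) := by
      intro θ₁ θ₂ P A B C c₁ c₂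
      calc _ = P * A * (θ₁ * (B * (θ₂ * C))) := by group
        _ = _ := by rw [c₁, c₂, ← mul_assoc, ← c₂ θ₁]; group
    have b1 : S g * (X h k * θ h k) * (S g)⁻¹ = S g * X h k * (S g)⁻¹ * θ h k := by
      calc _ = S g * X h k * (θ h k * (S g)⁻¹) := by group
        _ = _ := by rw [cen]; group
    rw [b1, swap (cen g h) (cen (g * h) k), swap (cen h k) (cen g (h * k)), ← a1, ← a2]
  have hl : ∀ g, lam g ≠ 0 := fun g => by
    have := norm_eigenvalue hn (hlam g)
    exact norm_ne_zero_iff.1 (by rw [this]; exact one_ne_zero)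
  have e1 : (((X g h * θ g h) * (X (g * h) k * θ (g * h) k) : UnitaryOp κ) : Op κ) *ᵥ ψ =
      (ν g h * ν (g * h) k) • ψ := by
    rw [coe_mul_mulVec, hν, Matrix.mulVec_smul, hν, smul_smul, mul_comm]
  have e2 : (((S g * (X h k * θ h k) * (S g)⁻¹) * (X g (h * k) * θ g (h * k)) : UnitaryOp κ) :
      Op κ) *ᵥ ψ = (ν h k * ν g (h * k)) • ψ := by
    rw [coe_mul_mulVec, hν, Matrix.mulVec_smul, coe_mul_mulVec, inv_mulVec_eigen (hl g) (hlam g),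
      Matrix.mulVec_smul, coe_mul_mulVec, hν, Matrix.mulVec_smul, hlam, smul_smul, smul_smul,
      smul_smul]
    congr 1
    have := hl g
    field_simp
  -- Evaluate `key` on `ψ`. The eigenvalues of `S g` cancel in the conjugation, the `X θ` terms
  -- become `ν`, and `hω` reduces the `Ω` terms to `ω`.
  have h1 := congrArg (fun u : UnitaryOp κ =>
    (((Ω g h * Ω (g * h) k)⁻¹ * u : UnitaryOp κ) : Op κ) *ᵥ ψ) key
  simp only [inv_mul_cancel_left] at h1
  rw [e1, coe_mul_mulVec, coe_mul_mulVec, e2, ← hω, Matrix.mulVec_smul, Matrix.smul_mulVec,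
    Matrix.mulVec_smul, Matrix.mulVec_smul, ← coe_mul_mulVec, inv_mul_cancel, Submonoid.coe_one,
    Matrix.one_mulVec, smul_smul] at h1
  obtain ⟨b, hb⟩ := hn.exists_ne_zero
  have h2 := congrFun h1 b
  simp only [Pi.smul_apply, smul_eq_mul] at h2
  rw [mul_right_cancel₀ hb h2]
  ring

end Cocycle

/-! ### Coordinates around the three cuts. -/

section Geometry

variable {L : ℕ}

theorem intCast_mem_seg_iff {m l h k : ℤ} (hl : m ≤ l) (hh : h ≤ m + L) (h₁ : m ≤ k)
    (h₂ : k < m + L) : (k : ZMod L) ∈ seg L l h ↔ l ≤ k ∧ k < h := by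
  refine ⟨fun hk => ?_, fun hk => intCast_mem_seg hk.1 hk.2⟩
  obtain ⟨k', h1, h2, h3⟩ := mem_seg.1 hk
  obtain rfl := eq_of_intCast_eq h3 (by omega) (by omega)
  exact ⟨h1, h2⟩

/-- The position of the coordinate `k` relative to the three cuts and their neighbourhoods. -/
def cutLabel (q : Fin 3 → ℤ) (w k : ℤ) : Fin 6 :=
  if k < q 0 then 1 else if k < q 0 + w then 2 else if k < q 1 then 3 else
    if k < q 1 + w then 4 else if k < q 2 then 5 else 0

/-- Six cells in cyclic order, two per piece, with each window inside the two cells adjacent to its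
cut. This is the input of `isProd_of_three_cuts`, where set identities become decidable in `Fin 6`.
-/
theorem exists_cutLabel [NeZero L] {q : Fin 3 → ℤ} {w : ℕ} (hq : Spaced L q (2 * w)) :
    ∃ ℓ : ZMod L → Fin 6,
      (window L q w 0 ⊆ Finset.univ.filter fun i => ℓ i ∈ ({1, 2} : Finset (Fin 6))) ∧
      (window L q w 1 ⊆ Finset.univ.filter fun i => ℓ i ∈ ({3, 4} : Finset (Fin 6))) ∧
      (window L q w 2 ⊆ Finset.univ.filter fun i => ℓ i ∈ ({5, 0} : Finset (Fin 6))) ∧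
      (Finset.univ.filter fun i => ℓ i ∈ ({0, 1} : Finset (Fin 6))) = pieces L q 2 ∧
      (Finset.univ.filter fun i => ℓ i ∈ ({2, 3} : Finset (Fin 6))) = pieces L q 0 ∧
      (Finset.univ.filter fun i => ℓ i ∈ ({4, 5} : Finset (Fin 6))) = pieces L q 1 := by
  obtain ⟨h1, h2, h3⟩ := hq
  choose k hk1 hk2 hk3 using exists_coord (L := L) (q 0 - w)
  refine ⟨fun i => cutLabel q w (k i), ?_, ?_, ?_, ?_, ?_, ?_⟩
  · intro i hi
    rw [← hk3 i, window, intCast_mem_seg_iff (m := q 0 - w) (by omega) (by omega) (hk1 i) (hk2 i)] at hi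
    have := hk1 i
    rw [Finset.mem_filter]
    simp only [Finset.mem_univ, true_and, cutLabel]
    split_ifs <;> first | decide | omega
  · intro i hi
    rw [← hk3 i, window, intCast_mem_seg_iff (m := q 0 - w) (by omega) (by omega) (hk1 i) (hk2 i)] at hi
    rw [Finset.mem_filter]
    simp only [Finset.mem_univ, true_and, cutLabel]
    split_ifs <;> first | decide | omega
  · intro i hi
    rw [← hk3 i, window, intCast_mem_seg_iff (m := q 0 - w) (by omega) (by omega) (hk1 i) (hk2 i)] at hi
    rw [Finset.mem_filter]
    simp only [Finset.mem_univ, true_and, cutLabel]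
    split_ifs <;> first | decide | omega
  · ext i
    have e : pieces L q 2 = seg L (q 2) (q 0 - w + L) ∪ seg L (q 0 - w) (q 0) := by
      rw [← seg_period (q 0 - w) (q 0), ← seg_union (by omega) (by omega)]
      rfl
    rw [e, Finset.mem_union, ← hk3 i]
    rw [intCast_mem_seg_iff (m := q 0 - w) (by omega) (by omega) (hk1 i) (hk2 i),
      intCast_mem_seg_iff (m := q 0 - w) (by omega) (by omega) (hk1 i) (hk2 i), hk3 i]
    have := hk1 i
    have := hk2 i
    rw [Finset.mem_filter]
    simp only [Finset.mem_univ, true_and, cutLabel]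
    split_ifs <;> simp <;> omega
  · ext i
    have e : pieces L q 0 = seg L (q 0) (q 1) := rfl
    rw [e, ← hk3 i]
    rw [intCast_mem_seg_iff (m := q 0 - w) (by omega) (by omega) (hk1 i) (hk2 i), hk3 i]
    have := hk1 i
    have := hk2 i
    rw [Finset.mem_filter]
    simp only [Finset.mem_univ, true_and, cutLabel]
    split_ifs <;> simp <;> omega
  · ext i
    have e : pieces L q 1 = seg L (q 1) (q 2) := rfl
    rw [e, ← hk3 i]
    rw [intCast_mem_seg_iff (m := q 0 - w) (by omega) (by omega) (hk1 i) (hk2 i), hk3 i]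
    have := hk1 i
    have := hk2 i
    rw [Finset.mem_filter]
    simp only [Finset.mem_univ, true_and, cutLabel]
    split_ifs <;> simp <;> omega

theorem pieces_two (q : Fin 3 → ℤ) : pieces L q 2 = seg L (q 2 - L) (q 0) := by
  rw [← seg_period, sub_add_cancel]; rfl

theorem window_two (q : Fin 3 → ℤ) (s : ℕ) :
    window L q s 2 = seg L (q 2 - L - s) (q 2 - L + s) := by
  rw [← seg_period]
  simp only [window]
  congr 1 <;> ring

end Geometry

/-! ### Making a symmetry operator local at one cut. -/

section LocalSymmetry

variable {L : ℕ} {κ : ZMod L → Type*} [NeZero L] [∀ i, Fintype (κ i)] [∀ i, DecidableEq (κ i)]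

/-- Each factor acts either within the piece `j` or off it, so the purity of that piece stays equal
to one. -/
theorem IsProd.prod3_mulVec {q : Fin 3 → ℤ} (hq : Spaced L q 0) {V : Fin 3 → UnitaryOp κ}
    (hV : ∀ j, V j ∈ loc κ (pieces L q j)) {ψ : Config κ → ℂ} (hn : IsNormalized ψ) {j : Fin 3}
    (hψ : IsProd (pieces L q j) ψ) :
    IsProd (pieces L q j) (((prod3 V : UnitaryOp κ) : Op κ) *ᵥ ψ) := by
  have key : ∀ i, ∀ φ : Config κ → ℂ,
      purity (pieces L q j) ((V i : Op κ) *ᵥ φ) = purity (pieces L q j) φ := by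
    intro i φ
    by_cases hij : i = j
    · subst hij
      exact purity_mulVec (hV i) φ
    · refine purity_mulVec_compl (loc_mono ?_ (hV i)) φ
      exact Finset.subset_compl_iff_disjoint_right.2 (hq.pieces_disjoint i j hij)
  refine isProd_of_purity_eq_one (hn.mulVec _) ?_
  rw [prod3, coe_mul_mulVec, coe_mul_mulVec, key, key, key, hψ.purity_eq_one hn]

theorem maps_prod3_pieces {q : Fin 3 → ℤ} (hq : Spaced L q 0) {V : Fin 3 → UnitaryOp κ}
    (hV : ∀ j, V j ∈ loc κ (pieces L q j)) :
    Maps (prod3 V) (pieces L q 2) (pieces L q 2) ∧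
      Maps (prod3 V)⁻¹ (pieces L q 2) (pieces L q 2) := by
  have m0 := maps_of_disjoint (hV 0) (hq.pieces_disjoint 0 2 (by decide))
  have m1 := maps_of_disjoint (hV 1) (hq.pieces_disjoint 1 2 (by decide))
  have m2 := maps_of_mem (hV 2) subset_rfl (subset_refl (pieces L q 2))
  have m0' := maps_of_disjoint (inv_mem (hV 0)) (hq.pieces_disjoint 0 2 (by decide))
  have m1' := maps_of_disjoint (inv_mem (hV 1)) (hq.pieces_disjoint 1 2 (by decide))
  have m2' := maps_of_mem (inv_mem (hV 2)) subset_rfl (subset_refl (pieces L q 2))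
  refine ⟨(m0.comp m1).comp m2, ?_⟩
  rw [prod3, _root_.mul_inv_rev, _root_.mul_inv_rev]
  exact m2'.comp (m1'.comp m0')

/-- A symmetry operator that fixes the state `y ψ₀` up to a phase can be modified near the cut
`q 0` so that it does not cross the cut and still fixes a vector up to a phase. -/
theorem exists_local_symmetry {q : Fin 3 → ℤ} {s t w : ℕ} (hw : w = s + t)
    (hq : Spaced L q (20 * w)) {y' : Fin 3 → UnitaryOp κ}
    (hy' : ∀ j, y' j ∈ loc κ (window L q t j)) {U : UnitaryOp κ} {u V : Fin 3 → UnitaryOp κ}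
    (hU : IsCut Finset.univ q s U u V) {ψ : Config κ → ℂ} (hn : IsNormalized ψ)
    (hψ : ∀ j, IsProd (pieces L q j) ψ)
    (hz : ∃ z : ℂ, ((U * prod3 y' : UnitaryOp κ) : Op κ) *ᵥ ψ =
      z • (((prod3 y' : UnitaryOp κ) : Op κ) *ᵥ ψ)) :
    ∃ S : UnitaryOp κ, S⁻¹ * U ∈ loc κ (seg L (q 0 - 2 * w) (q 0 + 2 * w)) ∧
      (∃ z : ℂ, (S : Op κ) *ᵥ (((y' 1 * y' 2 : UnitaryOp κ) : Op κ) *ᵥ ψ) =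
        z • (((y' 1 * y' 2 : UnitaryOp κ) : Op κ) *ᵥ ψ)) ∧
      (∀ l : ℤ, q 0 + 2 * w - L ≤ l → l ≤ q 0 - 2 * w →
        Maps S (seg L l (q 0)) (seg L (l - s) (q 0))) ∧
      Maps S⁻¹ (seg L (q 0 - 4 * w) (q 0)) (seg L (q 0 - 5 * w) (q 0)) := by
  obtain ⟨z, hz⟩ := hz
  have hs1 := hq.left
  have hs2 := hq.mid
  have hs3 := hq.right
  have hwin : PairwiseDisjoint3 (window L q w) := (hq.mono (by omega)).window_disjoint
  have hq0 : Spaced L q 0 := hq.mono (by omega)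
  have hsw : ∀ j, window L q s j ⊆ window L q w j := fun j => seg_mono (by omega) (by omega)
  have htw : ∀ j, window L q t j ⊆ window L q w j := fun j => seg_mono (by omega) (by omega)
  have hy'w := fun j => loc_mono (htw j) (hy' j)
  have huw := fun j => loc_mono (hsw j) (hU.x_mem j)
  set W := prod3 V with hW
  have hcy : ∀ j, W * y' j * W⁻¹ ∈ loc κ (window L q w j) := fun j =>
    loc_mono (seg_mono (by omega) (by omega)) (hU.spreads.maps _ _ _ (hy' j))
  -- Chosen so that `y'⁻¹ U y' = x₀ x₁ x₂ W` (`hprod`). Since `W` spreads by `s` and `y'` has radius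
  -- `t`, each `x j` has radius `w = s + t`.
  set x : Fin 3 → UnitaryOp κ := fun j => (y' j)⁻¹ * (u j * (W * y' j * W⁻¹)) with hx
  have hxw : ∀ j, x j ∈ loc κ (window L q w j) := fun j =>
    mul_mem (inv_mem (hy'w j)) (mul_mem (huw j) (hcy j))
  have hprod : prod3 y' * (prod3 x * W) = U * prod3 y' := by
    have e1 : prod3 u * prod3 (fun j => W * y' j * W⁻¹) = prod3 fun j => u j * (W * y' j * W⁻¹) :=
      prod3_mul hwin huw hcy
    have e2 : prod3 y' * prod3 x = prod3 fun j => u j * (W * y' j * W⁻¹) := by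
      rw [prod3_mul hwin hy'w hxw]
      simp only [hx, mul_inv_cancel_left]
    calc prod3 y' * (prod3 x * W) = prod3 y' * prod3 x * W := by group
      _ = prod3 u * (W * prod3 y' * W⁻¹) * W := by rw [e2, ← e1, prod3_conj]
      _ = U * prod3 y' := by rw [hU.eq, ← hW]; group
  have hxψ : ((prod3 x : UnitaryOp κ) : Op κ) *ᵥ ((W : Op κ) *ᵥ ψ) = z • ψ := by
    have e : prod3 x * W = (prod3 y')⁻¹ * (U * prod3 y') := by rw [← hprod]; group
    rw [← coe_mul_mulVec, e, coe_mul_mulVec, hz, Matrix.mulVec_smul, ← coe_mul_mulVec,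
      inv_mul_cancel, Submonoid.coe_one, Matrix.one_mulVec]
  obtain ⟨ℓ, l1, l2, l3, l4, l5, l6⟩ := exists_cutLabel (hq.mono (by omega) : Spaced L q (2 * w))
  have hpx : IsProd (pieces L q 2) ((((x 0)⁻¹ : UnitaryOp κ) : Op κ) *ᵥ ψ) := by
    rw [← l4]
    have hT : ∀ φ : Config κ → ℂ, (∀ j, IsProd (pieces L q j) φ) →
        ∀ T ∈ ({{0, 1}, {2, 3}, {4, 5}} : Finset (Finset (Fin 6))),
          IsProd (Finset.univ.filter fun i => ℓ i ∈ T) φ := by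
      intro φ hφ T hT
      simp only [Finset.mem_insert, Finset.mem_singleton] at hT
      rcases hT with rfl | rfl | rfl
      · rw [l4]; exact hφ 2
      · rw [l5]; exact hφ 0
      · rw [l6]; exact hφ 1
    exact isProd_of_three_cuts ℓ (loc_mono l1 (hxw 0)) (loc_mono l2 (hxw 1)) (loc_mono l3 (hxw 2))
      hn (hn.mulVec W) (hT ψ hψ) (hT _ fun j => (hψ j).prod3_mulVec hq0 hU.V_mem hn) hxψ
  have hp2 := pieces_two (L := L) q
  obtain ⟨v, hv, v', hv', k, hk⟩ := exists_local_unitaries (A := pieces L q 2)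
    (X := seg L (q 0 - w) (q 0)) (Y := seg L (q 0) (q 0 + w)) (x := (x 0)⁻¹)
    (by rw [hp2]; exact seg_mono (by omega) le_rfl)
    (by rw [hp2]; exact (seg_disjoint (by omega) (by omega)).symm)
    (by rw [← seg_union (by omega) (by omega)]; exact inv_mem (hxw 0)) hn.exists_ne_zero (hψ 2) hpx
  have hvw : v * v' ∈ loc κ (window L q w 0) :=
    mul_mem (loc_mono (seg_mono (by omega) (by omega)) hv)
      (loc_mono (seg_mono (by omega) (by omega)) hv')
  -- In `U = u₀ u₁ u₂ W`, the factor `u₀` is replaced by `(v v')⁻¹`, which acts separately on the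
  -- two sides of `q 0`.
  set S := (v * v')⁻¹ * (u 1 * u 2) * W with hS
  have hSE : S⁻¹ * U = W⁻¹ * (v * v' * u 0) * W⁻¹⁻¹ := by
    have c : v * v' * u 0 * (u 1 * u 2) = u 1 * u 2 * (v * v' * u 0) := by
      have c1 := loc_comm (hwin 0 1 (by decide)) (mul_mem hvw (huw 0)) (huw 1)
      have c2 := loc_comm (hwin 0 2 (by decide)) (mul_mem hvw (huw 0)) (huw 2)
      rw [← mul_assoc, c1, mul_assoc (u 1), c2, mul_assoc (u 1) (u 2)]
    calc S⁻¹ * U = W⁻¹ * ((u 1 * u 2)⁻¹ * (v * v' * u 0 * (u 1 * u 2))) * W := by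
          rw [hS, hU.eq, ← hW]; simp only [prod3]; group
      _ = _ := by rw [c]; group
  have hSU : S⁻¹ * U ∈ loc κ (seg L (q 0 - 2 * w) (q 0 + 2 * w)) := by
    rw [hSE]
    exact loc_mono (seg_mono (by omega) (by omega))
      (hU.spreads.inv.maps _ _ _ (mul_mem hvw (huw 0)))
  have mW : ∀ l : ℤ, q 0 - 4 * w ≤ l → l ≤ q 0 - 2 * w →
      Maps W (seg L l (q 0)) (seg L (l - s) (q 0)) := by
    intro l hl1 hl2
    have h1 := (maps_prod3_pieces hq0 hU.V_mem).1.mono (I' := seg L l (q 0))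
      (by rw [hp2]; exact seg_mono (by omega) le_rfl) subset_rfl
    rw [hp2] at h1
    exact (hU.spreads.maps _ _).inter h1
      (seg_inter_subset (by omega) (by omega) (by omega) (by omega))
  have mW' : Maps W⁻¹ (seg L (q 0 - 4 * w) (q 0)) (seg L (q 0 - 5 * w) (q 0)) := by
    have h1 := (maps_prod3_pieces hq0 hU.V_mem).2.mono (I' := seg L (q 0 - 4 * w) (q 0))
      (by rw [hp2]; exact seg_mono (by omega) le_rfl) subset_rfl
    rw [hp2] at h1
    exact (hU.spreads.inv.maps _ _).inter h1
      (seg_inter_subset (by omega) (by omega) (by omega) (by omega))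
  have du1 : Disjoint (window L q w 1) (seg L (q 0 - 5 * w) (q 0)) :=
    (seg_disjoint (by omega) (by omega)).symm
  have du2 : Disjoint (window L q w 2) (seg L (q 0 - 5 * w) (q 0)) := by
    rw [window_two]
    exact seg_disjoint (by omega) (by omega)
  have mS : ∀ l : ℤ, q 0 - 4 * w ≤ l → l ≤ q 0 - 2 * w →
      Maps S (seg L l (q 0)) (seg L (l - s) (q 0)) := by
    intro l hl1 hl2
    have hsub : seg L (l - s) (q 0) ⊆ seg L (q 0 - 5 * w) (q 0) := seg_mono (by omega) le_rfl
    have m1 := maps_of_disjoint (huw 1) (du1.mono_right hsub)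
    have m2 := maps_of_disjoint (huw 2) (du2.mono_right hsub)
    have m3 : Maps v'⁻¹ (seg L (l - s) (q 0)) (seg L (l - s) (q 0)) :=
      maps_of_disjoint (inv_mem hv') (seg_disjoint (by omega) (by omega)).symm
    have m4 : Maps v⁻¹ (seg L (l - s) (q 0)) (seg L (l - s) (q 0)) :=
      maps_of_mem (inv_mem hv) (seg_mono (by omega) le_rfl) subset_rfl
    rw [hS, _root_.mul_inv_rev]
    exact ((m3.comp m4).comp (m1.comp m2)).comp (mW l hl1 hl2)
  refine ⟨S, hSU, ?_, ?_, ?_⟩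
  · have hk0 : k ≠ 0 := by
      rintro rfl
      obtain ⟨b, hb⟩ := (hn.mulVec (v * v')).exists_ne_zero
      rw [hk, zero_smul] at hb
      exact hb rfl
    have e1 : (((x 0 * (v * v')) : UnitaryOp κ) : Op κ) *ᵥ ψ = k • ψ := by
      rw [coe_mul_mulVec, hk, Matrix.mulVec_smul, ← coe_mul_mulVec, mul_inv_cancel,
        Submonoid.coe_one, Matrix.one_mulVec]
    have e2 := inv_mulVec_eigen hk0 e1
    -- Both factors to the right of `y' 1 * y' 2` have `ψ` as an eigenvector: the last by the
    -- hypothesis on `U`, the other because `v v' ψ` is a multiple of `x₀⁻¹ ψ`.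
    have e3 : S * (y' 1 * y' 2) = (y' 1 * y' 2) * (x 0 * (v * v'))⁻¹ * ((prod3 y')⁻¹ *
        (U * prod3 y')) := by
      have c12 : (y' 1 * y' 2) * (x 0 * (v * v'))⁻¹ = (x 0 * (v * v'))⁻¹ * (y' 1 * y' 2) := by
        have hm := inv_mem (mul_mem (hxw 0) hvw)
        have c1 := loc_comm (hwin 0 1 (by decide)) hm (hy'w 1)
        have c2 := loc_comm (hwin 0 2 (by decide)) hm (hy'w 2)
        rw [← mul_assoc _ (y' 1), c1, mul_assoc (y' 1) _ (y' 2), c2, mul_assoc (y' 1) (y' 2)]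
      have cu : (u 1 * u 2) * (W * y' 0 * W⁻¹) = W * y' 0 * W⁻¹ * (u 1 * u 2) := by
        have c1 := loc_comm (hwin 0 1 (by decide)) (hcy 0) (huw 1)
        have c2 := loc_comm (hwin 0 2 (by decide)) (hcy 0) (huw 2)
        rw [← mul_assoc (W * y' 0 * W⁻¹) (u 1), c1, mul_assoc, ← c2, ← mul_assoc]
      rw [c12, hS, hU.eq, ← hW]
      simp only [hx]
      calc _ = (v * v')⁻¹ * (W * y' 0 * W⁻¹)⁻¹ * (W * y' 0 * W⁻¹ * (u 1 * u 2)) * W *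
            (y' 1 * y' 2) := by group
        _ = _ := by rw [← cu]; simp only [prod3]; group
    have e4 : (((prod3 y')⁻¹ * (U * prod3 y') : UnitaryOp κ) : Op κ) *ᵥ ψ = z • ψ := by
      rw [coe_mul_mulVec, hz, Matrix.mulVec_smul, ← coe_mul_mulVec, inv_mul_cancel,
        Submonoid.coe_one, Matrix.one_mulVec]
    refine ⟨z * k⁻¹, ?_⟩
    rw [← coe_mul_mulVec, e3, coe_mul_mulVec, e4, Matrix.mulVec_smul, coe_mul_mulVec, e2,
      Matrix.mulVec_smul, smul_smul]
  · intro l h1 h2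
    refine maps_of_sites fun i hi => ?_
    obtain ⟨j, hj1, hj2, rfl⟩ := mem_seg.1 hi
    -- At these sites, away from the cut, `S` acts as `U`; `mS` is needed only for sites close to
    -- it.
    rcases lt_or_ge j (q 0 - 2 * w) with hj | hj
    · have hag : Agree S U (seg L l (q 0 - 2 * w)) :=
        agree_of_inv_mul_mem hSU (seg_disjoint (by omega) (by omega)).symm
      exact (hag.maps (hU.spreads'.maps _ _)).mono (by simpa using intCast_mem_seg hj1 hj)
        (seg_mono le_rfl (by omega))
    · rcases le_total l (q 0 - 4 * w) with hl | hl
      · exact (mS (q 0 - 2 * w) (by omega) le_rfl).mono (by simpa using intCast_mem_seg hj hj2)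
          (seg_mono (by omega) le_rfl)
      · exact (mS l hl h2).mono (by simpa using intCast_mem_seg hj1 hj2) subset_rfl
  · have m1 := maps_of_disjoint (inv_mem (huw 1))
      (du1.mono_right (seg_mono (l' := q 0 - 5 * w) (l := q 0 - 4 * w) (by omega) le_rfl))
    have m2 := maps_of_disjoint (inv_mem (huw 2))
      (du2.mono_right (seg_mono (l' := q 0 - 5 * w) (l := q 0 - 4 * w) (by omega) le_rfl))
    have m3 : Maps v' (seg L (q 0 - 4 * w) (q 0)) (seg L (q 0 - 4 * w) (q 0)) :=
      maps_of_disjoint hv' (seg_disjoint (by omega) (by omega)).symm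
    have m4 : Maps v (seg L (q 0 - 4 * w) (q 0)) (seg L (q 0 - 4 * w) (q 0)) :=
      maps_of_mem hv (seg_mono (by omega) le_rfl) subset_rfl
    have e : S⁻¹ = W⁻¹ * ((u 2)⁻¹ * (u 1)⁻¹ * (v * v')) := by rw [hS]; group
    rw [e]
    exact mW'.comp ((m2.comp m1).comp (m4.comp m3))

end LocalSymmetry

/-! ### From a fixed product vector to a trivial cocycle. -/

section Core

variable {L : ℕ} {κ : ZMod L → Type*} [NeZero L] [∀ i, Fintype (κ i)] [∀ i, DecidableEq (κ i)]

/-- The modified symmetry operators multiply as the original ones, up to operators near the two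
sides of the cut at `p`. -/
theorem exists_local_mul {p : ℤ} {s w : ℕ} (hsw : s ≤ w) (hL : 20 * (w : ℤ) ≤ L)
    {U₁ U₂ S₁ S₂ S₃ : UnitaryOp κ} (hU₁₂ : Spreads s (U₁ * U₂)) (hU₂ : Spreads s U₂)
    (e₁ : S₁⁻¹ * U₁ ∈ loc κ (seg L (p - 2 * w) (p + 2 * w)))
    (e₂ : S₂⁻¹ * U₂ ∈ loc κ (seg L (p - 2 * w) (p + 2 * w)))
    (e₃ : S₃⁻¹ * (U₁ * U₂) ∈ loc κ (seg L (p - 2 * w) (p + 2 * w)))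
    (m₁ : ∀ l : ℤ, p + 2 * w - L ≤ l → l ≤ p - 2 * w → Maps S₁ (seg L l p) (seg L (l - s) p))
    (m₂ : ∀ l : ℤ, p + 2 * w - L ≤ l → l ≤ p - 2 * w → Maps S₂ (seg L l p) (seg L (l - s) p))
    (m₃ : Maps S₃⁻¹ (seg L (p - 4 * w) p) (seg L (p - 5 * w) p)) :
    ∃ XA ∈ loc κ (seg L (p - 4 * w) p), ∃ XB ∈ loc κ (seg L p (p + 4 * w)),
      S₁ * S₂ = XA * XB * S₃ := by
  set X := S₁ * S₂ * S₃⁻¹ with hX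
  -- `X` is the conjugate by `U₁ U₂` of `Z`, a product of the localized discrepancies between the
  -- `S` and the `U`; spreading adds `s` at each conjugation.
  have hXm : X ∈ loc κ (seg L (p - 4 * w) (p + 4 * w)) := by
    set Z := U₂⁻¹ * (S₁⁻¹ * U₁)⁻¹ * U₂⁻¹⁻¹ * ((S₂⁻¹ * U₂)⁻¹ * (S₃⁻¹ * (U₁ * U₂))) with hZ
    have hZm : Z ∈ loc κ (seg L (p - 3 * w) (p + 3 * w)) :=
      mul_mem (loc_mono (seg_mono (by omega) (by omega)) (hU₂.inv.maps _ _ _ (inv_mem e₁)))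
        (loc_mono (seg_mono (by omega) (by omega)) (mul_mem (inv_mem e₂) e₃))
    have e : X = U₁ * U₂ * Z * (U₁ * U₂)⁻¹ := by rw [hX, hZ]; group
    rw [e]
    exact loc_mono (seg_mono (by omega) (by omega)) (hU₁₂.maps _ _ _ hZm)
  -- None of the three factors carries operators from the left of `p` across it, so `X` splits by
  -- `exists_factor`.
  have hXA : Maps X (seg L (p - 4 * w) p) (seg L (p - 4 * w) p) := by
    have h1 : Maps X (seg L (p - 4 * w) p) (seg L (p - 7 * w) p) :=
      ((((m₁ (p - 5 * w - s) (by omega) (by omega)).comp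
        (m₂ (p - 5 * w) (by omega) (by omega))).comp m₃)).mono subset_rfl
        (seg_mono (by omega) le_rfl)
    have h2 : Maps X (seg L (p - 4 * w) p) (seg L (p - 4 * w) (p + 4 * w)) :=
      maps_of_mem hXm subset_rfl (seg_mono le_rfl (by omega))
    exact h1.inter h2 (seg_inter_subset (by omega) (by omega) (by omega) (by omega))
  obtain ⟨τ, hτ, hτ'⟩ := exists_factor hXA
  refine ⟨τ, hτ, τ⁻¹ * X, ?_, by rw [hX]; group⟩
  have h1 : τ⁻¹ * X ∈ loc κ (seg L (p - 4 * w) (p + 4 * w)) :=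
    mul_mem (inv_mem (loc_mono (seg_mono le_rfl (by omega)) hτ)) hXm
  refine mem_loc_of_subset_inter hτ' h1 ?_
  rw [seg_compl (by omega) (by omega)]
  exact seg_inter_subset (by omega) (by omega) (by omega) (by omega)

/-- If an anomalous symmetry fixes, up to phases, a state that is prepared by a local circuit from
a product state with respect to three long intervals, then the anomaly cocycle is a coboundary. -/
theorem exists_cochain_of_fixed {G : Type*} [Group G] {r D r' D' : ℕ} {U : G →* UnitaryOp κ}
    (hU : ∀ g, IsCircuit Finset.univ r D (U g : Op κ)) (R : SymmetryRestriction r D U)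
    {y : UnitaryOp κ} (hy : IsCircuit Finset.univ r' D' (y : Op κ)) {w : ℕ}
    (hw : w = r * D + r' * D') {q : Fin 3 → ℤ} (hq : Spaced L q (100 * w)) {a : ℤ}
    (ha : (a : ZMod L) = R.a) (haq : a + 100 * w ≤ q 0) (haq' : q 0 + 100 * w ≤ a + L)
    {ψ : Config κ → ℂ} (hn : IsNormalized ψ) (hψ : ∀ j, IsProd (pieces L q j) ψ)
    (hfix : ∀ g, ∃ z : ℂ, (U g : Op κ) *ᵥ ((y : Op κ) *ᵥ ψ) = z • ((y : Op κ) *ᵥ ψ))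
    {ω : G → G → G → ℂ}
    (hω : ∀ g h k, ω g h k • ((R.ΩL g h * R.ΩL (g * h) k : UnitaryOp κ) : Op κ) =
      ((R.UM g * R.ΩL h k * (R.UM g)⁻¹ * R.ΩL g (h * k) : UnitaryOp κ) : Op κ)) :
    ∃ ν : G → G → Circle, ∀ g h k, ω g h k * (ν h k * ν g (h * k)) = ν g h * ν (g * h) k := by
  set s : ℕ := r * D with hs
  set t : ℕ := r' * D' with ht
  have hlong : 100 * s ≤ R.n := R.long
  have hlongc : R.n + 100 * s ≤ L := R.long_compl
  -- The part `Y` of `y` on the pieces keeps `ψ` a product vector and is absorbed into `ψ₀`.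
  obtain ⟨y', Y, hyc⟩ := hy.exists_isCut' (q := q) (hq.mono (by omega))
  have hq0 : Spaced L q 0 := hq.mono (by omega)
  set ψ₀ := ((prod3 Y : UnitaryOp κ) : Op κ) *ᵥ ψ with hψ₀
  have hn₀ : IsNormalized ψ₀ := hn.mulVec _
  have hp₀ : ∀ j, IsProd (pieces L q j) ψ₀ := fun j => (hψ j).prod3_mulVec hq0 hyc.V_mem hn
  have hyψ : (y : Op κ) *ᵥ ψ = ((prod3 y' : UnitaryOp κ) : Op κ) *ᵥ ψ₀ := by
    rw [hψ₀, ← coe_mul_mulVec, ← hyc.eq]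
  rw [hyψ] at hfix
  choose u V hcut using fun g => (hU g).exists_isCut' (q := q) (hq.mono (by omega))
  choose S hSU hSψ hSm hSm' using fun g => exists_local_symmetry hw (hq.mono (by omega)) hyc.x_mem
    (hcut g) hn₀ hp₀ (by simpa only [coe_mul_mulVec] using hfix g)
  set p := q 0 with hp
  have hs1 := hq.left
  have hs2 := hq.mid
  have hs3 := hq.right
  choose XA hXA XB hXB hXS using fun g h => exists_local_mul (p := p) (s := s) (w := w)
    (U₁ := U g) (U₂ := U h) (S₁ := S g) (S₂ := S h) (S₃ := S (g * h)) (by omega) (by omega)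
    (by rw [← map_mul]; exact (hcut _).spreads') (hcut h).spreads' (hSU g) (hSU h)
    (by rw [← map_mul]; exact hSU _) (hSm g) (hSm h) (hSm' (g * h))
  set Y₁ : UnitaryOp κ := y' 1 * y' 2 with hY₁
  set ψ₁ := (Y₁ : Op κ) *ᵥ ψ₀ with hψ₁
  have hn₁ : IsNormalized ψ₁ := hn₀.mulVec _
  have hSne : ∀ {T : UnitaryOp κ} {z : ℂ}, (T : Op κ) *ᵥ ψ₁ = z • ψ₁ → z ≠ 0 := fun h => by
    have := norm_eigenvalue hn₁ h
    exact norm_ne_zero_iff.1 (by rw [this]; exact one_ne_zero)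
  have hcomm : ∀ {Z : UnitaryOp κ}, Z ∈ loc κ (seg L (p - 4 * w) (p + 4 * w)) → Z * Y₁ = Y₁ * Z := by
    intro Z hZ
    have c1 := loc_comm (seg_disjoint (by omega) (by omega)) hZ (hyc.x_mem 1)
    have c2' := hyc.x_mem 2
    rw [window_two] at c2'
    have c2 := loc_comm (seg_disjoint (by omega) (by omega)) c2' hZ
    rw [hY₁, ← mul_assoc, c1, mul_assoc, ← c2, mul_assoc]
  -- `XA XB = S g S h S(gh)⁻¹` has `ψ₁ = Y₁ ψ₀` as an eigenvector. It commutes with `Y₁`, so the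
  -- product vector `ψ₀` is an eigenvector as well; then so it is of `XA` alone, and `Y₁` carries
  -- this back to `ψ₁`.
  have hXψ : ∀ g h, ∃ z : ℂ, (XA g h : Op κ) *ᵥ ψ₁ = z • ψ₁ := by
    intro g h
    obtain ⟨z₁, hz₁⟩ := hSψ g
    obtain ⟨z₂, hz₂⟩ := hSψ h
    obtain ⟨z₃, hz₃⟩ := hSψ (g * h)
    have e1 : XA g h * XB g h = S g * (S h * (S (g * h))⁻¹) := by rw [← mul_assoc, hXS]; group
    have hm : XA g h ∈ loc κ (seg L (p - 4 * w) (p + 4 * w)) :=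
      loc_mono (seg_mono le_rfl (by omega)) (hXA g h)
    have hm' : XB g h ∈ loc κ (seg L (p - 4 * w) (p + 4 * w)) :=
      loc_mono (seg_mono (by omega) le_rfl) (hXB g h)
    have e2 : ((XA g h * XB g h : UnitaryOp κ) : Op κ) *ᵥ ψ₁ = (z₃⁻¹ * (z₂ * z₁)) • ψ₁ := by
      rw [e1, coe_mul_mulVec, coe_mul_mulVec, inv_mulVec_eigen (hSne hz₃) hz₃,
        Matrix.mulVec_smul, hz₂, smul_smul, Matrix.mulVec_smul, hz₁, smul_smul, mul_assoc]
    have e3 : ((XA g h * XB g h : UnitaryOp κ) : Op κ) *ᵥ ψ₀ = (z₃⁻¹ * (z₂ * z₁)) • ψ₀ := by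
      have e4 : XA g h * XB g h = Y₁⁻¹ * (XA g h * XB g h * Y₁) := by
        rw [hcomm (mul_mem hm hm')]; group
      rw [e4, coe_mul_mulVec, coe_mul_mulVec _ Y₁, e2, Matrix.mulVec_smul, ← coe_mul_mulVec,
        inv_mul_cancel, Submonoid.coe_one, Matrix.one_mulVec]
    obtain ⟨μ, hμ⟩ := exists_smul_of_isProd (A := pieces L q 2)
      (loc_mono (by rw [pieces_two]; exact seg_mono (by omega) le_rfl) (hXA g h))
      (loc_mono (by rw [pieces_two, seg_compl (by omega) (by omega)]
                    exact seg_mono le_rfl (by omega)) (hXB g h))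
      hn₀.exists_ne_zero (hp₀ 2) e3
    refine ⟨μ, ?_⟩
    rw [hψ₁, ← coe_mul_mulVec, hcomm hm, coe_mul_mulVec, hμ, Matrix.mulVec_smul]
  have hbulk : ∀ g, ∀ l h : ℤ, a + 4 * s ≤ l → h ≤ a + R.n - 4 * s →
      Agree (R.UM g) (U g) (seg L l h) := by
    intro g l h h1 h2
    refine agree_of_inv_mul_mem (mem_loc_iff.2 (R.bulk g)) ?_
    have e : R.a + ((4 * (r * D) : ℕ) : ZMod L) = ((a + 4 * s : ℤ) : ZMod L) := by
      rw [← ha, hs]; push_cast; ring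
    rw [e, arc_intCast]
    exact Finset.sdiff_disjoint.mono_right (seg_mono h1 (by omega))
  -- A gluing point well inside `M`, which has at least `100 * s` sites, and far from the cut, which
  -- is at least `100 * w` beyond `a`.
  set c : ℤ := a + 50 * s with hc
  have hcirc : ∀ g, IsCircuit (arc (a : ZMod L) R.n) r D (R.UM g : Op κ) := fun g => by
    rw [ha]; exact R.isCircuit g
  choose ξ hξ Vl hVl Vr hVr hUM hUMm hUMs using fun g => exists_cut_arc (c := c) rfl (hcirc g)
    (by omega) (by omega) (by omega)
  have hSag : ∀ g, ∀ l : ℤ, a ≤ l → Agree (S g) (U g) (seg L l (p - 2 * w)) := fun g l hl =>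
    agree_of_inv_mul_mem (hSU g) (seg_disjoint (by omega) (by omega)).symm
  choose H hH hHM hHS using fun g => exists_glue (s := s) (w := w) (p := p) (by omega) (by omega)
    (hξ g) (hVl g) (hVr g) (hUM g) (((hUMs g).maps _ _).mono subset_rfl (seg_mono (by omega) (by omega)))
    (hbulk g c (c + 2 * s) (by omega) (by omega))
    ((hSag g c (by omega)).mono (seg_mono le_rfl (by omega)))
    ((hSm g (c + 2 * s) (by omega) (by omega)).mono subset_rfl (seg_mono (by omega) le_rfl))
    (by omega) (by omega) (by omega) (by omega) (by omega)
  have hHU : ∀ g, Agree (H g) (U g) (seg L (a + 4 * s) (p - 2 * w)) := fun g =>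
    agree_union (((hHM g).mono (seg_mono (by omega) le_rfl)).trans
        (hbulk g (a + 4 * s) c le_rfl (by omega)))
      (((hHS g).mono (seg_mono le_rfl (by omega))).trans (hSag g c (by omega)))
      (seg_union (by omega) (by omega)).subset
  have hΩL : ∀ g h, R.ΩL g h ∈ loc κ (seg L a (a + 4 * s)) := fun g h => by
    have := mem_loc_iff.2 (R.suppL g h)
    rw [← ha, arc_intCast] at this
    exact loc_mono (seg_mono le_rfl (by push_cast; omega)) this
  have hΩR : ∀ g h, R.ΩR g h ∈ loc κ (seg L (a + R.n - 4 * s) (a + R.n)) := fun g h => by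
    have := mem_loc_iff.2 (R.suppR g h)
    have e : R.a + ((R.n - 4 * (r * D) : ℕ) : ZMod L) =
        ((a + R.n - 4 * s : ℤ) : ZMod L) := by
      rw [← ha, Nat.cast_sub (by omega), hs]; push_cast; ring
    rw [e, arc_intCast] at this
    exact loc_mono (seg_mono le_rfl (by push_cast; omega)) this
  have mM : ∀ g, Maps (R.UM g) (seg L a (a + 8 * s)) (seg L a (a + 9 * s)) := fun g =>
    ((hUMs g).maps _ _).inter (maps_of_mem (hUMm g) subset_rfl (seg_mono le_rfl (by omega)))
      (seg_inter_subset (by omega) (by omega) (by omega) (by omega))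
  have mS : ∀ g, Maps (S g) (seg L (p - 6 * w) p) (seg L (p - 7 * w) p) := fun g =>
    (hSm g (p - 6 * w) (by omega) (by omega)).mono subset_rfl (seg_mono (by omega) le_rfl)
  have mU : ∀ g, Maps (U g) (seg L (a + 8 * s) (p - 6 * w)) (seg L (a + 7 * s) (p - 5 * w)) :=
    fun g => ((hcut g).spreads'.maps _ _).mono subset_rfl (seg_mono (by omega) (by omega))
  have hHmul := fun g h => glue_mul (s := s) (w := w) (by omega) (by omega) (hH g) (hH h)
    (hH (g * h)) (hHM g) (hHM h) (hHM (g * h)) (hHS g) (hHS h) (hHS (g * h)) (hHU g) (hHU h)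
    (hHU (g * h)) (R.mul_eq g h) (hXS g h) (map_mul U g h).symm (mM h) (mM (g * h)) (mS h)
    (mS (g * h)) (mU h) (mU (g * h)) (hΩL g h) (hΩR g h) (hXA g h) (hXB g h) (by omega) (by omega)
    (by omega) (by omega) (by omega)
  exact exists_cochain_of_glue (I := seg L a (a + 4 * s)) (J := seg L (p - 4 * w) p)
    (J' := seg L (p - 5 * w) p) (seg_disjoint (by omega) (by omega)) hHmul hΩL hXA
    (fun g h k => hHM g _ (loc_mono (seg_mono le_rfl (by omega)) (hΩL h k)))
    (fun g h k => hHS g _ (loc_mono (seg_mono (by omega) le_rfl) (hXA h k)))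
    (seg_disjoint (by omega) (by omega))
    (fun g h k => loc_mono (seg_mono (by omega) le_rfl)
      (hSm g (p - 4 * w) (by omega) (by omega) _ (hXA h k))) hn₁ hSψ hXψ hω

end Core

/-! ### From partitions into intervals to cut points. -/

section Partition

variable {L : ℕ} [NeZero L]

theorem card_seg {l h : ℤ} (h₁ : l ≤ h) (h₂ : h ≤ l + L) : ((seg L l h).card : ℤ) = h - l := by
  rw [seg, Finset.card_image_of_injOn, Int.card_Ico]
  · omega
  · intro k hk k' hk' hkk
    simp only [Finset.coe_Ico, Set.mem_Ico] at hk hk'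
    exact eq_of_intCast_eq hkk (by omega) (by omega)

/-- A proper non-empty interval of the ring that contains the site following the interval
`seg L l h` and is disjoint from it starts at this site. -/
theorem eq_seg_of_mem {l h : ℤ} (hlh : l < h) {T : Finset (ZMod L)} (hT : IsInterval T)
    (hd : Disjoint (seg L l h) T) (hh : (h : ZMod L) ∈ T) : T = seg L h (h + T.card) := by
  obtain ⟨b, n, rfl⟩ := hT
  obtain ⟨b', -, -, rfl⟩ := exists_coord 0 b
  rw [arc_intCast] at hd hh ⊢
  obtain ⟨k, hk1, hk2, hk3⟩ := mem_seg.1 hh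
  -- Otherwise the predecessor of the site `h`, which is the last site of `seg L l h`, would lie in
  -- `T`.
  have hkb : k = b' := by
    by_contra hne
    have h1 : ((k - 1 : ℤ) : ZMod L) ∈ seg L b' (b' + n) := intCast_mem_seg (by omega) (by omega)
    have h2 : ((k - 1 : ℤ) : ZMod L) ∈ seg L l h := by
      rw [Int.cast_sub, hk3, ← Int.cast_sub]
      exact intCast_mem_seg (by omega) (by omega)
    exact Finset.disjoint_left.1 hd h2 h1
  subst hkb
  have hnL : (n : ℤ) ≤ L := by
    by_contra hcon
    have huniv : seg L k (k + n) = Finset.univ :=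
      Finset.univ_subset_iff.1 (by rw [← seg_eq_univ k]; exact seg_mono le_rfl (by omega))
    rw [huniv] at hd
    exact Finset.disjoint_left.1 hd (intCast_mem_seg le_rfl hlh) (Finset.mem_univ _)
  rw [card_seg (by omega) (by omega)]
  have e : ∀ x : ℤ, (x : ZMod L) ∈ seg L k (k + n) ↔ (x : ZMod L) ∈ seg L h (h + n) := by
    intro x
    rw [mem_seg, mem_seg]
    constructor
    · rintro ⟨y, h1, h2, h3⟩
      exact ⟨y - k + h, by omega, by omega, by push_cast; rw [hk3, h3]; ring⟩
    · rintro ⟨y, h1, h2, h3⟩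
      exact ⟨y - h + k, by omega, by omega, by push_cast; rw [hk3, h3]; ring⟩
  ext i
  obtain ⟨x, -, -, rfl⟩ := exists_coord 0 i
  rw [e, add_sub_cancel_left]

theorem exists_cuts {P : Fin 3 → Finset (ZMod L)} (hP : IsPartition P)
    (hI : ∀ j, IsInterval (P j)) {d : ℤ} (hd : ∀ j, d ≤ (P j).card) :
    ∃ q : Fin 3 → ℤ, Spaced L q d ∧ ∀ j, ∃ i, pieces L q j = P i := by
  obtain ⟨hne, hdis, hcov⟩ := hP
  have hpos : ∀ j, 0 < (P j).card := fun j => Finset.card_pos.2 (hne j)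
  have hsum : (P 0).card + (P 1).card + (P 2).card = L := by
    have h01 := Finset.card_union_of_disjoint (hdis 0 1 (by decide))
    have h02 := Finset.card_union_of_disjoint (s := P 0 ∪ P 1) (t := P 2)
      (Finset.disjoint_union_left.2 ⟨hdis 0 2 (by decide), hdis 1 2 (by decide)⟩)
    have hu : P 0 ∪ P 1 ∪ P 2 = Finset.univ := by
      refine Finset.eq_univ_iff_forall.2 fun i => ?_
      obtain ⟨j, hj⟩ := hcov i
      fin_cases j <;> simp_all
    rw [hu, Finset.card_univ, ZMod.card] at h02
    omega
  obtain ⟨b, n₀, hn₀, hb⟩ : ∃ (b : ℤ) (n : ℕ), (P 0).card = n ∧ P 0 = seg L b (b + n) := by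
    obtain ⟨b, n, h⟩ := hI 0
    obtain ⟨b', -, -, rfl⟩ := exists_coord 0 b
    rw [arc_intCast] at h
    rcases le_or_gt n L with hn | hn
    · have := card_seg (L := L) (l := b') (h := b' + n) (by omega) (by omega)
      rw [← h] at this
      exact ⟨b', n, by omega, h⟩
    · have huniv : P 0 = Finset.univ := Finset.univ_subset_iff.1 (by
        rw [h, ← seg_eq_univ b']; exact seg_mono le_rfl (by omega))
      have := hpos 1
      have hc := congrArg Finset.card huniv
      rw [Finset.card_univ, ZMod.card] at hc
      omega
  have p0 := hpos 0
  have p1 := hpos 1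
  have d0 := hd 0
  -- The part that follows `P 0` may be `P 1` or `P 2`; hence the pieces are identified only up to
  -- relabelling.
  obtain ⟨j, hj⟩ := hcov ((b + n₀ : ℤ) : ZMod L)
  have hj0 : j ≠ 0 := by
    rintro rfl
    rw [hb, intCast_mem_seg_iff (m := b) le_rfl (by omega) (by omega) (by omega)] at hj
    omega
  obtain ⟨k, hk, hjk⟩ : ∃ k : Fin 3, k ≠ 0 ∧ j ≠ k := by
    clear * - hj0
    revert j
    decide
  have hs : (P 0).card + (P j).card + (P k).card = L := by
    have : j = 1 ∧ k = 2 ∨ j = 2 ∧ k = 1 := by omega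
    rcases this with ⟨rfl, rfl⟩ | ⟨rfl, rfl⟩ <;> omega
  have pj := hpos j
  have pk := hpos k
  have dj := hd j
  have dk := hd k
  have ej := eq_seg_of_mem (l := b) (h := b + n₀) (by omega) (hI j) (by rw [← hb]; exact hdis 0 j hj0.symm) hj
  obtain ⟨n₁, hn₁⟩ : ∃ n, (P j).card = n := ⟨_, rfl⟩
  obtain ⟨n₂, hn₂⟩ : ∃ n, (P k).card = n := ⟨_, rfl⟩
  rw [hn₁] at ej
  have hmem : ((b + n₀ + n₁ : ℤ) : ZMod L) ∈ P k := by
    obtain ⟨m, hm⟩ := hcov ((b + n₀ + n₁ : ℤ) : ZMod L)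
    have hm0 : m ≠ 0 := by
      rintro rfl
      rw [hb, intCast_mem_seg_iff (m := b) le_rfl (by omega) (by omega) (by omega)] at hm
      omega
    have hmj : m ≠ j := by
      rintro rfl
      rw [ej, intCast_mem_seg_iff (m := b) (by omega) (by omega) (by omega) (by omega)] at hm
      omega
    have : m = k := by omega
    rwa [← this]
  have ek := eq_seg_of_mem (l := b + n₀) (h := b + n₀ + n₁) (by omega) (hI k) (by rw [← ej]; exact hdis j k hjk) hmem
  rw [hn₂] at ek
  refine ⟨![b, b + n₀, b + n₀ + n₁], ⟨?_, ?_, ?_⟩, fun i => ?_⟩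
  · simp; omega
  · simp; omega
  · simp; omega
  · fin_cases i
    · exact ⟨0, hb.symm⟩
    · exact ⟨j, ej.symm⟩
    · refine ⟨k, ?_⟩
      rw [ek]
      show seg L (b + n₀ + n₁) (b + L) = _
      congr 1
      omega

/-- The cuts can be shifted and rotated so that the first of them is far from a given site. -/
theorem exists_cuts_far {q : Fin 3 → ℤ} {w : ℤ} (hw : 0 ≤ w) (hq : Spaced L q (300 * w))
    (a : ZMod L) : ∃ (q' : Fin 3 → ℤ) (a' : ℤ), (a' : ZMod L) = a ∧ Spaced L q' (300 * w) ∧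
      a' + 100 * w ≤ q' 0 ∧ q' 0 + 100 * w ≤ a' + L ∧
      ∀ j, ∃ i, pieces L q' j = pieces L q i := by
  obtain ⟨a', h1, h2, h3⟩ := exists_coord (q 0) a
  obtain ⟨hl, hm, hr⟩ := hq
  have p0 : seg L (q 0 + L) (q 1 + L) = pieces L q 0 := seg_period _ _
  have p1 : seg L (q 1 + L) (q 2 + L) = pieces L q 1 := seg_period _ _
  have p2 : seg L (q 2 + L) (q 0 + L + L) = pieces L q 2 := seg_period _ _
  -- The candidates for the first cut, in the turn that starts at `a'`, are `q 1`, then `q 0 + L`,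
  -- then `q 1 + L`; the spacing excludes failure of all three.
  by_cases c1 : a' + 100 * w ≤ q 1
  · refine ⟨![q 1, q 2, q 0 + L], a', h3, ⟨?_, ?_, ?_⟩, ?_, ?_, fun j => ?_⟩
    · simpa using hm
    · simpa using hr
    · simp; omega
    · simpa using c1
    · simp; omega
    · fin_cases j
      · exact ⟨1, rfl⟩
      · exact ⟨2, rfl⟩
      · exact ⟨0, p0⟩
  by_cases c2 : a' + 100 * w ≤ q 0 + L
  · refine ⟨![q 0 + L, q 1 + L, q 2 + L], a', h3, ⟨?_, ?_, ?_⟩, ?_, ?_, fun j => ?_⟩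
    · simp; omega
    · simp; omega
    · simp; omega
    · simpa using c2
    · simp; omega
    · fin_cases j
      · exact ⟨0, p0⟩
      · exact ⟨1, p1⟩
      · exact ⟨2, p2⟩
  · refine ⟨![q 1 + L, q 2 + L, q 0 + L + L], a', h3, ⟨?_, ?_, ?_⟩, ?_, ?_, fun j => ?_⟩
    · simp; omega
    · simp; omega
    · simp; omega
    · simp; omega
    · simp; omega
    · fin_cases j
      · exact ⟨1, p1⟩
      · exact ⟨2, p2⟩
      · refine ⟨0, ?_⟩
        rw [← p0]
        exact seg_period _ _

end Partition

/-! ### Pure product vectors and normalization. -/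

section ProductStates

variable {L : ℕ} {κ : ZMod L → Type*} [NeZero L] [∀ i, Fintype (κ i)] [∀ i, DecidableEq (κ i)]

theorem IsPureProduct.isProd {k : ℕ} {P : Fin k → Finset (ZMod L)} (hP : IsPartition P)
    {ψ : Config κ → ℂ} (h : IsPureProduct P ψ) (j : Fin k) : IsProd (P j) ψ := by
  obtain ⟨φ, -, hφ⟩ := h
  intro a b
  rw [hφ, hφ, hφ, hφ, ← Finset.prod_mul_distrib, ← Finset.prod_mul_distrib]
  refine Finset.prod_congr rfl fun i _ => ?_
  by_cases hij : i = j
  · subst hij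
    have e : ∀ a b : Config κ, (fun l : P i => (P i).piecewise a b l) = fun l : P i => a l :=
      fun a b => funext fun l => Finset.piecewise_eq_of_mem _ _ _ l.2
    rw [e, e]
  · have e : ∀ a b : Config κ, (fun l : P i => (P j).piecewise a b l) = fun l : P i => b l :=
      fun a b => funext fun l => Finset.piecewise_eq_of_notMem _ _ _
        (Finset.disjoint_left.1 (hP.2.1 i j hij) l.2)
    rw [e, e, mul_comm]

theorem IsPureProduct.exists_ne_zero {k : ℕ} {P : Fin k → Finset (ZMod L)} (hP : IsPartition P)
    {ψ : Config κ → ℂ} (h : IsPureProduct P ψ) : ∃ b, ψ b ≠ 0 := by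
  obtain ⟨φ, hn, hφ⟩ := h
  have hx : ∀ j, ∃ x, φ j x ≠ 0 := by
    intro j
    by_contra hcon
    push Not at hcon
    have := hn j
    simp [hcon] at this
  choose x hx using hx
  choose f hf using hP.2.2
  refine ⟨fun i => x (f i) ⟨i, hf i⟩, ?_⟩
  rw [hφ, Finset.prod_ne_zero_iff]
  intro j _
  -- The index `f l` equals `j` only propositionally, so the dependent values of `x` are
  -- transported.
  have aux : ∀ (l : P j) (m) (_ : m = j) (hl : l.1 ∈ P m), x m ⟨l, hl⟩ = x j l := by
    rintro l _ rfl _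
    rfl
  have e : (fun l : P j => x (f l) ⟨l, hf l⟩) = x j := funext fun l => aux l _ (by
    by_contra hne
    exact Finset.disjoint_left.1 (hP.2.1 _ _ hne) (hf l) l.2) _
  rw [e]
  exact hx j

theorem IsProd.smul {X : Finset (ZMod L)} {ψ : Config κ → ℂ} (h : IsProd X ψ) (z : ℂ) :
    IsProd X (z • ψ) := by
  intro a b
  simp only [Pi.smul_apply, smul_eq_mul]
  linear_combination z * z * h a b

theorem exists_smul_isNormalized {ψ : Config κ → ℂ} (h : ∃ b, ψ b ≠ 0) :
    ∃ z : ℂ, IsNormalized (z • ψ) := by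
  obtain ⟨b, hb⟩ := h
  set N : ℝ := ∑ a, ‖ψ a‖ ^ 2 with hN
  have hpos : 0 < N := Finset.sum_pos' (fun a _ => by positivity)
    ⟨b, Finset.mem_univ _, by have := norm_pos_iff.2 hb; positivity⟩
  have hs : ∑ a, ψ a * star (ψ a) = (N : ℂ) := by
    rw [hN, Complex.ofReal_sum]
    refine Finset.sum_congr rfl fun a _ => ?_
    rw [Complex.ofReal_pow]
    exact RCLike.mul_conj _
  refine ⟨((Real.sqrt N)⁻¹ : ℝ), ?_⟩
  have e : ∀ a, (((Real.sqrt N)⁻¹ : ℝ) : ℂ) * ψ a * star ((((Real.sqrt N)⁻¹ : ℝ) : ℂ) * ψ a) =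
      ((N⁻¹ : ℝ) : ℂ) * (ψ a * star (ψ a)) := by
    intro a
    have h1 : ((N⁻¹ : ℝ) : ℂ) = (((Real.sqrt N)⁻¹ : ℝ) : ℂ) * (((Real.sqrt N)⁻¹ : ℝ) : ℂ) := by
      rw [← Complex.ofReal_mul, ← mul_inv, Real.mul_self_sqrt hpos.le]
    rw [h1, star_mul', show star ((((Real.sqrt N)⁻¹ : ℝ) : ℂ)) = _ from Complex.conj_ofReal _]
    ring
  simp only [IsNormalized, Pi.smul_apply, smul_eq_mul]
  rw [Finset.sum_congr rfl fun a _ => e a, ← Finset.mul_sum, hs, ← Complex.ofReal_mul,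
    inv_mul_cancel₀ hpos.ne', Complex.ofReal_one]

end ProductStates

/-! ### Adjoining ancillas, and eigenvectors in the dilated mixture. -/

section Ancilla

variable {L : ℕ} {κ : ZMod L → Type*} [NeZero L] [∀ i, Fintype (κ i)] [∀ i, DecidableEq (κ i)]
  (m : ZMod L → ℕ)

/-- The sites of the ring enlarged by ancillas. -/
abbrev WithAncilla (κ : ZMod L → Type*) : ZMod L → Type _ := fun i => κ i × Fin (m i)

/-- A configuration of the enlarged ring is a configuration of the ring and one of the ancillas. -/
def ancillaEquiv : Config (WithAncilla m κ) ≃ Config κ × (∀ i, Fin (m i)) where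
  toFun x := (fun i => (x i).1, fun i => (x i).2)
  invFun p := fun i => (p.1 i, p.2 i)
  left_inv _ := rfl
  right_inv _ := rfl

/-- `M ⊗ 1` on the enlarged ring. -/
def ancillaLift (M : Op κ) : Op (WithAncilla m κ) :=
  (Matrix.kroneckerMap (· * ·) M (1 : Matrix (∀ i, Fin (m i)) (∀ i, Fin (m i)) ℂ)).submatrix
    (ancillaEquiv m) (ancillaEquiv m)

theorem ancillaLift_one : ancillaLift m (1 : Op κ) = 1 := by
  rw [ancillaLift, Matrix.one_kronecker_one, Matrix.submatrix_one_equiv]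

theorem ancillaLift_mul (M N : Op κ) :
    ancillaLift m (M * N) = ancillaLift m M * ancillaLift m N := by
  rw [ancillaLift, ancillaLift, ancillaLift, Matrix.submatrix_mul_equiv, ← Matrix.mul_kronecker_mul,
    one_mul]

theorem ancillaLift_conjTranspose (M : Op κ) : ancillaLift m Mᴴ = (ancillaLift m M)ᴴ := by
  rw [ancillaLift, ancillaLift, Matrix.conjTranspose_submatrix, Matrix.conjTranspose_kronecker,
    Matrix.conjTranspose_one]

theorem ancillaLift_smul (z : ℂ) (M : Op κ) : ancillaLift m (z • M) = z • ancillaLift m M := by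
  rw [ancillaLift, Matrix.smul_kronecker]
  rfl

theorem ancillaLift_apply (M : Op κ) (x y : Config (WithAncilla m κ)) :
    ancillaLift m M x y = if ∀ i, (x i).2 = (y i).2 then
      M (fun i => (x i).1) (fun i => (y i).1) else 0 := by
  have e : (∀ i, (x i).2 = (y i).2) ↔ (fun i => (x i).2) = fun i => (y i).2 := funext_iff.symm
  simp only [e]
  show M _ _ * (1 : Matrix _ _ ℂ) _ _ = _
  rw [Matrix.one_apply, mul_ite, mul_one, mul_zero]
  rfl

/-- `u ⊗ 1` on the enlarged ring, for unitary `u`. -/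
def ancillaHom : UnitaryOp κ →* UnitaryOp (WithAncilla m κ) where
  toFun u := ⟨ancillaLift m (u : Op κ), by
    rw [Matrix.mem_unitaryGroup_iff, Matrix.star_eq_conjTranspose, ← ancillaLift_conjTranspose,
      ← ancillaLift_mul, ← Matrix.star_eq_conjTranspose, Matrix.mem_unitaryGroup_iff.1 u.2,
      ancillaLift_one]⟩
  map_one' := Subtype.ext (ancillaLift_one m)
  map_mul' u v := Subtype.ext (ancillaLift_mul m _ _)

theorem coe_ancillaHom (u : UnitaryOp κ) :
    (ancillaHom m u : Op (WithAncilla m κ)) = ancillaLift m (u : Op κ) := rfl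

theorem SupportedOn.ancillaLift {S : Finset (ZMod L)} {M : Op κ} (h : SupportedOn S M) :
    SupportedOn S (ancillaLift m M) := by
  obtain ⟨T, hT⟩ := h
  refine ⟨Matrix.of fun x y => if ∀ i, (x i).2 = (y i).2 then
    T (fun i => (x i).1) (fun i => (y i).1) else 0, fun x y => ?_⟩
  rw [ancillaLift_apply, hT, Matrix.of_apply]
  by_cases h1 : ∀ i, i ∉ S → x i = y i
  · have h2 : (∀ i, (x i).2 = (y i).2) ↔ ∀ i : S, (x i).2 = (y i).2 := by
      refine ⟨fun h i => h i, fun h i => ?_⟩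
      by_cases hi : i ∈ S
      · exact h ⟨i, hi⟩
      · rw [h1 i hi]
    rw [if_pos h1, if_pos fun i hi => by rw [h1 i hi]]
    simp only [h2]
  · rw [if_neg h1]
    split_ifs with h2 h3
    · exact absurd (fun i hi => Prod.ext (h3 i hi) (h2 i)) h1
    · rfl
    · rfl

theorem IsLayer.ancillaLift {S : Finset (ZMod L)} {r : ℕ} {W : Op κ} (h : IsLayer S r W) :
    IsLayer S r (ancillaLift m W) := by
  obtain ⟨N, a, n, u, h1, h2, rfl⟩ := h
  refine ⟨N, a, n, fun j => ancillaHom m (u j), fun j => ⟨(h1 j).1, (h1 j).2.1,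
    (h1 j).2.2.ancillaLift m⟩, h2, ?_⟩
  let φ : Op κ →* Op (WithAncilla m κ) :=
    { toFun := SpinRing.ancillaLift m
      map_one' := ancillaLift_one m
      map_mul' := ancillaLift_mul m }
  show φ _ = _
  rw [map_list_prod, List.map_ofFn]
  rfl

theorem IsCircuit.ancillaLift {S : Finset (ZMod L)} {r D : ℕ} {W : Op κ} (h : IsCircuit S r D W) :
    IsCircuit S r D (ancillaLift m W) := by
  induction D generalizing W with
  | zero =>
    obtain rfl : W = 1 := h
    exact ancillaLift_one m
  | succ D ih =>
    obtain ⟨V, W', hV, hW', rfl⟩ := h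
    exact ⟨_, _, hV.ancillaLift m, ih hW', ancillaLift_mul m _ _⟩

/-- The restriction of a symmetry, on the enlarged ring. -/
def SymmetryRestriction.ancillaLift {G : Type*} [Group G] {r D : ℕ} {U : G →* UnitaryOp κ}
    (R : SymmetryRestriction r D U) : SymmetryRestriction r D ((ancillaHom m).comp U) where
  a := R.a
  n := R.n
  long := R.long
  long_compl := R.long_compl
  UM g := ancillaHom m (R.UM g)
  isCircuit g := (R.isCircuit g).ancillaLift m
  bulk g := by
    rw [MonoidHom.comp_apply, ← map_inv, ← map_mul]
    exact (R.bulk g).ancillaLift m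
  ΩL g h := ancillaHom m (R.ΩL g h)
  ΩR g h := ancillaHom m (R.ΩR g h)
  suppL g h := (R.suppL g h).ancillaLift m
  suppR g h := (R.suppR g h).ancillaLift m
  mul_eq g h := by rw [← map_mul, ← map_mul, ← map_mul, R.mul_eq]

/-- `ψ ⊗ |e⟩` on the enlarged ring. -/
def adjoinVector {m : ZMod L → ℕ} (e : ∀ i, Fin (m i)) (ψ : Config κ → ℂ) :
    Config (WithAncilla m κ) → ℂ :=
  fun x => if ∀ i, (x i).2 = e i then ψ fun i => (x i).1 else 0

variable {m}

theorem adjoinAncilla_vecMulVec (e : ∀ i, Fin (m i)) (ψ : Config κ → ℂ) :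
    adjoinAncilla e (Matrix.vecMulVec ψ (star ψ)) =
      Matrix.vecMulVec (adjoinVector e ψ) (star (adjoinVector e ψ)) := by
  ext x y
  simp only [adjoinAncilla, Matrix.of_apply, Matrix.vecMulVec_apply, adjoinVector, Pi.star_apply]
  by_cases hx : ∀ i, (x i).2 = e i <;> by_cases hy : ∀ i, (y i).2 = e i <;> simp [hx, hy]

theorem ite_mul_ite_eq (p₁ p₂ p₃ p₄ : Prop) [Decidable (p₁ ∧ p₄)] [Decidable (p₃ ∧ p₂)]
    [Decidable (p₁ ∧ p₂)] [Decidable (p₃ ∧ p₄)] {x y z w : ℂ} (h : x * y = z * w) :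
    (if p₁ ∧ p₄ then x else 0) * (if p₃ ∧ p₂ then y else 0) =
      (if p₁ ∧ p₂ then z else 0) * if p₃ ∧ p₄ then w else 0 := by
  by_cases h1 : p₁ <;> by_cases h2 : p₂ <;> by_cases h3 : p₃ <;> by_cases h4 : p₄ <;>
    simp [h1, h2, h3, h4, h]

theorem IsProd.adjoinVector {X : Finset (ZMod L)} {ψ : Config κ → ℂ} (h : IsProd X ψ)
    (e : ∀ i, Fin (m i)) : IsProd X (adjoinVector e ψ) := by
  intro a b
  have hfst : ∀ a b : Config (WithAncilla m κ), (fun i => (X.piecewise a b i).1) =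
      X.piecewise (fun i => (a i).1) (fun i => (b i).1) := by
    intro a b
    funext i
    by_cases hi : i ∈ X
    · rw [Finset.piecewise_eq_of_mem _ _ _ hi, Finset.piecewise_eq_of_mem _ _ _ hi]
    · rw [Finset.piecewise_eq_of_notMem _ _ _ hi, Finset.piecewise_eq_of_notMem _ _ _ hi]
  have hsnd : ∀ a b : Config (WithAncilla m κ), (∀ i, (X.piecewise a b i).2 = e i) ↔
      (∀ i ∈ X, (a i).2 = e i) ∧ ∀ i, i ∉ X → (b i).2 = e i := by
    intro a b
    constructor
    · intro h
      refine ⟨fun i hi => ?_, fun i hi => ?_⟩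
      · have := h i; rwa [Finset.piecewise_eq_of_mem _ _ _ hi] at this
      · have := h i; rwa [Finset.piecewise_eq_of_notMem _ _ _ hi] at this
    · rintro ⟨h1, h2⟩ i
      by_cases hi : i ∈ X
      · rw [Finset.piecewise_eq_of_mem _ _ _ hi]; exact h1 i hi
      · rw [Finset.piecewise_eq_of_notMem _ _ _ hi]; exact h2 i hi
  have hall : ∀ a : Config (WithAncilla m κ), (∀ i, (a i).2 = e i) ↔
      (∀ i ∈ X, (a i).2 = e i) ∧ ∀ i, i ∉ X → (a i).2 = e i := by
    intro a
    exact ⟨fun h => ⟨fun i _ => h i, fun i _ => h i⟩, fun h i =>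
      (em (i ∈ X)).elim (h.1 i) (h.2 i)⟩
  simp only [SpinRing.adjoinVector, hfst, hsnd, hall a, hall b]
  have := h (fun i => (a i).1) fun i => (b i).1
  exact ite_mul_ite_eq _ _ _ _ this

theorem adjoinVector_ne_zero (e : ∀ i, Fin (m i)) {ψ : Config κ → ℂ} (h : ∃ b, ψ b ≠ 0) :
    ∃ b, adjoinVector e ψ b ≠ 0 := by
  obtain ⟨b, hb⟩ := h
  exact ⟨fun i => (b i, e i), by simpa [adjoinVector] using hb⟩

/-- An operator that multiplies the output of a channel by a scalar multiplies every pure state in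
its unravelling by the same scalar. -/
theorem ancillaLift_mulVec_eq {N : ℕ} {p : Fin N → ℝ} (hp : ∀ α, 0 ≤ p α)
    {Ψ : Fin N → Config (WithAncilla m κ) → ℂ} {ρ M : Op κ} {c : ℂ} (hM : M * ρ = c • ρ)
    (hρ : ρ = traceAncilla (∑ α, (p α : ℂ) • Matrix.vecMulVec (Ψ α) (star (Ψ α)))) {α : Fin N}
    (hα : 0 < p α) : ancillaLift m M *ᵥ Ψ α = c • Ψ α := by
  -- The components of `Ψ α` at a fixed ancilla configuration; the partial trace is the mixture of
  -- their projectors.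
  set χ : Fin N → (∀ i, Fin (m i)) → Config κ → ℂ := fun α s x => Ψ α fun i => (x i, s i) with hχ
  have hρ' : ρ = ∑ α, ∑ s, (p α : ℂ) • Matrix.vecMulVec (χ α s) (star (χ α s)) := by
    rw [hρ]
    ext x y
    simp only [traceAncilla, Matrix.of_apply, Matrix.sum_apply, Matrix.smul_apply,
      Matrix.vecMulVec_apply, Pi.star_apply, hχ]
    exact Finset.sum_comm
  set A : Op κ := M - c • 1 with hA
  -- The diagonal entries of `A ρ Aᴴ` are sums of nonnegative terms, so `A` annihilates every
  -- component with positive weight.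
  have hAρ : A * ρ * Aᴴ = 0 := by
    rw [hA, Matrix.sub_mul, hM, Matrix.smul_mul, Matrix.one_mul, sub_self, Matrix.zero_mul]
  have hentry : ∀ x, ∑ α, ∑ s, p α * ‖(A *ᵥ χ α s) x‖ ^ 2 = 0 := by
    intro x
    have h1 := congrFun (congrFun hAρ x) x
    rw [hρ', Matrix.mul_sum, Matrix.sum_mul, Matrix.sum_apply, Matrix.zero_apply] at h1
    have h2 : ∀ α, (A * (∑ s, (p α : ℂ) • Matrix.vecMulVec (χ α s) (star (χ α s))) * Aᴴ) x x =
        ((∑ s, p α * ‖(A *ᵥ χ α s) x‖ ^ 2 : ℝ) : ℂ) := by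
      intro α
      rw [Matrix.mul_sum, Matrix.sum_mul, Matrix.sum_apply, Complex.ofReal_sum]
      refine Finset.sum_congr rfl fun s _ => ?_
      rw [Matrix.mul_smul, Matrix.smul_mul, Matrix.smul_apply, Matrix.mul_vecMulVec,
        Matrix.vecMulVec_mul, ← Matrix.star_mulVec, Matrix.vecMulVec_apply, Pi.star_apply,
        smul_eq_mul, Complex.ofReal_mul, Complex.ofReal_pow]
      congr 1
      exact RCLike.mul_conj _
    rw [Finset.sum_congr rfl fun α _ => h2 α] at h1
    exact_mod_cast h1
  have hzero : ∀ s, A *ᵥ χ α s = 0 := by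
    intro s
    funext x
    have h1 := (Finset.sum_eq_zero_iff_of_nonneg fun α _ => Finset.sum_nonneg fun s _ =>
      mul_nonneg (hp α) (sq_nonneg _)).1 (hentry x) α (Finset.mem_univ _)
    have h2 := (Finset.sum_eq_zero_iff_of_nonneg fun s _ =>
      mul_nonneg (hp α) (sq_nonneg _)).1 h1 s (Finset.mem_univ _)
    simpa [hα.ne'] using h2
  funext x
  have h3 := congrFun (hzero fun i => (x i).2) fun i => (x i).1
  rw [hA, Matrix.sub_mulVec, Matrix.smul_mulVec, Matrix.one_mulVec, Pi.zero_apply, Pi.sub_apply,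
    sub_eq_zero] at h3
  rw [Pi.smul_apply]
  refine Eq.trans ?_ h3
  rw [Matrix.mulVec, dotProduct, ← (ancillaEquiv (κ := κ) m).symm.sum_comp, Fintype.sum_prod_type]
  refine Finset.sum_congr rfl fun y _ => ?_
  rw [Finset.sum_eq_single fun i => (x i).2]
  · exact congrArg (· * Ψ α _) ((ancillaLift_apply m M x _).trans (if_pos fun i => rfl))
  · intro s _ hs
    rw [ancillaLift_apply, if_neg, zero_mul]
    intro h
    exact hs (funext fun i => (h i).symm)
  · intro h
    exact absurd (Finset.mem_univ _) h

end Ancilla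

/-! ### Coboundaries have trivial class. -/

section Cohomology

open CategoryTheory

/-- A `3`-cocycle with values in `U(1)` that is the coboundary of a `2`-cochain has trivial
class. -/
theorem π_cocyclesMk_eq_zero {G : Type} [Group G] (ω : (Fin 3 → G) → Additive Circle)
    (hω : inhomogeneousCochains.d (trivialU1 G) 3 ω = 0) (ν : G → G → Circle)
    (h : ∀ g h k, ((Additive.toMul (ω ![g, h, k]) : Circle) : ℂ) * (ν h k * ν g (h * k)) =
      ν g h * ν (g * h) k) :
    groupCohomology.π (trivialU1 G) 3 (groupCohomology.cocyclesMk ω hω) = 0 := by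
  -- The inverse of `ν` is needed: additively, the hypothesis says that `ω` is minus the
  -- differential of `ν`.
  let f : (Fin 2 → G) → Additive Circle := fun x => Additive.ofMul (ν (x 0) (x 1))⁻¹
  have hf : inhomogeneousCochains.d (trivialU1 G) 2 f = ω := by
    funext x
    have h1 : Additive.toMul (ω ![x 0, x 1, x 2]) * (ν (x 1) (x 2) * ν (x 0) (x 1 * x 2)) =
      ν (x 0) (x 1) * ν (x 0 * x 1) (x 2) := Circle.ext (by push_cast; exact h _ _ _)
    have hx : x = ![x 0, x 1, x 2] := by ext i; fin_cases i <;> rfl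
    have h2 := congrArg Additive.ofMul h1
    simp only [ofMul_mul, ofMul_toMul] at h2
    rw [← hx] at h2
    rw [inhomogeneousCochains.d_hom_apply]
    simp [f, Fin.sum_univ_three]
    simp [Fin.contractNth]
    rw [eq_sub_of_add_eq h2]
    abel
  have e : groupCohomology.cocyclesMk ω hω = groupCohomology.toCocycles (trivialU1 G) 2 3 f := by
    apply (ModuleCat.mono_iff_injective (groupCohomology.iCocycles (trivialU1 G) 3)).1 inferInstance
    rw [groupCohomology.iCocycles_mk]
    have := congrArg (fun F => F.hom f)
      (HomologicalComplex.toCycles_i (groupCohomology.inhomogeneousCochains (trivialU1 G)) 2 3)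
    rw [groupCohomology.inhomogeneousCochains.d_def] at this
    exact (this.trans hf).symm
  rw [e]
  exact congrArg (fun F => F.hom f) (HomologicalComplex.toCycles_comp_homologyπ
    (groupCohomology.inhomogeneousCochains (trivialU1 G)) 2 3)

end Cohomology

/-! ### Reduction of the channel statement to a fixed pure state. -/

section Channel

variable {L : ℕ} {κ : ZMod L → Type*} [NeZero L] [∀ i, Fintype (κ i)] [∀ i, DecidableEq (κ i)]

theorem mul_adjoinAncilla_mul {m : ZMod L → ℕ} {N : ℕ} (p : Fin N → ℝ)
    (ψ : Fin N → Config κ → ℂ) (e : ∀ i, Fin (m i)) (V : Op (WithAncilla m κ)) :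
    V * adjoinAncilla e (∑ α, (p α : ℂ) • Matrix.vecMulVec (ψ α) (star (ψ α))) * Vᴴ =
      ∑ α, (p α : ℂ) • Matrix.vecMulVec (V *ᵥ adjoinVector e (ψ α))
        (star (V *ᵥ adjoinVector e (ψ α))) := by
  have h1 : adjoinAncilla e (∑ α, (p α : ℂ) • Matrix.vecMulVec (ψ α) (star (ψ α))) =
      ∑ α, (p α : ℂ) • adjoinAncilla e (Matrix.vecMulVec (ψ α) (star (ψ α))) := by
    ext x y
    rw [Matrix.sum_apply]
    simp only [adjoinAncilla, Matrix.of_apply, Matrix.smul_apply, Matrix.sum_apply]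
    split_ifs <;> simp
  rw [h1, Matrix.mul_sum, Matrix.sum_mul]
  refine Finset.sum_congr rfl fun α _ => ?_
  rw [adjoinAncilla_vecMulVec, Matrix.mul_smul, Matrix.smul_mul, Matrix.mul_vecMulVec,
    Matrix.vecMulVec_mul, ← Matrix.star_mulVec]

/-- The identity channel. -/
theorem isLocalChannel_id : IsLocalChannel (κ := κ) 0 0 fun ρ => ρ := by
  refine ⟨fun _ => 1, fun _ => 0, 1, rfl, fun ρ => ?_⟩
  rw [Matrix.conjTranspose_one, mul_one, one_mul]
  ext x y
  simp [traceAncilla, adjoinAncilla]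

/-- A strongly symmetric state of an anomalous symmetry is not the image of a tripartite separable
state under a local channel of small range. -/
theorem ne_channel_of_isSeparable {G : Type} [Group G] {r D : ℕ} {U : G →* UnitaryOp κ}
    (hU : ∀ g, IsCircuit Finset.univ r D (U g : Op κ)) {c : H3U1 G} (hc : IsAnomalyClass r D U c)
    (hc0 : c ≠ 0) {ρ : Op κ} (hρ : StronglySymmetric U ρ) {r' D' : ℕ} {E : Op κ → Op κ}
    (hE : IsLocalChannel r' D' E) {P : Fin 3 → Finset (ZMod L)} (hP : IsPartition P)
    (hI : ∀ j, IsInterval (P j)) (hcard : ∀ j, 300 * (r * D + r' * D') ≤ (P j).card) {ρ₀ : Op κ}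
    (hsep : IsSeparable P ρ₀) : ρ ≠ E ρ₀ := by
  intro hρE
  obtain ⟨R, ω, hω, hωR, rfl⟩ := hc
  obtain ⟨m, e, V, hV, hE⟩ := hE
  obtain ⟨N, p, ψ, hp, hp1, hψ, rfl⟩ := hsep
  rw [hE, mul_adjoinAncilla_mul] at hρE
  obtain ⟨α, hα⟩ : ∃ α, 0 < p α := by
    by_contra hcon
    push Not at hcon
    have : ∑ α, p α ≤ 0 := Finset.sum_nonpos fun α _ => hcon α
    linarith
  obtain ⟨q₀, hq₀, hqP⟩ := exists_cuts hP hI (d := 300 * (r * D + r' * D' : ℕ))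
    fun j => by exact_mod_cast hcard j
  -- The first cut must stay away from the left end of `M` to leave room for gluing.
  obtain ⟨q, a, ha, hq, haq, haq', hqq⟩ := exists_cuts_far (by positivity) hq₀ R.a
  set φ := adjoinVector e (ψ α) with hφ
  obtain ⟨z, hz⟩ := exists_smul_isNormalized
    (adjoinVector_ne_zero e ((hψ α).exists_ne_zero hP))
  have hzp : ∀ j, IsProd (pieces L q j) (z • φ) := by
    intro j
    obtain ⟨i, hi⟩ := hqq j
    obtain ⟨l, hl⟩ := hqP i
    rw [hi, hl]
    exact (((hψ α).isProd hP l).adjoinVector e).smul z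
  -- Used only to present the circuit `V` as an element of the unitary group.
  obtain ⟨y, -, -, rfl, -⟩ := hV.exists_isCut (q := q) (hq.mono (by omega))
  obtain ⟨ν, hν⟩ := exists_cochain_of_fixed (κ := WithAncilla m κ) (U := (ancillaHom m).comp U)
    (fun g => (hU g).ancillaLift m) (R.ancillaLift m) hV rfl (hq.mono (by omega)) ha haq haq' hz hzp
    (fun g => by
      obtain ⟨k, hk⟩ := hρ g
      refine ⟨k, ?_⟩
      have := ancillaLift_mulVec_eq hp hk hρE hα
      rw [Matrix.mulVec_smul, Matrix.mulVec_smul, smul_comm k z, ← this]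
      rfl)
    (ω := fun g h k => ((Additive.toMul (ω ![g, h, k]) : Circle) : ℂ)) (fun g h k => by
      have := congrArg (ancillaLift m) (hωR g h k)
      rw [ancillaLift_smul, ← coe_ancillaHom, ← coe_ancillaHom, map_mul, map_mul, map_mul, map_mul,
        map_inv] at this
      exact this)
  exact hc0 (π_cocyclesMk_eq_zero ω hω ν hν)

end Channel

end SpinRing

end

theorem theorem1 :
    ∃ K : ℕ,
      ∀ (G : Type) [Group G] (L : ℕ) [NeZero L] (κ : ZMod L → Type*)
        [∀ i, Fintype (κ i)] [∀ i, DecidableEq (κ i)] (r D : ℕ)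
        (U : G →* Matrix.unitaryGroup (SpinRing.Config κ) ℂ)
        (_ : ∀ g, SpinRing.IsCircuit Finset.univ r D (U g : SpinRing.Op κ))
        (c : SpinRing.H3U1 G) (_ : SpinRing.IsAnomalyClass r D U c) (_ : c ≠ 0)
        (ρ : SpinRing.Op κ) (_ : SpinRing.IsState ρ) (_ : SpinRing.StronglySymmetric U ρ),
        (∀ P : Fin 3 → Finset (ZMod L), SpinRing.IsPartition P →
          (∀ j, SpinRing.IsInterval (P j)) → (∀ j, K * (r * D) ≤ (P j).card) →
          ¬ SpinRing.IsSeparable P ρ) ∧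
        (∀ (r' D' : ℕ) (E : SpinRing.Op κ → SpinRing.Op κ), SpinRing.IsLocalChannel r' D' E →
          ∀ P : Fin 3 → Finset (ZMod L), SpinRing.IsPartition P →
          (∀ j, SpinRing.IsInterval (P j)) → (∀ j, K * (r * D + r' * D') ≤ (P j).card) →
          ∀ ρ₀ : SpinRing.Op κ, SpinRing.IsSeparable P ρ₀ → ρ ≠ E ρ₀) := by
  -- 300 is the spacing assumed by `exists_cuts_far`, ample for keeping some cut at distance 100
  -- from the end of `M`, in units of `r * D + r' * D'`.
  refine ⟨300, fun G _ L _ κ _ _ r D U hU c hc hc0 ρ _ hρ => ⟨fun P hP hI hcard hsep => ?_, ?_⟩⟩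
  · exact SpinRing.ne_channel_of_isSeparable hU hc hc0 hρ SpinRing.isLocalChannel_id hP hI
      (by simpa using hcard) hsep rfl
  · exact fun r' D' E hE P hP hI hcard ρ₀ hsep =>
      SpinRing.ne_channel_of_isSeparable hU hc hc0 hρ hE hP hI hcard hsep
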